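/- **Theorem (polynomial approximation barrier).** Let $\beta,c>0$ and put $M=\lfloor 2/\beta\rfloor$. *Inputs.* For each $n$ let $\Sigma_n\in\mathbb R^{d_n\times d_n}$ be positive semi-definite with $\|\Sigma_n\|_{\mathrm{op}}=1$, let $r_n=\operatorname{tr}(\Sigma_n)/\|\Sigma_n\|_{\mathrm{op}}$ be its effective dimension, and assume $r_n/n^\beta\to c$. Let $W$ be a random vector in $\mathbb R^{d_n}$ with i.i.d. coordinates whose law is either standard normal or centered with unit variance and supported in $[-B,B]$, with $B$ independent of $n$. The input distribution $P_n$ is either the law of $X=\Sigma_n^{1/2}W$ for all $n$ (covariance model), or the law of $X=\sqrt{r_n}\,Z/\|Z\|$ with $Z=\Sigma_n^{1/2}W$ for all $n$ (sphere model; $0/0=0$). Put $m=2M$ in the covariance model and $m=M$ in the sphere model. *Kernel.* Let $k(x,x')=g(\|x\|^2,\|x'\|^2,x^\top x')$ with $g$ not depending on the dimension $d$. Assume either that $k(x,x')=\exp(-\|x-x'\|^\alpha)$ for some $\alpha\in(0,2)$, or that $k$ is a positive semi-definite kernel on every $\mathbb R^d$ and, in the covariance model, is continuous and satisfies (i)–(iv),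 for some functions $g_j$ and some $\delta>0$: (i) $k(x,x')=\sum_{j\ge 0}g_j(\|x\|^2,\|x'\|^2)(x^\top x')^j$ whenever $\|x\|^2,\|x'\|^2\in[1-\delta,1+\delta]$, and every $g_j$ is a positive semi-definite kernel on $[1-\delta,1+\delta]$; (ii) $x\mapsto k(x,x)$ is Lipschitz on $\{\|x\|^2\in[1-\delta,1+\delta]\}$, with a constant not depending on $d$; (iii) for $i\le M$, $g_i$ is $(M+1-i)$-times continuously differentiable in a neighbourhood of $(1,1)$; (iv) $g_J(1,1)>0$ for some $J>M$. In the sphere model it is enough that the restriction of $k$ to the unit sphere satisfies these conditions, i.e. that $k(x,x')=\sum_{j\ge0}a_j(x^\top x')^j$ for $\|x\|=\|x'\|=1$, with constants $a_j\ge0$ and $a_J>0$ for some $J>M$. *Estimator.* Let $k_n(x,x')=g(\|x\|^2/r_n,\|x'\|^2/r_n,x^\top x'/r_n)$, with reproducing kernel Hilbert space $\mathcal H_n$. For each $n$ let $x_1,\dots,x_n$ be i.i.d. with law $P_n$ (no assumption on the joint law for different $n$), let $y_i$ be drawn independently given the inputs from a conditional law $\mathbb P_n(Y\mid X=x_i)$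 with finite mean, and let $f^*_n(x)=\mathbb E[Y\mid X=x]$ satisfy $|f_n^*|\le A$ $P_n$-almost everywhere, with $A$ independent of $n$. For $\lambda_n\ge0$ let $\hat f_n$ be the minimizer over $\mathcal H_n$ of $\sum_i(y_i-f(x_i))^2+\lambda_n\|f\|_{\mathcal H_n}^2$ if $\lambda_n>0$, and the interpolant of the data of minimal norm in $\mathcal H_n$ if $\lambda_n=0$. Let $\mathbb E_Y\hat f_n$ be its conditional expectation given the inputs. *Conclusions.* 1. Almost surely, for every $\varepsilon>0$ and all sufficiently large $n$, $$\|\mathbb E_Y\hat f_n-f_n^*\|_{L_2(P_n)}^2\;\ge\;\inf_{\deg p\le m}\|f_n^*-p\|_{L_2(P_n)}^2-\varepsilon .$$ 2. If $k_n$ is bounded on the support of $P_n$ uniformly in $n$, then almost surely there are polynomials $p_n$ of degree at most $m$ (depending on the inputs) such that $\|\mathbb E_Y\hat f_n-p_n\|_{L_2(P_n)}\to0$ as $n\to\infty$. -/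

import Mathlib

open Filter Topology MeasureTheory ProbabilityTheory
open scoped NNReal ENNReal Matrix

noncomputable section

namespace PolyBarrier

/-- The input space `ℝ^d` with its Euclidean norm. -/
abbrev E (d : ℕ) : Type := EuclideanSpace ℝ (Fin d)

/-! ### Kernels -/

/-- A real kernel is positive semi-definite on `S` if all kernel matrices at finitely many points
of `S` are (symmetric and) positive semi-definite. -/
def IsPSDKernelOn {α : Type*} (S : Set α) (k : α → α → ℝ) : Prop :=
  ∀ (N : ℕ) (x : Fin N → α), (∀ i, x i ∈ S) →
    (Matrix.of fun i j => k (x i) (x j)).PosSemidef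

/-- The rotationally invariant kernel `k(x, x') = g(‖x‖², ‖x'‖², xᵀx')` on `ℝ^d`; the function `g`
is the same for all dimensions `d`. -/
def rotKernel (g : ℝ → ℝ → ℝ → ℝ) {d : ℕ} (x x' : E d) : ℝ :=
  g (‖x‖ ^ 2) (‖x'‖ ^ 2) (inner ℝ x x')

/-- The rescaled kernel `k_τ(x, x') = g(‖x‖²/τ, ‖x'‖²/τ, xᵀx'/τ)`. -/
def scaledKernel (g : ℝ → ℝ → ℝ → ℝ) (τ : ℝ) {d : ℕ} (x x' : E d) : ℝ :=
  g (‖x‖ ^ 2 / τ) (‖x'‖ ^ 2 / τ) (inner ℝ x x' / τ)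

/-- The assumptions on a rotationally invariant kernel on the whole space, with coefficient
functions `gc j` of the local power series; `M` stands for `⌊2/β⌋`. -/
structure PowerSeriesKernel (g : ℝ → ℝ → ℝ → ℝ) (gc : ℕ → ℝ → ℝ → ℝ) (M : ℕ) : Prop where
  /-- `k` is a continuous kernel on every `ℝ^d`. -/
  continuous : ∀ d : ℕ, Continuous fun p : E d × E d => rotKernel g p.1 p.2
  /-- `k` is a positive semi-definite kernel on every `ℝ^d`. -/
  posSemidef : ∀ d : ℕ, IsPSDKernelOn Set.univ (rotKernel g (d := d))
  /-- Around the unit sphere `k(x, x') = ∑ⱼ gⱼ(‖x‖², ‖x'‖²) (xᵀx')ʲ` with positive semi-definite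
  coefficients `gⱼ`. -/
  expansion : ∃ δ : ℝ, 0 < δ ∧
    (∀ j, IsPSDKernelOn (Set.Icc (1 - δ) (1 + δ)) (gc j)) ∧
    ∀ (d : ℕ) (x x' : E d), ‖x‖ ^ 2 ∈ Set.Icc (1 - δ) (1 + δ) →
      ‖x'‖ ^ 2 ∈ Set.Icc (1 - δ) (1 + δ) →
      HasSum (fun j : ℕ => gc j (‖x‖ ^ 2) (‖x'‖ ^ 2) * (inner ℝ x x') ^ j) (rotKernel g x x')
  /-- Restricted Lipschitz continuity: `x ↦ k(x, x)` is Lipschitz around the unit sphere. -/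
  lipschitz : ∃ δ : ℝ, 0 < δ ∧ ∃ L : ℝ≥0, ∀ d : ℕ,
    LipschitzOnWith L (fun x : E d => rotKernel g x x)
      {x | ‖x‖ ^ 2 ∈ Set.Icc (1 - δ) (1 + δ)}
  /-- `gᵢ` is `(M + 1 - i)`-times continuously differentiable in a neighbourhood of `(1, 1)`. -/
  smooth : ∀ i ≤ M, ∃ U ∈ 𝓝 ((1 : ℝ), (1 : ℝ)),
    ContDiffOn ℝ ((M + 1 - i : ℕ) : WithTop ℕ∞) (fun p : ℝ × ℝ => gc i p.1 p.2) U
  /-- Some coefficient of order larger than `M` is positive at `(1, 1)`. -/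
  pos : ∃ J > M, 0 < gc J 1 1

/-- The same assumptions for the restriction of the kernel to the unit sphere only. There the
coefficients `gⱼ(1, 1)` are numbers `a j`; positive semi-definiteness says `0 ≤ a j`, and
`k(x, x)` being constant, the continuity, Lipschitz and smoothness requirements are automatic.
Nothing is assumed of `k` off the unit sphere except that it is a kernel on `ℝ^d` (a kernel that is
given only on the unit sphere may be extended by zero). -/
structure SpherePowerSeriesKernel (g : ℝ → ℝ → ℝ → ℝ) (a : ℕ → ℝ) (M : ℕ) : Prop where
  posSemidef : ∀ d : ℕ, IsPSDKernelOn Set.univ (rotKernel g (d := d))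
  nonneg : ∀ j, 0 ≤ a j
  expansion : ∀ (d : ℕ) (x x' : E d), ‖x‖ = 1 → ‖x'‖ = 1 →
    HasSum (fun j : ℕ => a j * (inner ℝ x x') ^ j) (rotKernel g x x')
  pos : ∃ J > M, 0 < a J

/-- `k(x, x') = exp(-‖x - x'‖^α)` in every dimension. -/
def IsAlphaExponential (g : ℝ → ℝ → ℝ → ℝ) (α : ℝ) : Prop :=
  ∀ (d : ℕ) (x x' : E d), rotKernel g x x' = Real.exp (-‖x - x'‖ ^ α)

/-! ### Input distributions -/

/-- The spectral norm of a square matrix. -/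
def opNorm {d : ℕ} (S : Matrix (Fin d) (Fin d) ℝ) : ℝ :=
  ‖Matrix.toEuclideanCLM (n := Fin d) (𝕜 := ℝ) S‖

/-- The effective dimension `tr Σ / ‖Σ‖`. -/
def effDim {d : ℕ} (S : Matrix (Fin d) (Fin d) ℝ) : ℝ := S.trace / opNorm S

/-- The admissible laws of the i.i.d. coordinates: standard normal, or supported in `[-B, B]` with
zero mean and unit variance. -/
def IsEntryLaw (B : ℝ) (ν : Measure ℝ) : Prop :=
  ν = gaussianReal 0 1 ∨
    ((∀ᵐ w ∂ν, |w| ≤ B) ∧ ∫ w, w ∂ν = 0 ∧ ∫ w, w ^ 2 ∂ν = 1)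

/-- The law of `Σ^{1/2} W` where `W` has i.i.d. coordinates of law `ν` and `R = Σ^{1/2}`. -/
def covLaw {d : ℕ} (ν : Measure ℝ) (R : Matrix (Fin d) (Fin d) ℝ) : Measure (E d) :=
  (Measure.pi fun _ : Fin d => ν).map fun w => WithLp.toLp 2 (R *ᵥ w)

/-- The law of `√r · Z/‖Z‖` where `Z` has law `Q` (with the convention `0/0 = 0`). -/
def sphereLaw {d : ℕ} (r : ℝ) (Q : Measure (E d)) : Measure (E d) :=
  Q.map fun z => Real.sqrt r • (‖z‖⁻¹ • z)

/-- The two types of input distributions: the covariance model and its projection to the sphere. -/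
inductive DataModel
  | covariance
  | sphere

/-- The input distribution with covariance matrix `S`, whose positive semi-definite square root is
`R`, and coordinate law `ν`. -/
def DataModel.law (model : DataModel) {d : ℕ} (ν : Measure ℝ) (S R : Matrix (Fin d) (Fin d) ℝ) :
    Measure (E d) :=
  match model with
  | .covariance => covLaw ν R
  | .sphere => sphereLaw (effDim S) (covLaw ν R)

/-- The degree of the barrier: `2⌊2/β⌋` in the covariance model, `⌊2/β⌋` on the sphere. -/
def DataModel.degree (model : DataModel) (β : ℝ) : ℕ :=
  match model with
  | .covariance => 2 * ⌊2 / β⌋₊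
  | .sphere => ⌊2 / β⌋₊

/-- The kernel, respectively (sphere model) its restriction to the unit sphere, has the required
local power series, or the kernel is `α`-exponential with `α ∈ (0, 2)`. -/
def DataModel.AdmissibleKernel (model : DataModel) (β : ℝ) (g : ℝ → ℝ → ℝ → ℝ) : Prop :=
  (match model with
    | .covariance => ∃ gc : ℕ → ℝ → ℝ → ℝ, PowerSeriesKernel g gc ⌊2 / β⌋₊
    | .sphere => ∃ a : ℕ → ℝ, SpherePowerSeriesKernel g a ⌊2 / β⌋₊) ∨
  ∃ α : ℝ, 0 < α ∧ α < 2 ∧ IsAlphaExponential g α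

/-! ### Kernel regression -/

/-- A real kernel as a matrix of operators on `ℝ`. -/
def kernelMatrix {X : Type*} (k : X → X → ℝ) : Matrix X X (ℝ →L[ℝ] ℝ) :=
  Matrix.of fun x x' => k x x' • ContinuousLinearMap.id ℝ ℝ

/-- The function `f` is the kernel regression estimate with ridge parameter `lam` for the data
`(xs i, ys i)`: it is an element of the reproducing kernel Hilbert space of `k` which
for `lam > 0` minimizes `∑ᵢ (yᵢ - f(xᵢ))² + lam ‖f‖²`, and
for `lam = 0` has minimal norm among the interpolants of the data. -/
def IsKernelEstimate {X : Type*} (k : X → X → ℝ) (lam : ℝ) {n : ℕ} (xs : Fin n → X)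
    (ys : Fin n → ℝ) (f : X → ℝ) : Prop :=
  ∃ _ : Fact (kernelMatrix k).PosSemidef, ∃ F : RKHS.OfKernel (kernelMatrix k),
    (∀ x, F x = f x) ∧
    ((0 < lam ∧ ∀ G : RKHS.OfKernel (kernelMatrix k),
        ∑ i, (ys i - F (xs i)) ^ 2 + lam * ‖F‖ ^ 2 ≤ ∑ i, (ys i - G (xs i)) ^ 2 + lam * ‖G‖ ^ 2) ∨
     (lam = 0 ∧ (∀ i, F (xs i) = ys i) ∧
        ∀ G : RKHS.OfKernel (kernelMatrix k), (∀ i, G (xs i) = ys i) → ‖F‖ ≤ ‖G‖))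

open Classical in
/-- The kernel regression estimate. (If it does not exist, which can happen only for `lam = 0` and
a singular kernel matrix, the value is `0`.) -/
def kernelEstimate {X : Type*} (k : X → X → ℝ) (lam : ℝ) {n : ℕ} (xs : Fin n → X)
    (ys : Fin n → ℝ) : X → ℝ :=
  if h : ∃ f, IsKernelEstimate k lam xs ys f then h.choose else 0

/-- The ground truth `f*(x) = 𝔼[y | X = x]`, where `κ x` is the law of `y` given `X = x`. -/
def groundTruth {d : ℕ} (κ : Kernel (E d) ℝ) (x : E d) : ℝ := ∫ y, y ∂(κ x)

/-- The averaged estimator: the conditional expectation of the estimate given the inputs `xs`, over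
independent observations `yᵢ` of law `κ (xs i)`. -/
def averagedEstimate {d : ℕ} (k : E d → E d → ℝ) (lam : ℝ) (κ : Kernel (E d) ℝ) {n : ℕ}
    (xs : Fin n → E d) (x : E d) : ℝ :=
  ∫ ys : Fin n → ℝ, kernelEstimate k lam xs ys x ∂(Measure.pi fun i => κ (xs i))

/-- The bias `‖𝔼_Y f̂ - f*‖²` in `L²(P)`. -/
def bias {d : ℕ} (P : Measure (E d)) (k : E d → E d → ℝ) (lam : ℝ) (κ : Kernel (E d) ℝ) {n : ℕ}
    (xs : Fin n → E d) : ℝ≥0∞ :=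
  eLpNorm (fun x => averagedEstimate k lam κ xs x - groundTruth κ x) 2 P ^ 2

/-- The squared `L²(P)`-distance of `f` to the polynomials of degree at most `m`. -/
def polyDistSq {d : ℕ} (P : Measure (E d)) (f : E d → ℝ) (m : ℕ) : ℝ≥0∞ :=
  ⨅ (p : MvPolynomial (Fin d) ℝ) (_ : p.totalDegree ≤ m),
    eLpNorm (fun x => f x - MvPolynomial.eval (fun i => x i) p) 2 P ^ 2

end PolyBarrier

end

/-!
After scaling by `r ^ (-1/2)`, the inputs are nearly orthonormal: by the Hanson–Wright moment bound,
Khinchine's inequality and the Borel–Cantelli lemma, almost surely their squared norms are within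
`δ = n ^ (-θ)` of `1` and their inner products are smaller than `δ`, for some `θ < β / 2`. Since
`2 / β < M + 1`, the exponent can be chosen with `n δ ^ (M + 1) → 0`.

On such points a Taylor expansion shows that the kernel, as a function of one argument, is a
polynomial of degree at most `m` up to an error `O(δ ^ (M + 1))`. The part of the power series of
order greater than `M` keeps the kernel matrix above a positive multiple of the identity, so that
the coefficients of the averaged estimate in the kernel expansion have `ℓ¹`-norm `O(n)`. Hence at
typical points the averaged estimate is within `O(n δ ^ (M + 1))` of a polynomial of degree at most
`m`. Atypical points have probability smaller than any fixed power of `n`, and there the moments of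
the input law control the polynomial.

For the `α`-exponential kernel no power series is at hand. It is a positive function times the
exponential of the energy kernel `‖x‖ ^ α + ‖x'‖ ^ α - ‖x - x'‖ ^ α`, an integral of kernels built
from Gaussian ones, and these keep the kernel matrix above a positive multiple of the identity.
-/

noncomputable section

namespace PolyBarrier

section Lp

variable {X : Type*} [MeasurableSpace X] {μ : Measure X}

lemma eLpNorm_natCast_pow_eq_lintegral (f : X → ℝ) {p : ℕ} (hp : p ≠ 0) :
    eLpNorm f p μ ^ p = ∫⁻ x, ‖f x‖ₑ ^ p ∂μ := by
  simpa using eLpNorm_nnreal_pow_eq_lintegral (f := f) (μ := μ) (p := p) (by exact_mod_cast hp)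

lemma eLpNorm_natCast_le_of_lintegral_le {f : X → ℝ} {p : ℕ} (hp : p ≠ 0) {K : ℝ≥0∞}
    (h : ∫⁻ x, ‖f x‖ₑ ^ p ∂μ ≤ K ^ p) : eLpNorm f p μ ≤ K := by
  rw [← eLpNorm_natCast_pow_eq_lintegral f hp] at h
  exact (ENNReal.pow_le_pow_left_iff hp).1 h

lemma eLpNorm_sqrt_sum_sq_sq_le {ι : Type*} [Fintype ι] {f : ι → X → ℝ}
    (hf : ∀ i, AEStronglyMeasurable (f i) μ) {p : ℝ≥0∞} (hp : 1 ≤ p) :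
    eLpNorm (fun x => √(∑ i, f i x ^ 2)) (p * 2) μ ^ 2 ≤ ∑ i, eLpNorm (f i) (p * 2) μ ^ 2 := by
  have eLpNorm_sq (g : X → ℝ) : eLpNorm (fun x => g x ^ 2) p μ = eLpNorm g (p * 2) μ ^ 2 := by
    simpa using eLpNorm_norm_rpow (p := p) (μ := μ) g two_pos
  simp_rw [← eLpNorm_sq]
  calc eLpNorm (fun x => √(∑ i, f i x ^ 2) ^ 2) p μ
      = eLpNorm (∑ i, fun x => f i x ^ 2) p μ := by
        congr 1 with x
        rw [Real.sq_sqrt (Finset.sum_nonneg fun i _ => sq_nonneg _), Finset.sum_apply]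
    _ ≤ ∑ i, eLpNorm (fun x => f i x ^ 2) p μ :=
        eLpNorm_sum_le (fun i _ => (hf i).pow 2) hp

lemma eLpNorm_sub_integral_le [IsProbabilityMeasure μ] {f : X → ℝ} (hf : Integrable f μ) {p : ℕ}
    (hp : p ≠ 0) :
    eLpNorm (fun x => f x - ∫ y, f y ∂μ) p μ ≤ eLpNorm (fun z => f z.1 - f z.2) p (μ.prod μ) := by
  have hm : AEStronglyMeasurable (fun z : X × X => f z.1 - f z.2) (μ.prod μ) :=
    hf.1.comp_fst.sub hf.1.comp_snd
  refine eLpNorm_natCast_le_of_lintegral_le hp ?_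
  rw [eLpNorm_natCast_pow_eq_lintegral _ hp, lintegral_prod _ (hm.enorm.pow_const p)]
  refine lintegral_mono fun x => ?_
  have hx : f x - ∫ y, f y ∂μ = ∫ y, (f x - f y) ∂μ := by
    rw [integral_sub (integrable_const _) hf]; simp
  have jensen := eLpNorm_le_eLpNorm_of_exponent_le (p := 1) (q := p) (μ := μ)
    (f := fun y => f x - f y) (by exact_mod_cast Nat.one_le_iff_ne_zero.2 hp)
    (aestronglyMeasurable_const.sub hf.1)
  calc ‖f x - ∫ y, f y ∂μ‖ₑ ^ p ≤ eLpNorm (fun y => f x - f y) 1 μ ^ p := by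
        rw [hx, eLpNorm_one_eq_lintegral_enorm]
        gcongr
        exact enorm_integral_le_lintegral_enorm _
    _ ≤ eLpNorm (fun y => f x - f y) p μ ^ p := by gcongr
    _ = _ := eLpNorm_natCast_pow_eq_lintegral _ hp

end Lp

/-! ### Moments of sub-Gaussian variables -/

section SubGaussian

variable {Ω : Type*} [MeasurableSpace Ω] {μ : Measure Ω} {X : Ω → ℝ} {c : ℝ≥0}

lemma hasSubgaussianMGF_mono {c' : ℝ≥0} (h : HasSubgaussianMGF X c μ) (hc : c ≤ c') :
    HasSubgaussianMGF X c' μ where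
  integrable_exp_mul := h.integrable_exp_mul
  mgf_le t := (h.mgf_le t).trans (by gcongr)

lemma integral_eq_zero_of_hasSubgaussianMGF [IsProbabilityMeasure μ]
    (h : HasSubgaussianMGF X c μ) : ∫ ω, X ω ∂μ = 0 := by
  have hmgf : HasDerivAt (mgf X μ) (∫ ω, X ω ∂μ) 0 := by
    simpa using hasDerivAt_mgf (X := X) (μ := μ) (t := 0) (by simp [h.integrableExpSet_eq_univ])
  have hexp : HasDerivAt (fun t : ℝ => Real.exp (c * t ^ 2 / 2)) 0 0 := by
    simpa using ((((hasDerivAt_id (0 : ℝ)).pow 2).const_mul (c : ℝ)).div_const 2).exp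
  have hmin : IsLocalMin (fun t => Real.exp (c * t ^ 2 / 2) - mgf X μ t) 0 :=
    Eventually.of_forall fun t => by simpa using h.mgf_le t
  simpa using hmin.hasDerivAt_eq_zero (hexp.sub hmgf)

lemma abs_pow_le_cosh (x : ℝ) (p : ℕ) : |x| ^ p ≤ 2 * p.factorial * Real.cosh x := by
  have h := Real.pow_div_factorial_le_exp |x| (abs_nonneg x) p
  rw [div_le_iff₀ (by positivity)] at h
  have hexp : Real.exp |x| ≤ 2 * Real.cosh x := by
    rw [← Real.cosh_abs, Real.cosh_eq]
    linarith [Real.exp_pos (-|x|)]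
  calc |x| ^ p ≤ Real.exp |x| * p.factorial := h
    _ ≤ 2 * Real.cosh x * p.factorial := by gcongr
    _ = _ := by ring

/-- A bound for the `L^p`-norm of a variable with sub-Gaussian parameter `1`. -/
def subgaussianMomentConst (p : ℕ) : ℝ≥0 :=
  (2 * p.factorial * (Real.exp (1 / 2)).toNNReal) ^ (p : ℝ)⁻¹

lemma eLpNorm_le_of_hasSubgaussianMGF_one (h : HasSubgaussianMGF X 1 μ) (p : ℕ) :
    eLpNorm X p μ ≤ subgaussianMomentConst p := by
  rcases eq_or_ne p 0 with rfl | hp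
  · simp
  have hi := h.integrable_exp_mul 1
  have hi' := h.integrable_exp_mul (-1)
  have hcosh : (fun ω => Real.cosh (X ω)) =
      fun ω => (Real.exp (1 * X ω) + Real.exp (-1 * X ω)) / 2 := by
    funext ω; rw [Real.cosh_eq, one_mul, neg_one_mul]
  have hcosh_int : Integrable (fun ω => Real.cosh (X ω)) μ := hcosh ▸ (hi.add hi').div_const 2
  have hcosh_le : ∫ ω, Real.cosh (X ω) ∂μ ≤ Real.exp (1 / 2) := by
    rw [hcosh, integral_div, integral_add hi hi']
    have h1 := h.mgf_le 1
    have h2 := h.mgf_le (-1)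
    simp only [mgf, NNReal.coe_one, one_pow, one_mul, neg_sq] at h1 h2 ⊢
    linarith
  refine eLpNorm_natCast_le_of_lintegral_le hp ?_
  calc ∫⁻ ω, ‖X ω‖ₑ ^ p ∂μ
      ≤ ∫⁻ ω, ENNReal.ofReal (2 * p.factorial * Real.cosh (X ω)) ∂μ := by
        refine lintegral_mono fun ω => ?_
        rw [Real.enorm_eq_ofReal_abs, ← ENNReal.ofReal_pow (abs_nonneg _)]
        exact ENNReal.ofReal_le_ofReal (abs_pow_le_cosh _ p)
    _ = ENNReal.ofReal (2 * p.factorial * ∫ ω, Real.cosh (X ω) ∂μ) := by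
        rw [← integral_const_mul, ofReal_integral_eq_lintegral_ofReal (hcosh_int.const_mul _)
          (ae_of_all _ fun ω => by positivity)]
    _ ≤ ENNReal.ofReal (2 * p.factorial * Real.exp (1 / 2)) := by gcongr
    _ = (subgaussianMomentConst p : ℝ≥0∞) ^ p := by
        rw [subgaussianMomentConst, ← ENNReal.coe_pow, ← NNReal.rpow_natCast, ← NNReal.rpow_mul,
          inv_mul_cancel₀ (by exact_mod_cast hp), NNReal.rpow_one, ENNReal.ofReal]
        congr 1
        rw [Real.toNNReal_mul (by positivity), Real.toNNReal_mul (by positivity)]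
        simp

lemma eLpNorm_le_of_hasSubgaussianMGF (h : HasSubgaussianMGF X c μ)
    (p : ℕ) : eLpNorm X p μ ≤ subgaussianMomentConst p * NNReal.sqrt c := by
  rcases eq_or_ne c 0 with rfl | hc
  · rw [eLpNorm_congr_ae h.ae_eq_zero_of_hasSubgaussianMGF_zero]
    simp
  set s := NNReal.sqrt c with hs
  have hs0 : (s : ℝ) ≠ 0 := by simpa [hs] using hc
  have hscaled : HasSubgaussianMGF (fun ω => (s : ℝ)⁻¹ * X ω) 1 μ := by
    convert h.const_mul (s : ℝ)⁻¹ using 1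
    ext
    have hc_eq : (c : ℝ) = s ^ 2 := by simp [hs]
    change (1 : ℝ) = (s : ℝ)⁻¹ ^ 2 * c
    rw [hc_eq]
    field_simp
  have hX : X = (s : ℝ) • fun ω => (s : ℝ)⁻¹ * X ω := by
    funext ω; simp [hs0]
  rw [hX, eLpNorm_const_smul, mul_comm]
  gcongr
  · exact eLpNorm_le_of_hasSubgaussianMGF_one hscaled p
  · simp

end SubGaussian

lemma IsEntryLaw.integral_sq {B : ℝ} {ν : Measure ℝ} (h : IsEntryLaw B ν) :
    ∫ w, w ^ 2 ∂ν = 1 := by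
  rcases h with rfl | ⟨-, -, hvar⟩
  · have hvar := variance_fun_id_gaussianReal (μ := 0) (v := 1)
    rw [variance_eq_integral (by fun_prop)] at hvar
    simpa using hvar
  · exact hvar

lemma IsEntryLaw.hasSubgaussianMGF {B : ℝ} {ν : Measure ℝ} [IsProbabilityMeasure ν]
    (h : IsEntryLaw B ν) : HasSubgaussianMGF id (max 1 ((‖B - -B‖₊ / 2) ^ 2)) ν := by
  rcases h with rfl | ⟨hbound, hmean, -⟩
  · have hgauss : HasSubgaussianMGF id 1 (gaussianReal 0 1) :=
      ⟨integrable_exp_mul_gaussianReal, fun t => by simp [mgf_id_gaussianReal]⟩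
    exact hasSubgaussianMGF_mono hgauss (le_max_left _ _)
  · refine hasSubgaussianMGF_mono (hasSubgaussianMGF_of_mem_Icc_of_integral_eq_zero
      aemeasurable_id ?_ hmean) (le_max_right _ _)
    filter_upwards [hbound] with w hw using abs_le.1 hw

section LinearForm

variable {ι : Type*} [Fintype ι] {ν : Measure ℝ} [IsProbabilityMeasure ν] {c : ℝ≥0}

lemma hasSubgaussianMGF_dotProduct (h : HasSubgaussianMGF id c ν) (a : ι → ℝ) :
    HasSubgaussianMGF (fun w => a ⬝ᵥ w) ((∑ i, ‖a i‖₊ ^ 2) * c) (Measure.pi fun _ => ν) := by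
  rw [Finset.sum_mul]
  refine HasSubgaussianMGF.sum_of_iIndepFun (X := fun i (w : ι → ℝ) => a i * w i)
    (c := fun i => ‖a i‖₊ ^ 2 * c)
    (iIndepFun_pi (X := fun i x => a i * x) fun i => by fun_prop) fun i _ => ?_
  have hcoord : HasSubgaussianMGF (fun w : ι → ℝ => w i) c (Measure.pi fun _ => ν) := by
    refine HasSubgaussianMGF.of_map (X := id) (measurable_pi_apply i).aemeasurable ?_
    rwa [(measurePreserving_eval (fun _ : ι => ν) i).map_eq]
  have hsq : ‖a i‖₊ ^ 2 = NNReal.mk (a i ^ 2) (sq_nonneg _) := by ext; simp [sq_abs]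
  rw [hsq]
  exact hcoord.const_mul (a i)

lemma eLpNorm_dotProduct_le (h : HasSubgaussianMGF id c ν) (a : ι → ℝ) (p : ℕ) :
    eLpNorm (fun w => a ⬝ᵥ w) p (Measure.pi fun _ => ν) ≤
      subgaussianMomentConst p * NNReal.sqrt ((∑ i, ‖a i‖₊ ^ 2) * c) :=
  eLpNorm_le_of_hasSubgaussianMGF (hasSubgaussianMGF_dotProduct h a) p

lemma eLpNorm_dotProduct_add_sub_le (h : HasSubgaussianMGF id c ν) (a : ι → ℝ) (p : ℕ) :
    eLpNorm (fun z : (ι → ℝ) × (ι → ℝ) => a ⬝ᵥ (z.1 + z.2)) p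
        ((Measure.pi fun _ => ν).prod (Measure.pi fun _ => ν)) ≤
      subgaussianMomentConst p * NNReal.sqrt ((∑ i, ‖a i‖₊ ^ 2) * (2 * c)) ∧
    eLpNorm (fun z : (ι → ℝ) × (ι → ℝ) => a ⬝ᵥ (z.1 - z.2)) p
        ((Measure.pi fun _ => ν).prod (Measure.pi fun _ => ν)) ≤
      subgaussianMomentConst p * NNReal.sqrt ((∑ i, ‖a i‖₊ ^ 2) * (2 * c)) := by
  have hm : Measurable fun w : ι → ℝ => a ⬝ᵥ w := by unfold dotProduct; fun_prop
  have hlin := hasSubgaussianMGF_dotProduct h a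
  have hfst := HasSubgaussianMGF.of_map (X := fun w : ι → ℝ => a ⬝ᵥ w)
    (μ := (Measure.pi fun _ : ι => ν).prod (Measure.pi fun _ : ι => ν)) measurable_fst.aemeasurable
    (by rw [measurePreserving_fst.map_eq]; exact hlin)
  have hsnd := HasSubgaussianMGF.of_map (X := fun w : ι → ℝ => a ⬝ᵥ w)
    (μ := (Measure.pi fun _ : ι => ν).prod (Measure.pi fun _ : ι => ν)) measurable_snd.aemeasurable
    (by rw [measurePreserving_snd.map_eq]; exact hlin)
  have hindep := indepFun_prod (μ := Measure.pi fun _ : ι => ν) (ν := Measure.pi fun _ : ι => ν)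
    hm hm
  have hadd := hfst.add_of_indepFun hsnd hindep
  have hsub := hfst.sub_of_indepFun hsnd hindep
  rw [← two_mul, mul_left_comm] at hadd hsub
  constructor
  · simpa only [dotProduct_add, Function.comp_apply] using eLpNorm_le_of_hasSubgaussianMGF hadd p
  · simpa only [dotProduct_sub, Function.comp_apply] using eLpNorm_le_of_hasSubgaussianMGF hsub p

end LinearForm

/-! ### Symmetrization -/

/-- The law of a random sign, used to symmetrize sums. -/
def signLaw : Measure ℝ := (2⁻¹ : ℝ≥0∞) • (Measure.dirac 1 + Measure.dirac (-1))

instance : IsProbabilityMeasure signLaw := ⟨by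
  simpa [signLaw, one_add_one_eq_two] using ENNReal.inv_two_add_inv_two⟩

lemma ae_signLaw : ∀ᵐ e ∂signLaw, e = 1 ∨ e = -1 := by
  refine Measure.ae_smul_measure (ae_add_measure_iff.2 ⟨?_, ?_⟩) _ <;>
    rw [ae_dirac_iff (by measurability)] <;> simp

lemma hasSubgaussianMGF_signLaw : HasSubgaussianMGF id 1 signLaw := by
  have hmean : ∫ e, id e ∂signLaw = 0 := by
    rw [signLaw, integral_smul_measure, integral_add_measure (integrable_dirac (by simp))
      (integrable_dirac (by simp))]
    simp
  have hbound : ∀ᵐ e ∂signLaw, id e ∈ Set.Icc (-1 : ℝ) 1 := by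
    filter_upwards [ae_signLaw] with e he
    rcases he with rfl | rfl <;> simp
  convert hasSubgaussianMGF_of_mem_Icc_of_integral_eq_zero aemeasurable_id hbound hmean using 1
  ext
  norm_num

section Swap

variable {ι : Type*}

/-- Exchange of the coordinates in `A` between two vectors. -/
def swapOn (A : Set ι) (z : (ι → ℝ) × (ι → ℝ)) : (ι → ℝ) × (ι → ℝ) :=
  open Classical in (A.piecewise z.2 z.1, A.piecewise z.1 z.2)

lemma swapOn_fst_add_snd (A : Set ι) (z : (ι → ℝ) × (ι → ℝ)) :
    (swapOn A z).1 + (swapOn A z).2 = z.1 + z.2 := by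
  funext i
  by_cases h : i ∈ A <;> simp [swapOn, h, add_comm]

lemma swapOn_fst_sub_snd {e : ι → ℝ} (he : ∀ i, e i = 1 ∨ e i = -1) (z : (ι → ℝ) × (ι → ℝ)) :
    (swapOn {i | e i = -1} z).1 - (swapOn {i | e i = -1} z).2 = e * (z.1 - z.2) := by
  funext i
  rcases he i with h | h <;> norm_num [swapOn, h]

end Swap

section Symmetrization

variable {ι : Type*} [Fintype ι] {ν : Measure ℝ} [IsProbabilityMeasure ν]

lemma ae_pi_signLaw : ∀ᵐ e ∂(Measure.pi fun _ : ι => signLaw), ∀ i, e i = 1 ∨ e i = -1 :=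
  ae_all_iff.2 fun i =>
    (measurePreserving_eval (fun _ : ι => signLaw) i).quasiMeasurePreserving.ae ae_signLaw

-- Khinchine's inequality, averaged over `x`.
lemma eLpNorm_sum_le_of_sign_invariant {X : Type*} [MeasurableSpace X] {μ : Measure X} [SFinite μ]
    {f : X → ι → ℝ} (hf : Measurable f) {p : ℕ} (hp : p ≠ 0)
    (hsign : ∀ e : ι → ℝ, (∀ i, e i = 1 ∨ e i = -1) →
      eLpNorm (fun x => f x ⬝ᵥ e) p μ = eLpNorm (fun x => ∑ i, f x i) p μ) :
    eLpNorm (fun x => ∑ i, f x i) p μ ≤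
      subgaussianMomentConst p * eLpNorm (fun x => √(∑ i, f x i ^ 2)) p μ := by
  set σ := Measure.pi fun _ : ι => signLaw
  refine eLpNorm_natCast_le_of_lintegral_le hp ?_
  calc ∫⁻ x, ‖∑ i, f x i‖ₑ ^ p ∂μ = ∫⁻ _, ∫⁻ x, ‖∑ i, f x i‖ₑ ^ p ∂μ ∂σ := by simp
    _ = ∫⁻ e, ∫⁻ x, ‖f x ⬝ᵥ e‖ₑ ^ p ∂μ ∂σ := by
        refine lintegral_congr_ae ?_
        filter_upwards [ae_pi_signLaw] with e he
        simp only [← eLpNorm_natCast_pow_eq_lintegral _ hp, hsign e he]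
    _ = ∫⁻ x, ∫⁻ e, ‖f x ⬝ᵥ e‖ₑ ^ p ∂σ ∂μ :=
        lintegral_lintegral_swap (by unfold dotProduct; fun_prop)
    _ ≤ ∫⁻ x, (subgaussianMomentConst p * ‖√(∑ i, f x i ^ 2)‖ₑ) ^ p ∂μ := by
        refine lintegral_mono fun x => ?_
        rw [← eLpNorm_natCast_pow_eq_lintegral _ hp]
        gcongr
        have hnorm : NNReal.sqrt ((∑ i, ‖f x i‖₊ ^ 2) * 1) = ‖√(∑ i, f x i ^ 2)‖₊ := by
          ext; simp [abs_of_nonneg, Real.sqrt_nonneg]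
        simpa only [hnorm, enorm_eq_nnnorm] using
          eLpNorm_dotProduct_le hasSubgaussianMGF_signLaw (f x) p
    _ = _ := by
        simp_rw [mul_pow]
        rw [lintegral_const_mul' _ _ (by finiteness), eLpNorm_natCast_pow_eq_lintegral _ hp]

lemma measurePreserving_swapOn (A : Set ι) :
    MeasurePreserving (swapOn A) ((Measure.pi fun _ => ν).prod (Measure.pi fun _ => ν))
      ((Measure.pi fun _ => ν).prod (Measure.pi fun _ => ν)) := by
  classical
  have hpair := measurePreserving_arrowProdEquivProdArrow ℝ ℝ ι (fun _ => ν) (fun _ => ν)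
  have hswap := measurePreserving_pi (fun _ : ι => ν.prod ν) (fun _ : ι => ν.prod ν)
    (f := fun i z => if i ∈ A then z.swap else z) fun i => by
      by_cases h : i ∈ A
      · simpa only [h, if_true] using Measure.measurePreserving_swap
      · simp only [h, if_false]
        exact MeasurePreserving.id _
  convert (hpair.comp hswap).comp hpair.symm using 1
  funext z
  refine Prod.ext ?_ ?_ <;> funext i <;> by_cases h : i ∈ A <;>
    simp [swapOn, MeasurableEquiv.arrowProdEquivProdArrow, Equiv.arrowProdEquivProdArrow,
      MeasurableEquiv.symm, h]

end Symmetrization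

/-! ### The Hanson–Wright moment bound -/

section QuadraticForm

variable {ι : Type*} [Fintype ι] {ν : Measure ℝ} [IsProbabilityMeasure ν] {c : ℝ≥0}

lemma memLp_eval_pi (h : HasSubgaussianMGF id c ν) (i : ι) :
    MemLp (fun w : ι → ℝ => w i) 2 (Measure.pi fun _ => ν) :=
  (h.memLp 2).comp_measurePreserving (measurePreserving_eval (fun _ : ι => ν) i)

lemma integral_eval_mul_eval_pi [DecidableEq ι] (h : HasSubgaussianMGF id c ν)
    (hv : ∫ w, w ^ 2 ∂ν = 1) (i j : ι) :
    ∫ w : ι → ℝ, w i * w j ∂(Measure.pi fun _ => ν) = (1 : Matrix ι ι ℝ) i j := by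
  rcases eq_or_ne i j with rfl | hij
  · have hsq := integral_comp_eval (μ := fun _ : ι => ν) (i := i) (f := fun x : ℝ => x ^ 2)
      (by fun_prop)
    simp only [← sq, hsq, hv, Matrix.one_apply_eq]
  · have hindep : IndepFun (fun w : ι → ℝ => w i) (fun w => w j) (Measure.pi fun _ => ν) :=
      (iIndepFun_pi (X := fun _ => id) fun _ => aemeasurable_id).indepFun hij
    have hmean : ∫ w : ι → ℝ, w i ∂(Measure.pi fun _ => ν) = 0 :=
      (integral_comp_eval (μ := fun _ : ι => ν) (i := i) (f := fun x : ℝ => x)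
        (by fun_prop)).trans (integral_eq_zero_of_hasSubgaussianMGF h)
    rw [hindep.integral_fun_mul_eq_mul_integral (memLp_eval_pi h i).1 (memLp_eval_pi h j).1,
      hmean, zero_mul, Matrix.one_apply_ne hij]

lemma quadratic_eq_sum (S : Matrix ι ι ℝ) (w : ι → ℝ) :
    w ⬝ᵥ S *ᵥ w = ∑ i, ∑ j, S i j * (w i * w j) := by
  simp only [dotProduct, Matrix.mulVec, Finset.mul_sum]
  exact Finset.sum_congr rfl fun i _ => Finset.sum_congr rfl fun j _ => by ring

lemma integrable_eval_mul_eval_pi (h : HasSubgaussianMGF id c ν) (i j : ι) :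
    Integrable (fun w : ι → ℝ => w i * w j) (Measure.pi fun _ => ν) :=
  (memLp_eval_pi h i).integrable_mul (memLp_eval_pi h j)

lemma integrable_quadratic (h : HasSubgaussianMGF id c ν) (S : Matrix ι ι ℝ) :
    Integrable (fun w : ι → ℝ => w ⬝ᵥ S *ᵥ w) (Measure.pi fun _ => ν) := by
  simp_rw [quadratic_eq_sum]
  exact integrable_finsetSum _ fun i _ => integrable_finsetSum _ fun j _ =>
    (integrable_eval_mul_eval_pi h i j).const_mul _

lemma integral_quadratic (h : HasSubgaussianMGF id c ν) (hv : ∫ w, w ^ 2 ∂ν = 1)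
    (S : Matrix ι ι ℝ) :
    ∫ w : ι → ℝ, w ⬝ᵥ S *ᵥ w ∂(Measure.pi fun _ => ν) = S.trace := by
  classical
  have hint (i j : ι) := (integrable_eval_mul_eval_pi h i j).const_mul (S i j)
  simp_rw [quadratic_eq_sum]
  rw [integral_finsetSum _ fun i _ => integrable_finsetSum _ fun j _ => hint i j]
  refine Finset.sum_congr rfl fun i _ => ?_
  rw [integral_finsetSum _ fun j _ => hint i j]
  simp [integral_const_mul, integral_eval_mul_eval_pi h hv, Matrix.one_apply]

lemma quadratic_sub_quadratic {S : Matrix ι ι ℝ} (hS : S.IsSymm) (v w : ι → ℝ) :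
    v ⬝ᵥ S *ᵥ v - w ⬝ᵥ S *ᵥ w = (v - w) ⬝ᵥ S *ᵥ (v + w) := by
  have hcomm : w ⬝ᵥ S *ᵥ v = v ⬝ᵥ S *ᵥ w := by
    rw [Matrix.dotProduct_mulVec, ← Matrix.mulVec_transpose, hS.eq, dotProduct_comm]
  rw [Matrix.mulVec_add, dotProduct_add, sub_dotProduct, sub_dotProduct, hcomm]
  ring

lemma eLpNorm_sub_mul_mulVec_add_le (h : HasSubgaussianMGF id c ν) (S : Matrix ι ι ℝ) (p : ℕ)
    (i : ι) :
    eLpNorm (fun z : (ι → ℝ) × (ι → ℝ) => (z.1 - z.2) i * (S *ᵥ (z.1 + z.2)) i) p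
        ((Measure.pi fun _ => ν).prod (Measure.pi fun _ => ν)) ≤
      subgaussianMomentConst (2 * p) ^ 2 * (2 * c) * NNReal.sqrt (∑ j, ‖S i j‖₊ ^ 2) := by
  classical
  set K := subgaussianMomentConst (2 * p)
  have hdiff := (eLpNorm_dotProduct_add_sub_le h (Pi.single i 1) (2 * p)).2
  have hsum := (eLpNorm_dotProduct_add_sub_le h (S i) (2 * p)).1
  have hunit : ∑ j, ‖(Pi.single i 1 : ι → ℝ) j‖₊ ^ 2 = 1 := by
    rw [Finset.sum_eq_single i (fun j _ hj => by simp [hj]) (by simp)]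
    simp
  simp only [single_dotProduct, one_mul, hunit] at hdiff
  have hholder : ENNReal.HolderTriple ((2 * p : ℕ) : ℝ≥0∞) ((2 * p : ℕ) : ℝ≥0∞) p := ⟨by
    push_cast
    rw [ENNReal.mul_inv (by simp) (by simp), ← add_mul, ENNReal.inv_two_add_inv_two, one_mul]⟩
  calc _ ≤ eLpNorm (fun z : (ι → ℝ) × (ι → ℝ) => (z.1 - z.2) i) (2 * p : ℕ) _ *
        eLpNorm (fun z : (ι → ℝ) × (ι → ℝ) => S i ⬝ᵥ (z.1 + z.2)) (2 * p : ℕ) _ :=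
      eLpNorm_smul_le_mul_eLpNorm (by unfold dotProduct; fun_prop) (by fun_prop)
    _ ≤ (K * NNReal.sqrt (2 * c)) * (K * NNReal.sqrt ((∑ j, ‖S i j‖₊ ^ 2) * (2 * c))) := by
      gcongr
    _ = _ := by
      norm_cast
      rw [NNReal.sqrt_mul (∑ j, ‖S i j‖₊ ^ 2)]
      conv_rhs => rw [← NNReal.mul_self_sqrt (2 * c)]
      ring

lemma eLpNorm_bilinear_add_sub_le (h : HasSubgaussianMGF id c ν) (S : Matrix ι ι ℝ) {q : ℕ}
    (hq : q ≠ 0) :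
    eLpNorm (fun z : (ι → ℝ) × (ι → ℝ) => (z.1 - z.2) ⬝ᵥ S *ᵥ (z.1 + z.2)) (2 * q : ℕ)
        ((Measure.pi fun _ => ν).prod (Measure.pi fun _ => ν)) ≤
      subgaussianMomentConst (2 * q) * (subgaussianMomentConst (2 * (2 * q)) ^ 2 * (2 * c) *
        NNReal.sqrt (∑ i, ∑ j, ‖S i j‖₊ ^ 2)) := by
  set π := Measure.pi fun _ : ι => ν
  set f : (ι → ℝ) × (ι → ℝ) → ι → ℝ := fun z i => (z.1 - z.2) i * (S *ᵥ (z.1 + z.2)) i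
  have hf : Measurable f := by unfold f Matrix.mulVec dotProduct; fun_prop
  have hq' : 2 * q ≠ 0 := by omega
  have hsign (e : ι → ℝ) (he : ∀ i, e i = 1 ∨ e i = -1) :
      eLpNorm (fun z => f z ⬝ᵥ e) (2 * q : ℕ) (π.prod π) =
        eLpNorm (fun z => ∑ i, f z i) (2 * q : ℕ) (π.prod π) := by
    rw [eq_comm, ← eLpNorm_comp_measurePreserving (by fun_prop)
      (measurePreserving_swapOn (ν := ν) {i | e i = -1})]
    congr 1 with z
    simp only [Function.comp_apply, f, swapOn_fst_add_snd, swapOn_fst_sub_snd he, dotProduct,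
      Pi.mul_apply]
    exact Finset.sum_congr rfl fun i _ => by ring
  refine (eLpNorm_sum_le_of_sign_invariant hf hq' hsign).trans ?_
  gcongr
  rw [← ENNReal.pow_le_pow_left_iff two_ne_zero]
  calc eLpNorm (fun z => √(∑ i, f z i ^ 2)) (2 * q : ℕ) (π.prod π) ^ 2
      ≤ ∑ i, eLpNorm (fun z => f z i) (2 * q : ℕ) (π.prod π) ^ 2 := by
        rw [Nat.cast_mul, Nat.cast_two, mul_comm]
        exact eLpNorm_sqrt_sum_sq_sq_le (fun i => by fun_prop)
          (by exact_mod_cast Nat.one_le_iff_ne_zero.2 hq)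
    _ ≤ ∑ i, (subgaussianMomentConst (2 * (2 * q)) ^ 2 * (2 * c) *
          NNReal.sqrt (∑ j, ‖S i j‖₊ ^ 2) : ℝ≥0∞) ^ 2 := by
        gcongr with i
        exact_mod_cast eLpNorm_sub_mul_mulVec_add_le h S (2 * q) i
    _ = _ := by
        norm_cast
        simp only [mul_pow, NNReal.sq_sqrt, Finset.mul_sum]

lemma eLpNorm_quadratic_sub_trace_le (h : HasSubgaussianMGF id c ν) (hv : ∫ w, w ^ 2 ∂ν = 1)
    {S : Matrix ι ι ℝ} (hS : S.IsSymm) {q : ℕ} (hq : q ≠ 0) :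
    eLpNorm (fun w : ι → ℝ => w ⬝ᵥ S *ᵥ w - S.trace) (2 * q : ℕ) (Measure.pi fun _ => ν) ≤
      subgaussianMomentConst (2 * q) * (subgaussianMomentConst (2 * (2 * q)) ^ 2 * (2 * c) *
        NNReal.sqrt (∑ i, ∑ j, ‖S i j‖₊ ^ 2)) := by
  rw [← integral_quadratic h hv S]
  refine (eLpNorm_sub_integral_le (integrable_quadratic h S) (by omega)).trans ?_
  simp_rw [quadratic_sub_quadratic hS]
  exact eLpNorm_bilinear_add_sub_le h S hq

end QuadraticForm

/-! ### Concentration of the inputs -/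

section Matrix

variable {d : ℕ} {R : Matrix (Fin d) (Fin d) ℝ}

lemma opNorm_mul_self (hR : R.IsHermitian) : opNorm (R * R) = opNorm R ^ 2 := by
  have hself : IsSelfAdjoint (Matrix.toEuclideanCLM (n := Fin d) (𝕜 := ℝ) R) :=
    IsSelfAdjoint.map hR _
  rw [opNorm, map_mul, hself.norm_mul_self, opNorm]

lemma norm_toLp_mulVec_le (R : Matrix (Fin d) (Fin d) ℝ) (v : Fin d → ℝ) :
    ‖(WithLp.toLp 2 (R *ᵥ v) : E d)‖ ≤ opNorm R * ‖(WithLp.toLp 2 v : E d)‖ := by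
  rw [← Matrix.toEuclideanCLM_toLp]
  exact (Matrix.toEuclideanCLM (n := Fin d) (𝕜 := ℝ) R).le_opNorm _

lemma norm_sq_toLp (v : Fin d → ℝ) : ‖(WithLp.toLp 2 v : E d)‖ ^ 2 = v ⬝ᵥ v := by
  rw [EuclideanSpace.real_norm_sq_eq]
  simp only [dotProduct, sq]

lemma sum_sq_mul_self_le (hR : R.IsSymm) :
    ∑ i, ∑ j, (R * R) i j ^ 2 ≤ opNorm R ^ 2 * (R * R).trace := by
  rw [Matrix.trace, Finset.mul_sum]
  refine Finset.sum_le_sum fun i _ => ?_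
  have hrow : (R * R) i = R *ᵥ R i := by
    ext j
    rw [Matrix.mul_apply', dotProduct_comm]
    exact congrArg (· ⬝ᵥ R i) (funext fun k => hR.apply k j).symm
  have hdiag : (R * R) i i = R i ⬝ᵥ R i := by
    rw [hrow]; rfl
  calc ∑ j, (R * R) i j ^ 2 = ‖(WithLp.toLp 2 (R *ᵥ R i) : E d)‖ ^ 2 := by
        rw [EuclideanSpace.real_norm_sq_eq, hrow]
    _ ≤ (opNorm R * ‖(WithLp.toLp 2 (R i) : E d)‖) ^ 2 := by
        gcongr; exact norm_toLp_mulVec_le R _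
    _ = opNorm R ^ 2 * (R * R).diag i := by
        rw [mul_pow, norm_sq_toLp, Matrix.diag_apply, hdiag]

lemma norm_sq_toLp_mulVec (hR : R.IsSymm) (w : Fin d → ℝ) :
    ‖(WithLp.toLp 2 (R *ᵥ w) : E d)‖ ^ 2 = w ⬝ᵥ (R * R) *ᵥ w := by
  rw [norm_sq_toLp, ← Matrix.mulVec_mulVec, Matrix.dotProduct_mulVec w, ← Matrix.mulVec_transpose,
    hR.eq]

lemma inner_toLp_mulVec (hR : R.IsSymm) (w : Fin d → ℝ) (x : E d) :
    inner ℝ (WithLp.toLp 2 (R *ᵥ w) : E d) x = (R *ᵥ x.ofLp) ⬝ᵥ w := by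
  rw [EuclideanSpace.inner_eq_star_dotProduct, star_trivial, Matrix.dotProduct_mulVec,
    ← Matrix.mulVec_transpose, hR.eq]

end Matrix

lemma eLpNorm_div_le_of_eLpNorm_le {X : Type*} [MeasurableSpace X] {μ : Measure X} {f : X → ℝ}
    {p : ℝ≥0∞} {D r : ℝ} (hr : 0 < r) (h : eLpNorm f p μ ≤ ENNReal.ofReal (D * √r)) :
    eLpNorm (fun x => f x / r) p μ ≤ ENNReal.ofReal (D / √r) := by
  have hscale : (fun x => f x / r) = r⁻¹ • f := by
    funext x; rw [Pi.smul_apply, smul_eq_mul, div_eq_inv_mul]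
  rw [hscale, eLpNorm_const_smul, Real.enorm_of_nonneg (inv_pos.2 hr).le]
  calc ENNReal.ofReal r⁻¹ * eLpNorm f p μ ≤ ENNReal.ofReal r⁻¹ * ENNReal.ofReal (D * √r) := by
        gcongr
    _ = ENNReal.ofReal (D / √r) := by
        rw [← ENNReal.ofReal_mul (inv_pos.2 hr).le]
        congr 1
        rw [← Real.sq_sqrt hr.le, Real.sqrt_sq (by positivity)]
        field_simp

section CovLaw

variable {d : ℕ} {R : Matrix (Fin d) (Fin d) ℝ} {c : ℝ≥0} {ν : Measure ℝ}

lemma measurable_toLp_mulVec (R : Matrix (Fin d) (Fin d) ℝ) :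
    Measurable fun w : Fin d → ℝ => (WithLp.toLp 2 (R *ᵥ w) : E d) := by
  refine (WithLp.measurable_toLp 2 _).comp ?_
  fun_prop [Matrix.mulVec, dotProduct]

lemma eLpNorm_covLaw {f : E d → ℝ} (hf : Measurable f) (p : ℝ≥0∞) :
    eLpNorm f p (covLaw ν R) =
      eLpNorm (fun w => f (WithLp.toLp 2 (R *ᵥ w))) p (Measure.pi fun _ => ν) :=
  eLpNorm_map_measure hf.aestronglyMeasurable (measurable_toLp_mulVec R).aemeasurable

variable [IsProbabilityMeasure ν]

instance : IsProbabilityMeasure (covLaw ν R) :=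
  Measure.isProbabilityMeasure_map (measurable_toLp_mulVec R).aemeasurable

lemma eLpNorm_norm_sq_div_trace_sub_one_le (h : HasSubgaussianMGF id c ν)
    (hv : ∫ w, w ^ 2 ∂ν = 1) (hR : R.IsSymm) (hnorm : opNorm R = 1) (hr : 0 < (R * R).trace)
    {q : ℕ} (hq : q ≠ 0) :
    eLpNorm (fun z => ‖z‖ ^ 2 / (R * R).trace - 1) (2 * q : ℕ) (covLaw ν R) ≤
      ENNReal.ofReal (subgaussianMomentConst (2 * q) * (subgaussianMomentConst (2 * (2 * q)) ^ 2 *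
        (2 * c)) / √(R * R).trace) := by
  set r := (R * R).trace
  set D : ℝ≥0 :=
    subgaussianMomentConst (2 * q) * (subgaussianMomentConst (2 * (2 * q)) ^ 2 * (2 * c))
  have hsymm : (R * R).IsSymm := by rw [Matrix.IsSymm, Matrix.transpose_mul, hR.eq]
  have hquad : eLpNorm (fun w => w ⬝ᵥ (R * R) *ᵥ w - r) (2 * q : ℕ) (Measure.pi fun _ => ν) ≤
      ENNReal.ofReal (D * √r) := by
    have hfrob : NNReal.sqrt (∑ i, ∑ j, ‖(R * R) i j‖₊ ^ 2) ≤ √r := by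
      rw [Real.coe_sqrt]
      push_cast
      simp only [Real.norm_eq_abs, sq_abs]
      exact Real.sqrt_le_sqrt (by simpa [hnorm] using sum_sq_mul_self_le hR)
    refine (eLpNorm_quadratic_sub_trace_le h hv hsymm hq).trans ?_
    rw [← mul_assoc, ENNReal.ofReal_mul D.coe_nonneg, ENNReal.ofReal_coe_nnreal]
    refine mul_le_mul' (by simp [D]) ?_
    rw [← ENNReal.ofReal_coe_nnreal]
    exact ENNReal.ofReal_le_ofReal hfrob
  rw [eLpNorm_covLaw (by fun_prop)]
  convert eLpNorm_div_le_of_eLpNorm_le hr hquad using 2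
  · funext w
    rw [norm_sq_toLp_mulVec hR, sub_div, div_self hr.ne']
  · simp [D]

lemma eLpNorm_inner_div_trace_le (h : HasSubgaussianMGF id c ν) (hR : R.IsSymm)
    (hnorm : opNorm R = 1) (hr : 0 < (R * R).trace) {x : E d}
    (hx : ‖x‖ ^ 2 / (R * R).trace ≤ 2) (p : ℕ) :
    eLpNorm (fun z => inner ℝ z x / (R * R).trace) p (covLaw ν R) ≤
      ENNReal.ofReal (subgaussianMomentConst p * √(2 * c) / √(R * R).trace) := by
  set r := (R * R).trace
  have hlin : eLpNorm (fun w => (R *ᵥ x.ofLp) ⬝ᵥ w) p (Measure.pi fun _ => ν) ≤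
      ENNReal.ofReal (subgaussianMomentConst p * √(2 * c) * √r) := by
    have hnorm_sq : NNReal.sqrt ((∑ i, ‖(R *ᵥ x.ofLp) i‖₊ ^ 2) * c) ≤ √(2 * c) * √r := by
      have hcontr := norm_toLp_mulVec_le R x.ofLp
      rw [hnorm, one_mul] at hcontr
      have hsum : ∑ i, (R *ᵥ x.ofLp) i ^ 2 ≤ 2 * r := by
        rw [← EuclideanSpace.real_norm_sq_eq (WithLp.toLp 2 (R *ᵥ x.ofLp))]
        exact (pow_le_pow_left₀ (norm_nonneg _) hcontr 2).trans ((div_le_iff₀ hr).1 hx)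
      rw [← Real.sqrt_mul (by positivity), Real.coe_sqrt]
      push_cast
      simp only [Real.norm_eq_abs, sq_abs]
      refine Real.sqrt_le_sqrt ?_
      calc _ ≤ 2 * r * (c : ℝ) := by gcongr
        _ = _ := by ring
    refine (eLpNorm_dotProduct_le h _ p).trans ?_
    rw [mul_assoc, ENNReal.ofReal_mul (by positivity), ENNReal.ofReal_coe_nnreal]
    gcongr
    rw [← ENNReal.ofReal_coe_nnreal]
    exact ENNReal.ofReal_le_ofReal hnorm_sq
  rw [eLpNorm_covLaw (by fun_prop)]
  simp_rw [inner_toLp_mulVec hR]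
  exact eLpNorm_div_le_of_eLpNorm_le hr hlin

end CovLaw

lemma measure_lt_abs_le_of_eLpNorm_le {X : Type*} [MeasurableSpace X] {μ : Measure X} {f : X → ℝ}
    (hf : AEStronglyMeasurable f μ) {q : ℕ} (hq : q ≠ 0) {D δ r : ℝ} (hD : 0 ≤ D) (hδ : 0 < δ)
    (hr : 0 < r) (h : eLpNorm f (2 * q : ℕ) μ ≤ ENNReal.ofReal (D / √r)) :
    μ {x | δ < |f x|} ≤ ENNReal.ofReal (D ^ (2 * q) / (δ ^ 2 * r) ^ q) := by
  have hmarkov := meas_ge_le_mul_pow_eLpNorm_enorm μ (p := (2 * q : ℕ)) (by simpa using hq)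
    (ENNReal.natCast_ne_top _) hf (ε := ENNReal.ofReal δ) (by simpa using hδ) (by simp)
  have hsub : {x | δ < |f x|} ⊆ {x | ENNReal.ofReal δ ≤ ‖f x‖ₑ} := fun x hx => by
    rw [Set.mem_ofPred_eq, Real.enorm_eq_ofReal_abs]
    exact ENNReal.ofReal_le_ofReal (le_of_lt hx)
  refine (measure_mono hsub).trans (hmarkov.trans ?_)
  rw [ENNReal.toReal_natCast, ENNReal.rpow_natCast, ENNReal.rpow_natCast, ← mul_pow,
    ← ENNReal.ofReal_inv_of_pos hδ]
  calc _ ≤ (ENNReal.ofReal δ⁻¹ * ENNReal.ofReal (D / √r)) ^ (2 * q) := by gcongr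
    _ = _ := by
        rw [← ENNReal.ofReal_mul (by positivity), ← ENNReal.ofReal_pow (by positivity)]
        congr 1
        rw [inv_mul_eq_div, div_div, div_pow, pow_mul (_ * δ), mul_pow, Real.sq_sqrt hr.le,
          mul_comm r]

/-- The squared norms in `T` that are within `δ` of `1`. -/
def shell (T : Set ℝ) (δ : ℝ) : Set ℝ := {s | s ∈ T ∧ |s - 1| ≤ δ}

lemma measurableSet_shell {T : Set ℝ} (hT : MeasurableSet T) (δ : ℝ) : MeasurableSet (shell T δ) :=
  hT.inter (measurableSet_le (by fun_prop : Measurable fun s : ℝ => |s - 1|) measurable_const)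

/-- The law `Q` on `ℝ^d` concentrates at scale `r`: up to probability `O((δ² r)^{-q})`, the number
`‖x‖² / r` lies in `T` and within `δ` of `1`, and `xᵀx'/r` is smaller than `δ` for every fixed `x'`
with `‖x'‖² ≤ 2r`; moreover `‖x‖² / r` is bounded in `L^{2q}`. The set `T` is everything
for a law on the whole space, and `{1}` for a law on the sphere of radius `√r`. -/
structure Concentrates {d : ℕ} (Q : Measure (E d)) (T : Set ℝ) (r : ℝ) (q : ℕ) (C : ℝ≥0) :
    Prop where
  norm_tail : ∀ δ : ℝ, 0 < δ → δ ≤ 1 / 2 →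
    Q {x | ‖x‖ ^ 2 / r ∉ shell T δ} ≤ ENNReal.ofReal (C / (δ ^ 2 * r) ^ q)
  inner_tail : ∀ δ : ℝ, 0 < δ → δ ≤ 1 / 2 → ∀ x' : E d, ‖x'‖ ^ 2 / r ≤ 2 →
    Q {x | δ < |inner ℝ x x' / r|} ≤ ENNReal.ofReal (C / (δ ^ 2 * r) ^ q)
  moment : eLpNorm (fun x => 1 + ‖x‖ ^ 2 / r) (2 * q : ℕ) Q ≤ C

lemma exists_concentrates_covLaw (c : ℝ≥0) {q : ℕ} (hq : q ≠ 0) :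
    ∃ C : ℝ≥0, ∀ {d : ℕ} {R : Matrix (Fin d) (Fin d) ℝ} {ν : Measure ℝ} [IsProbabilityMeasure ν],
      HasSubgaussianMGF id c ν → ∫ w, w ^ 2 ∂ν = 1 → R.IsSymm → opNorm R = 1 →
      1 ≤ (R * R).trace → Concentrates (covLaw ν R) Set.univ (R * R).trace q C := by
  set D₁ : ℝ≥0 :=
    subgaussianMomentConst (2 * q) * (subgaussianMomentConst (2 * (2 * q)) ^ 2 * (2 * c))
  set D₂ : ℝ≥0 := subgaussianMomentConst (2 * q) * NNReal.sqrt (2 * c)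
  refine ⟨D₁ ^ (2 * q) + D₂ ^ (2 * q) + (2 + D₁), fun {d R ν} _ h hv hR hnorm hr => ?_⟩
  have hr0 : 0 < (R * R).trace := one_pos.trans_le hr
  have hnorm_sq := eLpNorm_norm_sq_div_trace_sub_one_le h hv hR hnorm hr0 hq
  refine ⟨fun δ hδ _ => ?_, fun δ hδ _ x' hx' => ?_, ?_⟩
  · simp only [shell, Set.mem_ofPred_eq, Set.mem_univ, true_and, not_le]
    refine (measure_lt_abs_le_of_eLpNorm_le (D := D₁) (by fun_prop) hq D₁.2 hδ hr0
      (by simpa [D₁] using hnorm_sq)).trans (ENNReal.ofReal_le_ofReal ?_)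
    gcongr
    exact_mod_cast (le_self_add.trans le_self_add : D₁ ^ (2 * q) ≤ _)
  · refine (measure_lt_abs_le_of_eLpNorm_le (D := D₂) (by fun_prop) hq D₂.2 hδ hr0
      (by simpa [D₂] using eLpNorm_inner_div_trace_le h hR hnorm hr0 hx' (2 * q))).trans
      (ENNReal.ofReal_le_ofReal ?_)
    gcongr
    exact_mod_cast (le_add_self.trans le_self_add : D₂ ^ (2 * q) ≤ _)
  · have hq1 : (1 : ℝ≥0∞) ≤ (2 * q : ℕ) := by exact_mod_cast (by omega : 1 ≤ 2 * q)
    calc eLpNorm (fun x => 1 + ‖x‖ ^ 2 / (R * R).trace) (2 * q : ℕ) (covLaw ν R)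
        = eLpNorm ((fun _ => 2) + fun x : E d => ‖x‖ ^ 2 / (R * R).trace - 1) (2 * q : ℕ)
            (covLaw ν R) := by
          congr 1 with x
          simp only [Pi.add_apply]
          ring
      _ ≤ 2 + ENNReal.ofReal (D₁ / √(R * R).trace) := by
          refine (eLpNorm_add_le (by fun_prop) (by fun_prop) hq1).trans (add_le_add ?_ ?_)
          · rw [eLpNorm_const _ (by positivity) (NeZero.ne _)]; simp [Real.enorm_eq_ofReal_abs]
          · simpa [D₁] using hnorm_sq
      _ ≤ 2 + D₁ := by
          gcongr
          rw [← ENNReal.ofReal_coe_nnreal]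
          exact ENNReal.ofReal_le_ofReal (div_le_self D₁.2 (Real.one_le_sqrt.2 hr))
      _ ≤ _ := by exact_mod_cast le_add_self

section Sphere

variable {d : ℕ} {Q : Measure (E d)} {r : ℝ}

lemma measurable_smul_normalize (r : ℝ) : Measurable fun z : E d => √r • (‖z‖⁻¹ • z) := by
  fun_prop

lemma norm_sq_smul_normalize_div (hr : 0 < r) {z : E d} (hz : z ≠ 0) :
    ‖√r • (‖z‖⁻¹ • z)‖ ^ 2 / r = 1 := by
  rw [norm_smul, norm_smul, norm_inv, norm_norm, inv_mul_cancel₀ (norm_ne_zero_iff.2 hz), mul_one,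
    Real.norm_eq_abs, sq_abs, Real.sq_sqrt hr.le, div_self hr.ne']

lemma ne_zero_of_abs_norm_sq_div_sub_one_le {z : E d} (hz : |‖z‖ ^ 2 / r - 1| ≤ 1 / 2) :
    z ≠ 0 := by
  rintro rfl
  norm_num at hz

lemma abs_inner_smul_normalize_le (hr : 0 < r) {z : E d} (hz : |‖z‖ ^ 2 / r - 1| ≤ 1 / 2)
    (x : E d) : |inner ℝ (√r • (‖z‖⁻¹ • z)) x / r| ≤ 2 * |inner ℝ z x / r| := by
  have hz0 := norm_pos_iff.2 (ne_zero_of_abs_norm_sq_div_sub_one_le hz)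
  have hfactor : √r * ‖z‖⁻¹ ≤ 2 := by
    have hnorm : 1 / 2 ≤ ‖z‖ ^ 2 / r := by linarith [(abs_le.1 hz).1]
    rw [le_div_iff₀ hr] at hnorm
    rw [← div_eq_mul_inv, div_le_iff₀ hz0, Real.sqrt_le_left (by positivity)]
    nlinarith
  rw [smul_smul, real_inner_smul_left, mul_div_assoc, abs_mul, abs_of_nonneg (by positivity)]
  gcongr

lemma preimage_smul_normalize_lt_abs_inner_subset (hr : 0 < r) (δ : ℝ) (x : E d) :
    (fun z : E d => √r • (‖z‖⁻¹ • z)) ⁻¹' {y | δ < |inner ℝ y x / r|} ⊆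
      {z | ¬|‖z‖ ^ 2 / r - 1| ≤ 1 / 2} ∪ {z | δ / 2 < |inner ℝ z x / r|} := by
  intro z hz
  refine or_iff_not_imp_left.2 fun hz' => ?_
  have hle := abs_inner_smul_normalize_le hr (not_not.1 hz') x
  have hlt : δ < |inner ℝ (√r • (‖z‖⁻¹ • z)) x / r| := hz
  rw [Set.mem_ofPred_eq]
  linarith

lemma eLpNorm_one_add_norm_sq_div_sphereLaw_le [IsProbabilityMeasure Q] (hr : 0 < r) (p : ℝ≥0∞) :
    eLpNorm (fun x => 1 + ‖x‖ ^ 2 / r) p (sphereLaw r Q) ≤ 2 := by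
  have hbound (x : E d) : ‖1 + ‖√r • (‖x‖⁻¹ • x)‖ ^ 2 / r‖ ≤ 2 := by
    rw [Real.norm_of_nonneg (by positivity)]
    rcases eq_or_ne x 0 with rfl | hx
    · simp
    · rw [norm_sq_smul_normalize_div hr hx]; norm_num
  rw [sphereLaw, eLpNorm_map_measure (by fun_prop) (measurable_smul_normalize r).aemeasurable]
  refine (eLpNorm_le_of_ae_bound (ae_of_all _ hbound)).trans ?_
  simp

lemma Concentrates.sphereLaw [IsProbabilityMeasure Q] {q : ℕ} {C : ℝ≥0} (hr : 0 < r)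
    (h : Concentrates Q Set.univ r q C) :
    Concentrates (sphereLaw r Q) {1} r q (2 + (1 + 4 ^ q) * C) := by
  have hmeas := measurable_smul_normalize (d := d) r
  have hbad {δ : ℝ} (hδ : 0 < δ) (hδ' : δ ≤ 1 / 2) : Q {z | ¬|‖z‖ ^ 2 / r - 1| ≤ 1 / 2} ≤
      ENNReal.ofReal (C / (δ ^ 2 * r) ^ q) := by
    refine (measure_mono fun z hz => ?_).trans (h.norm_tail δ hδ hδ')
    exact fun hz' => hz (hz'.2.trans hδ')
  refine ⟨fun δ hδ hδ' => ?_, fun δ hδ hδ' x' hx' => ?_, ?_⟩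
  · have hshell : MeasurableSet {x : E d | ‖x‖ ^ 2 / r ∉ shell {1} δ} :=
      (measurableSet_shell (measurableSet_singleton 1) δ).compl.preimage
        (by fun_prop : Measurable fun x : E d => ‖x‖ ^ 2 / r)
    rw [PolyBarrier.sphereLaw, Measure.map_apply hmeas hshell]
    refine (measure_mono fun z hz => ?_).trans ((hbad hδ hδ').trans
      (ENNReal.ofReal_le_ofReal ?_))
    · refine fun hz' => hz ?_
      have hone := norm_sq_smul_normalize_div hr (ne_zero_of_abs_norm_sq_div_sub_one_le hz')
      simp [shell, hone, hδ.le]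
    · gcongr
      nlinarith [C.coe_nonneg, show (0 : ℝ) ≤ 4 ^ q * C by positivity]
  · rw [PolyBarrier.sphereLaw,
      Measure.map_apply hmeas (measurableSet_lt (by fun_prop) (by fun_prop))]
    have hscale : C / ((δ / 2) ^ 2 * r) ^ q = 4 ^ q * C / (δ ^ 2 * r) ^ q := by
      rw [div_pow, div_mul_eq_mul_div, div_pow, div_div_eq_mul_div, mul_comm (C : ℝ)]
      norm_num
    calc Q _ ≤ ENNReal.ofReal (C / (δ ^ 2 * r) ^ q) +
          ENNReal.ofReal (C / ((δ / 2) ^ 2 * r) ^ q) :=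
        (measure_mono (preimage_smul_normalize_lt_abs_inner_subset hr δ x')).trans
          ((measure_union_le _ _).trans (add_le_add (hbad hδ hδ')
            (h.inner_tail (δ / 2) (by linarith) (by linarith) x' hx')))
      _ ≤ _ := by
        rw [← ENNReal.ofReal_add (by positivity) (by positivity), hscale, ← add_div]
        refine ENNReal.ofReal_le_ofReal (div_le_div_of_nonneg_right ?_ (by positivity))
        push_cast
        linarith
  · refine (eLpNorm_one_add_norm_sq_div_sphereLaw_le hr _).trans ?_
    push_cast
    exact le_self_add

end Sphere

section Model

variable {d : ℕ} {ν : Measure ℝ} [IsProbabilityMeasure ν] {S R : Matrix (Fin d) (Fin d) ℝ}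

/-- The values that `‖x‖² / r` takes almost surely (up to the event `Z = 0` on the sphere). -/
def DataModel.shells (model : DataModel) : Set ℝ :=
  match model with
  | .covariance => Set.univ
  | .sphere => {1}

lemma DataModel.measurableSet_shells (model : DataModel) : MeasurableSet model.shells := by
  cases model
  · exact MeasurableSet.univ
  · exact measurableSet_singleton 1

instance (model : DataModel) : IsProbabilityMeasure (model.law ν S R) := by
  cases model
  · exact inferInstanceAs (IsProbabilityMeasure (covLaw ν R))
  · exact Measure.isProbabilityMeasure_map (measurable_smul_normalize _).aemeasurable

theorem DataModel.exists_concentrates (model : DataModel) (c : ℝ≥0) {q : ℕ} (hq : q ≠ 0) :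
    ∃ C : ℝ≥0, ∀ {d : ℕ} {R : Matrix (Fin d) (Fin d) ℝ} {ν : Measure ℝ} [IsProbabilityMeasure ν],
      HasSubgaussianMGF id c ν → ∫ w, w ^ 2 ∂ν = 1 → R.IsSymm → opNorm (R * R) = 1 →
      1 ≤ effDim (R * R) →
      Concentrates (model.law ν (R * R) R) model.shells (effDim (R * R)) q C := by
  obtain ⟨C, hC⟩ := exists_concentrates_covLaw c hq
  have hcov {d : ℕ} {R : Matrix (Fin d) (Fin d) ℝ} {ν : Measure ℝ} [IsProbabilityMeasure ν]
      (h : HasSubgaussianMGF id c ν) (hv : ∫ w, w ^ 2 ∂ν = 1) (hR : R.IsSymm)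
      (hnorm : opNorm (R * R) = 1) (hr : 1 ≤ effDim (R * R)) :
      Concentrates (covLaw ν R) Set.univ (effDim (R * R)) q C := by
    have hnorm' : opNorm R = 1 := by
      rw [opNorm_mul_self (Matrix.isHermitian_iff_isSymm.2 hR)] at hnorm
      exact (pow_eq_one_iff_of_nonneg (norm_nonneg _) two_ne_zero).1 hnorm
    rw [effDim, hnorm, div_one] at hr ⊢
    exact hC h hv hR hnorm' hr
  cases model with
  | covariance => exact ⟨C, hcov⟩
  | sphere => exact ⟨_, fun h hv hR hnorm hr =>
      (hcov h hv hR hnorm hr).sphereLaw (one_pos.trans_le hr)⟩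

end Model

section PSDKernel

variable {α β : Type*} {A : Set α} {k l : α → α → ℝ} {N : ℕ} {x : Fin N → α}

/-- The quadratic form of the kernel matrix of `k` at the points `x`. -/
def kernelForm (k : α → α → ℝ) (x : Fin N → α) (v : Fin N → ℝ) : ℝ :=
  ∑ i, ∑ j, v i * v j * k (x i) (x j)

lemma kernelForm_eq_dotProduct (k : α → α → ℝ) (x : Fin N → α) (v : Fin N → ℝ) :
    kernelForm k x v = v ⬝ᵥ (Matrix.of fun i j => k (x i) (x j)) *ᵥ v := by
  simp only [kernelForm, dotProduct, Matrix.mulVec, Matrix.of_apply, Finset.mul_sum]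
  exact Finset.sum_congr rfl fun i _ => Finset.sum_congr rfl fun j _ => by ring

lemma kernelForm_sum {ι : Type*} (s : Finset ι) (k : ι → α → α → ℝ) (x : Fin N → α)
    (v : Fin N → ℝ) :
    kernelForm (fun y z => ∑ a ∈ s, k a y z) x v = ∑ a ∈ s, kernelForm (k a) x v := by
  simp only [kernelForm, Finset.mul_sum]
  rw [Finset.sum_comm' (s := s) (t' := Finset.univ) (s' := fun _ => s) (by simp)]
  exact Finset.sum_congr rfl fun i _ => Finset.sum_comm

lemma kernelForm_sub (k l : α → α → ℝ) (x : Fin N → α) (v : Fin N → ℝ) :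
    kernelForm (fun y z => k y z - l y z) x v = kernelForm k x v - kernelForm l x v := by
  simp only [kernelForm, mul_sub, Finset.sum_sub_distrib]

lemma IsPSDKernelOn.kernelForm_nonneg (h : IsPSDKernelOn A k) (hx : ∀ i, x i ∈ A)
    (v : Fin N → ℝ) : 0 ≤ kernelForm k x v := by
  rw [kernelForm_eq_dotProduct]
  exact (h N x hx).dotProduct_mulVec_nonneg v

lemma isPSDKernelOn_of_kernelForm_nonneg (hs : ∀ y ∈ A, ∀ z ∈ A, k y z = k z y)
    (h : ∀ (N : ℕ) (x : Fin N → α), (∀ i, x i ∈ A) → ∀ v, 0 ≤ kernelForm k x v) :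
    IsPSDKernelOn A k := by
  intro N x hx
  refine Matrix.PosSemidef.of_dotProduct_mulVec_nonneg ?_ fun v => ?_
  · ext i j
    exact hs _ (hx j) _ (hx i)
  · rw [star_trivial, ← kernelForm_eq_dotProduct]
    exact h N x hx v

lemma IsPSDKernelOn.symm (h : IsPSDKernelOn A k) {y z : α} (hy : y ∈ A) (hz : z ∈ A) :
    k y z = k z y := by
  have := (h 2 ![y, z] (by simp [Fin.forall_fin_two, hy, hz])).isHermitian.apply 0 1
  simpa using this.symm

lemma IsPSDKernelOn.apply_self_nonneg (h : IsPSDKernelOn A k) {y : α} (hy : y ∈ A) :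
    0 ≤ k y y := by
  simpa [kernelForm] using h.kernelForm_nonneg (x := fun _ : Fin 1 => y) (fun _ => hy) 1

lemma IsPSDKernelOn.abs_le (h : IsPSDKernelOn A k) {y z : α} (hy : y ∈ A) (hz : z ∈ A) :
    |k y z| ≤ (k y y + k z z) / 2 := by
  have hyz : ∀ i, ![y, z] i ∈ A := by simp [Fin.forall_fin_two, hy, hz]
  have hsum := h.kernelForm_nonneg hyz ![1, 1]
  have hdiff := h.kernelForm_nonneg hyz ![1, -1]
  have hsymm := h.symm hy hz
  simp only [kernelForm, Fin.sum_univ_two, Matrix.cons_val_zero, Matrix.cons_val_one] at hsum hdiff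
  exact _root_.abs_le.2 ⟨by linarith, by linarith⟩

lemma IsPSDKernelOn.mul (hk : IsPSDKernelOn A k) (hl : IsPSDKernelOn A l) :
    IsPSDKernelOn A fun y z => k y z * l y z :=
  fun N x hx => (hk N x hx).hadamard (hl N x hx)

lemma isPSDKernelOn_const {c : ℝ} (hc : 0 ≤ c) : IsPSDKernelOn A fun _ _ => c := by
  refine isPSDKernelOn_of_kernelForm_nonneg (fun _ _ _ _ => rfl) fun N x _ v => ?_
  have : kernelForm (fun _ _ => c) x v = (∑ i, v i) ^ 2 * c := by
    rw [sq, Finset.sum_mul_sum]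
    simp only [kernelForm, Finset.sum_mul]
  rw [this]
  positivity

lemma IsPSDKernelOn.pow (hk : IsPSDKernelOn A k) (n : ℕ) :
    IsPSDKernelOn A fun y z => k y z ^ n := by
  induction n with
  | zero => simpa only [pow_zero] using isPSDKernelOn_const (A := A) zero_le_one
  | succ n ih => simpa only [pow_succ] using ih.mul hk

lemma IsPSDKernelOn.comp (hk : IsPSDKernelOn A k) (f : β → α) :
    IsPSDKernelOn (f ⁻¹' A) fun y z => k (f y) (f z) := fun N x hx => hk N (fun i => f (x i)) hx

lemma IsPSDKernelOn.mono {A' : Set α} (hk : IsPSDKernelOn A k) (h : A' ⊆ A) :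
    IsPSDKernelOn A' k := fun N x hx => hk N x fun i => h (hx i)

lemma isPSDKernelOn_inner {V : Type*} [NormedAddCommGroup V] [InnerProductSpace ℝ V] (A : Set V) :
    IsPSDKernelOn A fun y z => inner ℝ y z := by
  refine isPSDKernelOn_of_kernelForm_nonneg (fun y _ z _ => real_inner_comm z y) fun N x _ v => ?_
  have : kernelForm (fun y z => inner ℝ y z) x v =
      inner ℝ (∑ i, v i • x i) (∑ i, v i • x i) := by
    simp only [kernelForm, sum_inner]
    simp only [inner_sum, real_inner_smul_left, real_inner_smul_right, mul_assoc]
    exact Finset.sum_congr rfl fun i _ => Finset.sum_congr rfl fun j _ => mul_left_comm _ _ _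
  rw [this]
  exact real_inner_self_nonneg

lemma le_kernelForm_of_diag_offDiag {D e : ℝ} (he : 0 ≤ e) (hdiag : ∀ i, D ≤ k (x i) (x i))
    (hoff : ∀ i j, i ≠ j → |k (x i) (x j)| ≤ e) (v : Fin N → ℝ) :
    (D - N * e) * ∑ i, v i ^ 2 ≤ kernelForm k x v := by
  have hterm : ∀ i j, (if i = j then D * v i ^ 2 else 0) - e * (|v i| * |v j|) ≤
      v i * v j * k (x i) (x j) := by
    intro i j
    split_ifs with hij
    · subst hij
      have hle : D * v i ^ 2 ≤ v i * v i * k (x i) (x i) := by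
        nlinarith [hdiag i, sq_nonneg (v i)]
      have : 0 ≤ e * (|v i| * |v i|) := by positivity
      linarith
    · have hle : |v i * v j * k (x i) (x j)| ≤ |v i| * |v j| * e := by
        rw [abs_mul, abs_mul]
        gcongr
        exact hoff i j hij
      linarith [neg_abs_le (v i * v j * k (x i) (x j))]
  have hcauchy : (∑ i, |v i|) ^ 2 ≤ N * ∑ i, v i ^ 2 := by
    simpa using sq_sum_le_card_mul_sum_sq (s := Finset.univ) (f := fun i => |v i|)
  calc (D - N * e) * ∑ i, v i ^ 2 = D * ∑ i, v i ^ 2 - e * (N * ∑ i, v i ^ 2) := by ring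
    _ ≤ D * ∑ i, v i ^ 2 - e * (∑ i, |v i|) ^ 2 := by gcongr
    _ = ∑ i, ∑ j, ((if i = j then D * v i ^ 2 else 0) - e * (|v i| * |v j|)) := by
      rw [sq (∑ i, |v i|), Finset.sum_mul_sum]
      simp only [Finset.sum_sub_distrib, Finset.sum_ite_eq, Finset.mem_univ, if_true,
        Finset.mul_sum]
    _ ≤ _ := Finset.sum_le_sum fun i _ => Finset.sum_le_sum fun j _ => hterm i j

end PSDKernel

section KernelEstimate

variable {X : Type*} {k : X → X → ℝ} {lam : ℝ} {n : ℕ} {xs : Fin n → X} {ys α : Fin n → ℝ}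

lemma posSemidef_kernelMatrix (h : IsPSDKernelOn Set.univ k) : (kernelMatrix k).PosSemidef := by
  classical
  have hsymm : ∀ x y, k x y = k y x := fun x y => h.symm (Set.mem_univ x) (Set.mem_univ y)
  have htfae := (RKHS.posSemidef_tfae (K := kernelMatrix k)).out 0 2
  refine htfae.2 ⟨?_, fun v => ?_⟩
  · ext x y
    simp [kernelMatrix, hsymm y x, ContinuousLinearMap.star_eq_adjoint,
      ContinuousLinearMap.adjoint_id]
  · let e := v.support.equivFin.symm
    refine (h.kernelForm_nonneg (x := fun i => (e i : X)) (by simp) fun i => v (e i)).trans_eq ?_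
    change _ = ∑ a ∈ v.support, ∑ b ∈ v.support, v b * (k b a * v a)
    rw [← Finset.sum_coe_sort, ← e.sum_comp]
    refine Finset.sum_congr rfl fun i _ => ?_
    rw [← Finset.sum_coe_sort v.support fun b => v b * (k b (e i) * v (e i)), ← e.sum_comp]
    refine Finset.sum_congr rfl fun j _ => ?_
    rw [hsymm (e i) (e j)]
    ring

variable [hk : Fact (kernelMatrix k).PosSemidef]

lemma exists_kernel_combination (xs : Fin n → X) (α : Fin n → ℝ) :
    ∃ F : RKHS.OfKernel (kernelMatrix k), (∀ x, F x = ∑ i, α i * k x (xs i)) ∧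
      ∀ G : RKHS.OfKernel (kernelMatrix k), inner ℝ F G = ∑ i, α i * G (xs i) := by
  refine ⟨∑ i, α i • RKHS.kerFun (RKHS.OfKernel (kernelMatrix k)) (xs i) (1 : ℝ), fun x => ?_,
    fun G => ?_⟩
  · rw [← RKHS.coeCLM_apply, map_sum, Finset.sum_apply]
    refine Finset.sum_congr rfl fun i _ => ?_
    rw [RKHS.coeCLM_apply, RKHS.coe_smul, Pi.smul_apply, RKHS.kerFun_apply,
      RKHS.OfKernel.kernel_ofKernel]
    simp [kernelMatrix]
  · rw [sum_inner]
    refine Finset.sum_congr rfl fun i _ => ?_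
    rw [inner_smul_left, RKHS.kerFun_inner]
    simp

variable {F₀ : RKHS.OfKernel (kernelMatrix k)}

lemma norm_sq_eq_add_norm_sub_sq
    (hF₀ : ∀ G : RKHS.OfKernel (kernelMatrix k), inner ℝ F₀ G = ∑ i, α i * G (xs i))
    (G : RKHS.OfKernel (kernelMatrix k)) :
    ‖G‖ ^ 2 = ‖F₀‖ ^ 2 + ‖G - F₀‖ ^ 2 + 2 * ∑ i, α i * (G (xs i) - F₀ (xs i)) := by
  have hinner : ∑ i, α i * (G (xs i) - F₀ (xs i)) = inner ℝ F₀ (G - F₀) := by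
    rw [hF₀]
    simp
  rw [hinner, ← add_sub_cancel F₀ G, norm_add_sq_real, add_sub_cancel]
  ring

lemma ridge_objective_eq
    (hF₀ : ∀ G : RKHS.OfKernel (kernelMatrix k), inner ℝ F₀ G = ∑ i, α i * G (xs i))
    (hres : ∀ i, ys i - F₀ (xs i) = lam * α i) (G : RKHS.OfKernel (kernelMatrix k)) :
    ∑ i, (ys i - G (xs i)) ^ 2 + lam * ‖G‖ ^ 2 =
      (∑ i, (ys i - F₀ (xs i)) ^ 2 + lam * ‖F₀‖ ^ 2) +
        (∑ i, (G (xs i) - F₀ (xs i)) ^ 2 + lam * ‖G - F₀‖ ^ 2) := by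
  have hloss : ∑ i, (ys i - G (xs i)) ^ 2 = ∑ i, (ys i - F₀ (xs i)) ^ 2 +
      ∑ i, (G (xs i) - F₀ (xs i)) ^ 2 - 2 * lam * ∑ i, α i * (G (xs i) - F₀ (xs i)) := by
    rw [Finset.mul_sum, ← Finset.sum_add_distrib, ← Finset.sum_sub_distrib]
    exact Finset.sum_congr rfl fun i _ => by
      linear_combination (-2 * (G (xs i) - F₀ (xs i))) * hres i
  rw [hloss, norm_sq_eq_add_norm_sub_sq hF₀ G]
  ring

end KernelEstimate

section KernelEstimate

variable {X : Type*} {k : X → X → ℝ} {lam : ℝ} {n : ℕ} {xs : Fin n → X} {ys α : Fin n → ℝ}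

lemma isKernelEstimate_kernel_combination (hk : (kernelMatrix k).PosSemidef) (hlam : 0 ≤ lam)
    (hα : ∀ i, ∑ j, α j * k (xs i) (xs j) + lam * α i = ys i) :
    IsKernelEstimate k lam xs ys fun x => ∑ i, α i * k x (xs i) := by
  have : Fact (kernelMatrix k).PosSemidef := ⟨hk⟩
  obtain ⟨F₀, hF₀, hinner⟩ := exists_kernel_combination (k := k) xs α
  refine ⟨this, F₀, hF₀, ?_⟩
  rcases hlam.eq_or_lt with rfl | hpos
  · have hinterp : ∀ i, F₀ (xs i) = ys i := fun i => by rw [hF₀, ← hα i, zero_mul, add_zero]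
    refine Or.inr ⟨rfl, hinterp, fun G hG => le_of_sq_le_sq ?_ (norm_nonneg _)⟩
    rw [norm_sq_eq_add_norm_sub_sq hinner G]
    simp only [hG, hinterp, sub_self, mul_zero, Finset.sum_const_zero, add_zero]
    exact le_add_of_nonneg_right (sq_nonneg _)
  · refine Or.inl ⟨hpos, fun G => ?_⟩
    rw [ridge_objective_eq hinner (fun i => by rw [hF₀, ← hα i]; ring) G]
    exact le_add_of_nonneg_right (by positivity)

lemma IsKernelEstimate.eq_kernel_combination
    (hα : ∀ i, ∑ j, α j * k (xs i) (xs j) + lam * α i = ys i) {f : X → ℝ}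
    (hf : IsKernelEstimate k lam xs ys f) : f = fun x => ∑ i, α i * k x (xs i) := by
  obtain ⟨_, F, hFf, hF⟩ := hf
  obtain ⟨F₀, hF₀, hinner⟩ := exists_kernel_combination (k := k) xs α
  have hnorm : ‖F - F₀‖ ^ 2 ≤ 0 := by
    rcases hF with ⟨hpos, hmin⟩ | ⟨rfl, hinterp, hmin⟩
    · have hle := hmin F₀
      rw [ridge_objective_eq hinner (fun i => by rw [hF₀, ← hα i]; ring) F] at hle
      have : 0 ≤ ∑ i, (F (xs i) - F₀ (xs i)) ^ 2 := Finset.sum_nonneg fun i _ => sq_nonneg _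
      exact nonpos_of_mul_nonpos_right (by linarith) hpos
    · have hinterp₀ : ∀ i, F₀ (xs i) = ys i := fun i => by rw [hF₀, ← hα i, zero_mul, add_zero]
      have hdecomp := norm_sq_eq_add_norm_sub_sq hinner F
      simp only [hinterp, hinterp₀, sub_self, mul_zero, Finset.sum_const_zero, add_zero] at hdecomp
      have := pow_le_pow_left₀ (norm_nonneg F) (hmin F₀ hinterp₀) 2
      linarith
  have heq : F = F₀ := sub_eq_zero.1 (norm_eq_zero.1 (by nlinarith [norm_nonneg (F - F₀)]))
  funext x
  rw [← hFf, heq, hF₀]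

lemma kernelEstimate_eq (hk : (kernelMatrix k).PosSemidef) (hlam : 0 ≤ lam)
    (hα : ∀ i, ∑ j, α j * k (xs i) (xs j) + lam * α i = ys i) :
    kernelEstimate k lam xs ys = fun x => ∑ i, α i * k x (xs i) := by
  have hex : ∃ f, IsKernelEstimate k lam xs ys f :=
    ⟨_, isKernelEstimate_kernel_combination hk hlam hα⟩
  rw [kernelEstimate, dif_pos hex]
  exact hex.choose_spec.eq_kernel_combination hα

end KernelEstimate

section Coercive

variable {n : ℕ} {A : Matrix (Fin n) (Fin n) ℝ} {c : ℝ}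

lemma isUnit_det_of_coercive (hc : 0 < c) (hA : ∀ v, c * ∑ i, v i ^ 2 ≤ v ⬝ᵥ A *ᵥ v) :
    IsUnit A.det := by
  refine (Matrix.isUnit_iff_isUnit_det A).1 (Matrix.mulVec_injective_iff_isUnit.1 ?_)
  rw [← Matrix.coe_mulVecLin, ← LinearMap.ker_eq_bot, LinearMap.ker_eq_bot']
  intro v (hv : A *ᵥ v = 0)
  have hle := hA v
  rw [hv, dotProduct_zero] at hle
  have hzero := (nonpos_of_mul_nonpos_right hle hc).antisymm
    (Finset.sum_nonneg fun i _ => sq_nonneg (v i))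
  funext i
  exact pow_eq_zero_iff two_ne_zero |>.1
    ((Finset.sum_eq_zero_iff_of_nonneg fun i _ => sq_nonneg (v i)).1 hzero i (Finset.mem_univ _))

lemma sq_mul_sum_sq_le_of_coercive (hc : 0 < c) (hA : ∀ v, c * ∑ i, v i ^ 2 ≤ v ⬝ᵥ A *ᵥ v)
    (v : Fin n → ℝ) : c ^ 2 * ∑ i, v i ^ 2 ≤ ∑ i, (A *ᵥ v) i ^ 2 := by
  set a := ∑ i, v i ^ 2
  have ha : 0 ≤ a := Finset.sum_nonneg fun i _ => sq_nonneg _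
  have hcauchy : (c * a) ^ 2 ≤ a * ∑ i, (A *ᵥ v) i ^ 2 :=
    (pow_le_pow_left₀ (by positivity) (hA v) 2).trans
      (Finset.sum_mul_sq_le_sq_mul_sq Finset.univ v (A *ᵥ v))
  rcases ha.eq_or_lt with h0 | hpos
  · rw [← h0, mul_zero]
    exact Finset.sum_nonneg fun i _ => sq_nonneg _
  · refine le_of_mul_le_mul_left ?_ hpos
    linarith

end Coercive

lemma averagedEstimate_eq {d n : ℕ} {k : E d → E d → ℝ} {lam : ℝ} (κ : Kernel (E d) ℝ)
    [IsMarkovKernel κ] {xs : Fin n → E d} (hint : ∀ i, Integrable (fun y : ℝ => y) (κ (xs i)))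
    {L : Fin n → Fin n → ℝ}
    (hL : ∀ ys x, kernelEstimate k lam xs ys x = ∑ i, (∑ j, L i j * ys j) * k x (xs i)) (x : E d) :
    averagedEstimate k lam κ xs x =
      ∑ i, (∑ j, L i j * groundTruth κ (xs j)) * k x (xs i) := by
  have hcoord : ∀ j, Integrable (fun ys : Fin n → ℝ => ys j) (Measure.pi fun i => κ (xs i)) :=
    fun j => integrable_comp_eval (μ := fun i => κ (xs i)) (i := j) (f := fun y : ℝ => y) (hint j)
  have hmean : ∀ j, ∫ ys : Fin n → ℝ, ys j ∂(Measure.pi fun i => κ (xs i)) =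
      groundTruth κ (xs j) := fun j =>
    integral_comp_eval (μ := fun i => κ (xs i)) (f := fun y : ℝ => y) (by fun_prop)
  simp only [averagedEstimate, hL]
  rw [integral_finsetSum _ fun i _ =>
    (integrable_finsetSum _ fun j _ => (hcoord j).const_mul _).mul_const _]
  refine Finset.sum_congr rfl fun i _ => ?_
  rw [integral_mul_const, integral_finsetSum _ fun j _ => (hcoord j).const_mul _]
  simp only [integral_const_mul, hmean]

lemma exists_averagedEstimate_eq {d n : ℕ} {k : E d → E d → ℝ}
    (hk : IsPSDKernelOn Set.univ k) {lam : ℝ} (hlam : 0 ≤ lam) (κ : Kernel (E d) ℝ)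
    [IsMarkovKernel κ] {xs : Fin n → E d}
    (hint : ∀ i, Integrable (fun y : ℝ => y) (κ (xs i))) {c : ℝ} (hc : 0 < c)
    (hlow : ∀ v, c * ∑ i, v i ^ 2 ≤ kernelForm k xs v) :
    ∃ α : Fin n → ℝ, (∀ x, averagedEstimate k lam κ xs x = ∑ i, α i * k x (xs i)) ∧
      c ^ 2 * ∑ i, α i ^ 2 ≤ ∑ i, groundTruth κ (xs i) ^ 2 := by
  set A : Matrix (Fin n) (Fin n) ℝ := Matrix.of (fun i j => k (xs i) (xs j)) + lam • 1 with hA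
  have hAv : ∀ v, A *ᵥ v = (Matrix.of fun i j => k (xs i) (xs j)) *ᵥ v + lam • v := by
    intro v
    rw [hA, Matrix.add_mulVec, Matrix.smul_mulVec, Matrix.one_mulVec]
  have hcoer : ∀ v, c * ∑ i, v i ^ 2 ≤ v ⬝ᵥ A *ᵥ v := by
    intro v
    have hsq : v ⬝ᵥ v = ∑ i, v i ^ 2 := by simp only [dotProduct, sq]
    rw [hAv, dotProduct_add, ← kernelForm_eq_dotProduct, dotProduct_smul, smul_eq_mul, hsq]
    exact (hlow v).trans (le_add_of_nonneg_right (by positivity))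
  have hsol : ∀ y, A *ᵥ (A⁻¹ *ᵥ y) = y := by
    intro y
    rw [Matrix.mulVec_mulVec, Matrix.mul_nonsing_inv _ (isUnit_det_of_coercive hc hcoer),
      Matrix.one_mulVec]
  refine ⟨A⁻¹ *ᵥ fun j => groundTruth κ (xs j), averagedEstimate_eq κ hint fun ys x => ?_, ?_⟩
  · refine congrFun (kernelEstimate_eq (posSemidef_kernelMatrix hk) hlam fun i => ?_) x
    have hi := congrFun (hsol ys) i
    rw [hAv] at hi
    rw [← hi]
    exact congrArg (· + _) (Finset.sum_congr rfl fun j _ => mul_comm _ _)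
  · simpa only [hsol] using sq_mul_sum_sq_le_of_coercive hc hcoer
      (A⁻¹ *ᵥ fun j => groundTruth κ (xs j))

/-! ### Kernels with a barrier -/

/-- The polynomial `∑_{k, l ≤ M} a k l t (s - 1)^l w^k`, which stands in for a rotationally
invariant kernel at `s = ‖x‖²`, `t = ‖x'‖²` and `w = xᵀx'`. -/
def shellPoly (a : ℕ → ℕ → ℝ → ℝ) (M : ℕ) (s t w : ℝ) : ℝ :=
  ∑ k ∈ Finset.range (M + 1), ∑ l ∈ Finset.range (M + 1), a k l t * (s - 1) ^ l * w ^ k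

/-- The kernel `g` is `shellPoly a M` up to `C δ^(M+1)` for pairs of points that are `δ`-close to
the unit sphere and `δ`-almost orthogonal. -/
structure ShellApprox (g : ℝ → ℝ → ℝ → ℝ) (a : ℕ → ℕ → ℝ → ℝ) (M : ℕ) (T : Set ℝ) (C δ : ℝ) :
    Prop where
  abs_coeff_le : ∀ k ≤ M, ∀ l ≤ M, ∀ t, |t - 1| ≤ δ → |a k l t| ≤ C
  abs_sub_le : ∀ {d : ℕ} (x x' : E d), ‖x‖ ^ 2 ∈ shell T δ → ‖x'‖ ^ 2 ∈ shell T δ →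
    |inner ℝ x x'| ≤ δ →
    |rotKernel g x x' - shellPoly a M (‖x‖ ^ 2) (‖x'‖ ^ 2) (inner ℝ x x')| ≤ C * δ ^ (M + 1)

/-- The points are `δ`-close to the unit sphere and pairwise `δ`-almost orthogonal. -/
structure NearOrthonormal (T : Set ℝ) (δ : ℝ) {d N : ℕ} (x : Fin N → E d) : Prop where
  norm_sq_mem : ∀ i, ‖x i‖ ^ 2 ∈ shell T δ
  abs_inner_le : ∀ i j, i ≠ j → |inner ℝ (x i) (x j)| ≤ δ

/-- What the polynomial barrier needs of a kernel: on nearly orthonormal points it is a polynomial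
of degree at most `m` up to an error `O(δ^(M+1))`, while its quadratic form stays bounded below. The
degree bound counts `‖x‖²` twice. -/
structure BarrierKernel (g : ℝ → ℝ → ℝ → ℝ) (M m : ℕ) (T : Set ℝ) : Prop where
  posSemidef : ∀ d : ℕ, IsPSDKernelOn Set.univ (rotKernel g (d := d))
  approx : ∃ (a : ℕ → ℕ → ℝ → ℝ) (C : ℝ), 0 ≤ C ∧ (∀ k l t, a k l t ≠ 0 → k + 2 * l ≤ m) ∧
    ∀ᶠ δ in 𝓝[>] (0 : ℝ), ShellApprox g a M T C δ
  coercive : ∃ c η : ℝ, 0 < c ∧ 0 < η ∧ ∀ᶠ δ in 𝓝[>] (0 : ℝ),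
    ∀ {d N : ℕ} (x : Fin N → E d), N * δ ^ (M + 1) ≤ η → NearOrthonormal T δ x →
      ∀ v, c * ∑ i, v i ^ 2 ≤ kernelForm (rotKernel g) x v

section Shell

variable {g : ℝ → ℝ → ℝ → ℝ} {a : ℕ → ℕ → ℝ → ℝ} {M m : ℕ} {T : Set ℝ}

lemma shellPoly_ite_add_le (s t w : ℝ) :
    shellPoly (fun k l t => if k + l ≤ M then a k l t else 0) M s t w =
      ∑ k ∈ Finset.range (M + 1),
        (∑ l ∈ Finset.range (M + 1 - k), a k l t * (s - 1) ^ l) * w ^ k := by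
  refine Finset.sum_congr rfl fun k _ => ?_
  rw [Finset.sum_mul]
  refine (Finset.sum_subset_zero_on_sdiff (fun l hl => ?_) (fun l hl => ?_) fun l hl => ?_).symm
  · rw [Finset.mem_range] at hl ⊢
    omega
  · rw [Finset.mem_sdiff, Finset.mem_range, Finset.mem_range] at hl
    simp only [if_neg (show ¬k + l ≤ M by omega), zero_mul]
  · rw [Finset.mem_range] at hl
    simp only [if_pos (show k + l ≤ M by omega)]

lemma shellPoly_ite_eq_zero_one (t w : ℝ) :
    shellPoly (fun k l t => if l = 0 ∧ k ≤ M then a k l t else 0) M 1 t w =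
      shellPoly a M 1 t w := by
  refine Finset.sum_congr rfl fun k hk => Finset.sum_congr rfl fun l _ => ?_
  rcases eq_or_ne l 0 with rfl | hl
  · simp [Finset.mem_range_succ_iff.1 hk]
  · simp [hl]

/-- On the sphere `(‖x‖² - 1)^l` vanishes for `l ≠ 0`, which lowers the degree to `M`. -/
lemma BarrierKernel.sphere (h : BarrierKernel g M m T) (hT : 1 ∈ T) : BarrierKernel g M M {1} := by
  have hshell {δ s : ℝ} (hs : s ∈ shell {1} δ) : s ∈ shell T δ := ⟨hs.1 ▸ hT, hs.2⟩
  refine ⟨h.posSemidef, ?_, ?_⟩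
  · obtain ⟨a, C, hC, -, ha⟩ := h.approx
    refine ⟨fun k l t => if l = 0 ∧ k ≤ M then a k l t else 0, C, hC, fun k l t hne => ?_, ?_⟩
    · by_contra hcon
      exact hne (if_neg (by omega))
    · filter_upwards [ha] with δ hδ
      refine ⟨fun k hk l hl t ht => ?_, fun x x' hx hx' hw => ?_⟩
      · split_ifs
        · exact hδ.abs_coeff_le k hk l hl t ht
        · simpa using hC
      · have happrox := hδ.abs_sub_le x x' (hshell hx) (hshell hx') hw
        rw [show ‖x‖ ^ 2 = 1 from hx.1] at happrox ⊢
        rwa [shellPoly_ite_eq_zero_one]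
  · obtain ⟨c, η, hc, hη, hcoer⟩ := h.coercive
    refine ⟨c, η, hc, hη, ?_⟩
    filter_upwards [hcoer] with δ hδ d N x hN hx
    exact hδ x hN ⟨fun i => hshell (hx.norm_sq_mem i), hx.abs_inner_le⟩

end Shell

/-! ### Kernels given by a power series near the sphere -/

/-- A kernel with a power series `k(x, x') = ∑ⱼ gⱼ(‖x‖², ‖x'‖²) (xᵀx')ʲ` for squared norms in `T`
whose coefficients are positive semi-definite and whose tail beyond order `M` is, on the diagonal,
bounded below by `c`. -/
structure ShellPowerSeries (g : ℝ → ℝ → ℝ → ℝ) (gc : ℕ → ℝ → ℝ → ℝ) (M : ℕ) (T : Set ℝ) (C c : ℝ) :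
    Prop where
  half_le : ∀ s ∈ T, 1 / 2 ≤ s
  posSemidef : ∀ j, IsPSDKernelOn T (gc j)
  expansion : ∀ {d : ℕ} (x x' : E d), ‖x‖ ^ 2 ∈ T → ‖x'‖ ^ 2 ∈ T →
    HasSum (fun j : ℕ => gc j (‖x‖ ^ 2) (‖x'‖ ^ 2) * (inner ℝ x x') ^ j) (rotKernel g x x')
  nonneg : 0 ≤ C
  diag_le : ∀ s ∈ T, g s s s ≤ C
  pos : 0 < c
  le_diag_tail : ∀ s ∈ T, c ≤ g s s s - ∑ j ∈ Finset.range (M + 1), gc j s s * s ^ j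

section PowerSeries

variable {g : ℝ → ℝ → ℝ → ℝ} {gc : ℕ → ℝ → ℝ → ℝ} {M : ℕ} {T : Set ℝ} {C c δ : ℝ}

lemma apply_le_sub_sum_range {u : ℕ → ℝ} {S : ℝ} (hu : HasSum u S) (h0 : ∀ j, 0 ≤ u j)
    {J N : ℕ} (hJ : N ≤ J) : u J ≤ S - ∑ j ∈ Finset.range N, u j := by
  have hle := sum_le_hasSum (insert J (Finset.range N)) (fun j _ => h0 j) hu
  rw [Finset.sum_insert (by simpa using hJ)] at hle
  linarith

lemma pow_le_two_mul_pow_mul_pow (hδ0 : 0 ≤ δ) (hδ : δ ≤ 1 / 2) {s : ℝ} (hs : 1 / 2 ≤ s)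
    {N k : ℕ} (hk : N ≤ k) : δ ^ k ≤ (2 * δ) ^ N * s ^ k :=
  calc δ ^ k ≤ (2 * δ * s) ^ k := pow_le_pow_left₀ hδ0 (by nlinarith) k
    _ = (2 * δ) ^ k * s ^ k := mul_pow _ _ _
    _ ≤ (2 * δ) ^ N * s ^ k :=
      mul_le_mul_of_nonneg_right (pow_le_pow_of_le_one (by positivity) (by linarith) hk)
        (by positivity)

namespace ShellPowerSeries

lemma rotKernel_self_le (h : ShellPowerSeries g gc M T C c) {d : ℕ} {x : E d} (hx : ‖x‖ ^ 2 ∈ T) :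
    rotKernel g x x ≤ C := by
  rw [rotKernel, real_inner_self_eq_norm_sq]
  exact h.diag_le _ hx

lemma term_self_nonneg (h : ShellPowerSeries g gc M T C c) {s : ℝ} (hs : s ∈ T) (j : ℕ) :
    0 ≤ gc j s s * s ^ j :=
  mul_nonneg ((h.posSemidef j).apply_self_nonneg hs)
    (pow_nonneg (by linarith [h.half_le s hs]) j)

lemma abs_term_le (h : ShellPowerSeries g gc M T C c) (hδ : δ ≤ 1 / 2) {s t w : ℝ} (hs : s ∈ T)
    (ht : t ∈ T) (hw : |w| ≤ δ) {N k : ℕ} (hk : N ≤ k) :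
    |gc k s t * w ^ k| ≤ (2 * δ) ^ N / 2 * (gc k s s * s ^ k + gc k t t * t ^ k) := by
  have hδ0 : 0 ≤ δ := (abs_nonneg w).trans hw
  have hgs := (h.posSemidef k).apply_self_nonneg hs
  have hgt := (h.posSemidef k).apply_self_nonneg ht
  rw [abs_mul, abs_pow]
  calc |gc k s t| * |w| ^ k ≤ (gc k s s + gc k t t) / 2 * δ ^ k := by
        gcongr
        exact (h.posSemidef k).abs_le hs ht
    _ = gc k s s / 2 * δ ^ k + gc k t t / 2 * δ ^ k := by ring
    _ ≤ gc k s s / 2 * ((2 * δ) ^ N * s ^ k) + gc k t t / 2 * ((2 * δ) ^ N * t ^ k) := by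
        gcongr
        · exact pow_le_two_mul_pow_mul_pow hδ0 hδ (h.half_le s hs) hk
        · exact pow_le_two_mul_pow_mul_pow hδ0 hδ (h.half_le t ht) hk
    _ = _ := by ring

/-- The off-diagonal tail is compared with the two diagonal tails term by term. -/
lemma abs_tail_le (h : ShellPowerSeries g gc M T C c) (hδ : δ ≤ 1 / 2) {d : ℕ} {x x' : E d}
    (hx : ‖x‖ ^ 2 ∈ T) (hx' : ‖x'‖ ^ 2 ∈ T) (hw : |inner ℝ x x'| ≤ δ) (N : ℕ) :
    |rotKernel g x x' - ∑ j ∈ Finset.range N,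
      gc j (‖x‖ ^ 2) (‖x'‖ ^ 2) * (inner ℝ x x') ^ j| ≤ C * (2 * δ) ^ N := by
  have hδ0 : 0 ≤ δ := (abs_nonneg _).trans hw
  have hdiag {y : E d} (hy : ‖y‖ ^ 2 ∈ T) : ∃ D ≤ C,
      HasSum (fun j => gc (j + N) (‖y‖ ^ 2) (‖y‖ ^ 2) * (‖y‖ ^ 2) ^ (j + N)) D := by
    have hsum := h.expansion y y hy hy
    simp only [real_inner_self_eq_norm_sq] at hsum
    refine ⟨_, ?_, (hasSum_nat_add_iff' N).2 hsum⟩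
    linarith [h.rotKernel_self_le hy, Finset.sum_nonneg fun j (_ : j ∈ Finset.range N) =>
      h.term_self_nonneg hy j]
  obtain ⟨D, hD, hsum⟩ := hdiag hx
  obtain ⟨D', hD', hsum'⟩ := hdiag hx'
  have htail := (hasSum_nat_add_iff' N).2 (h.expansion x x' hx hx')
  rw [← htail.tsum_eq, ← Real.norm_eq_abs]
  refine (tsum_of_norm_bounded ((hsum.add hsum').mul_left ((2 * δ) ^ N / 2)) fun j =>
    h.abs_term_le hδ hx hx' hw (Nat.le_add_left N j)).trans ?_
  calc (2 * δ) ^ N / 2 * (D + D') ≤ (2 * δ) ^ N / 2 * (C + C) := by gcongr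
    _ = C * (2 * δ) ^ N := by ring

/-- Dropping the terms of order at most `M`, which are positive semi-definite, leaves a diagonally
dominant matrix. -/
lemma le_kernelForm (h : ShellPowerSeries g gc M T C c) (hδ0 : 0 ≤ δ) (hδ : δ ≤ 1 / 2) {d N : ℕ}
    {x : Fin N → E d} (hx : ∀ i, ‖x i‖ ^ 2 ∈ T)
    (hw : ∀ i j, i ≠ j → |inner ℝ (x i) (x j)| ≤ δ) (v : Fin N → ℝ) :
    (c - N * (C * (2 * δ) ^ (M + 1))) * ∑ i, v i ^ 2 ≤ kernelForm (rotKernel g) x v := by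
  have htail := le_kernelForm_of_diag_offDiag (x := x) (D := c) (e := C * (2 * δ) ^ (M + 1))
    (k := fun y z => rotKernel g y z - ∑ j ∈ Finset.range (M + 1),
      gc j (‖y‖ ^ 2) (‖z‖ ^ 2) * (inner ℝ y z) ^ j)
    (mul_nonneg h.nonneg (by positivity))
    (fun i => by
      simp only [rotKernel, real_inner_self_eq_norm_sq]
      exact h.le_diag_tail _ (hx i))
    (fun i j hij => h.abs_tail_le hδ (hx i) (hx j) (hw i j hij) (M + 1)) v
  rw [kernelForm_sub, kernelForm_sum] at htail
  have hhead : 0 ≤ ∑ j ∈ Finset.range (M + 1),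
      kernelForm (fun y z : E d => gc j (‖y‖ ^ 2) (‖z‖ ^ 2) * (inner ℝ y z) ^ j) x v :=
    Finset.sum_nonneg fun j _ => (((h.posSemidef j).comp fun y : E d => ‖y‖ ^ 2).mul
      ((isPSDKernelOn_inner _).pow j)).kernelForm_nonneg hx v
  linarith

lemma coercive (h : ShellPowerSeries g gc M T C c) {T' : Set ℝ}
    (hT' : ∀ᶠ δ in 𝓝[>] (0 : ℝ), shell T' δ ⊆ T) :
    ∃ c' η : ℝ, 0 < c' ∧ 0 < η ∧ ∀ᶠ δ in 𝓝[>] (0 : ℝ),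
      ∀ {d N : ℕ} (x : Fin N → E d), N * δ ^ (M + 1) ≤ η → NearOrthonormal T' δ x →
        ∀ v, c' * ∑ i, v i ^ 2 ≤ kernelForm (rotKernel g) x v := by
  have hC := h.nonneg
  have hc := h.pos
  set D := C * 2 ^ (M + 1) + 1
  have hD0 : 0 < D := by positivity
  refine ⟨c / 2, c / (2 * D), by positivity, by positivity, ?_⟩
  filter_upwards [hT', Ioo_mem_nhdsGT (show (0 : ℝ) < 1 / 2 by norm_num)]
    with δ hsub ⟨hδ0, hδ⟩ d N x hN hx v
  refine le_trans (mul_le_mul_of_nonneg_right ?_ (Finset.sum_nonneg fun i _ => sq_nonneg _))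
    (h.le_kernelForm hδ0.le hδ.le (fun i => hsub (hx.norm_sq_mem i)) hx.abs_inner_le v)
  have hoff : N * (C * (2 * δ) ^ (M + 1)) ≤ c / 2 :=
    calc N * (C * (2 * δ) ^ (M + 1)) = N * δ ^ (M + 1) * (C * 2 ^ (M + 1)) := by
          rw [mul_pow]; ring
      _ ≤ c / (2 * D) * D := by gcongr; exact (lt_add_one _).le
      _ = c / 2 := by field_simp
  linarith

end ShellPowerSeries

end PowerSeries

/-! ### Taylor expansion of the coefficients -/

/-- `∑_{l < m} aₗ(t) (s - 1)^l` is a Taylor expansion of `f(s, t)` in the first variable, with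
uniform constant `C` over the box `|s - 1|, |t - 1| ≤ δ`. -/
structure TaylorApprox (f : ℝ → ℝ → ℝ) (a : ℕ → ℝ → ℝ) (m : ℕ) (C δ : ℝ) : Prop where
  abs_coeff_le : ∀ l t, |t - 1| ≤ δ → |a l t| ≤ C
  abs_sub_le : ∀ s t, |s - 1| ≤ δ → |t - 1| ≤ δ →
    |f s t - ∑ l ∈ Finset.range m, a l t * (s - 1) ^ l| ≤ C * |s - 1| ^ m

section Taylor

variable {f : ℝ → ℝ → ℝ} {a : ℕ → ℝ → ℝ} {m : ℕ} {C C' δ : ℝ}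

lemma TaylorApprox.mono (h : TaylorApprox f a m C δ) (hC : C ≤ C') : TaylorApprox f a m C' δ :=
  ⟨fun l t ht => (h.abs_coeff_le l t ht).trans hC, fun s t hs ht =>
    (h.abs_sub_le s t hs ht).trans (mul_le_mul_of_nonneg_right hC (by positivity))⟩

lemma eventually_box {p : ℝ × ℝ → Prop} (h : ∀ᶠ z in 𝓝 ((1 : ℝ), (1 : ℝ)), p z) :
    ∀ᶠ δ in 𝓝[>] (0 : ℝ), ∀ s t, |s - 1| ≤ δ → |t - 1| ≤ δ → p (s, t) := by
  obtain ⟨ε, hε, hb⟩ := Metric.eventually_nhds_iff.1 h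
  filter_upwards [Ioo_mem_nhdsGT hε] with δ hδ s t hs ht
  apply hb
  rw [Prod.dist_eq, max_lt_iff, Real.dist_eq, Real.dist_eq]
  exact ⟨hs.trans_lt hδ.2, ht.trans_lt hδ.2⟩

lemma eventually_box_abs_le {f : ℝ × ℝ → ℝ} (h : ContinuousAt f (1, 1)) :
    ∀ᶠ δ in 𝓝[>] (0 : ℝ), ∀ s t, |s - 1| ≤ δ → |t - 1| ≤ δ → |f (s, t)| ≤ |f (1, 1)| + 1 :=
  eventually_box (p := fun z => |f z| ≤ |f (1, 1)| + 1) <|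
    (h.abs.eventually_lt_const (lt_add_one _)).mono fun _ hz => hz.le

lemma abs_sub_taylor_le_of_deriv {φ φ' : ℝ → ℝ} {b : ℕ → ℝ} {u₀ s : ℝ}
    (hφ : ∀ u ∈ Set.uIcc u₀ s, HasDerivAt φ (φ' u) u)
    (hbound : ∀ u ∈ Set.uIcc u₀ s, |φ' u - ∑ l ∈ Finset.range m, b l * (u - u₀) ^ l| ≤ C) :
    |φ s - (∑ l ∈ Finset.range m, b l / (l + 1 : ℕ) * (s - u₀) ^ (l + 1) + φ u₀)| ≤
      C * |s - u₀| := by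
  set H : ℝ → ℝ := fun u => φ u - ∑ l ∈ Finset.range m, b l / (l + 1 : ℕ) * (u - u₀) ^ (l + 1)
    with hH
  have hterm (l : ℕ) (u : ℝ) :
      HasDerivAt (fun u => b l / (l + 1 : ℕ) * (u - u₀) ^ (l + 1)) (b l * (u - u₀) ^ l) u := by
    have hl : ((l + 1 : ℕ) : ℝ) ≠ 0 := by positivity
    refine ((((hasDerivAt_id' u).sub_const u₀).pow (l + 1)).const_mul _).congr_deriv ?_
    rw [Nat.add_sub_cancel]
    field_simp
  have hder : ∀ u ∈ Set.uIcc u₀ s, HasDerivWithinAt H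
      (φ' u - ∑ l ∈ Finset.range m, b l * (u - u₀) ^ l) (Set.uIcc u₀ s) u := fun u hu =>
    ((hφ u hu).sub (HasDerivAt.fun_sum fun l _ => hterm l u)).hasDerivWithinAt
  have hle := Convex.norm_image_sub_le_of_norm_hasDerivWithin_le hder hbound (convex_uIcc u₀ s)
    Set.left_mem_uIcc Set.right_mem_uIcc
  have hHu₀ : H u₀ = φ u₀ := by simp [hH]
  rwa [hHu₀, Real.norm_eq_abs, Real.norm_eq_abs, hH, sub_sub] at hle

/-- Integrating the Taylor expansion of the partial derivative. -/
lemma TaylorApprox.of_deriv {f' : ℝ → ℝ → ℝ} (h : TaylorApprox f' a m C δ) (hδ : 0 ≤ δ)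
    (hder : ∀ s t, |s - 1| ≤ δ → |t - 1| ≤ δ → HasDerivAt (fun u => f u t) (f' s t) s)
    (hC' : 0 ≤ C') (hf : ∀ t, |t - 1| ≤ δ → |f 1 t| ≤ C') :
    TaylorApprox f (fun l t => if l = 0 then f 1 t else a (l - 1) t / l) (m + 1) (C + C') δ := by
  have hC : 0 ≤ C := (abs_nonneg _).trans (h.abs_coeff_le 0 1 (by simpa using hδ))
  refine ⟨fun l t ht => ?_, fun s t hs ht => ?_⟩
  · split_ifs with hl
    · linarith [hf t ht]
    · calc |a (l - 1) t / l| ≤ |a (l - 1) t| := by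
            rw [abs_div, Nat.abs_cast]
            exact div_le_self (abs_nonneg _) (by exact_mod_cast Nat.one_le_iff_ne_zero.2 hl)
        _ ≤ C + C' := by linarith [h.abs_coeff_le (l - 1) t ht]
  · have hmem {u : ℝ} (hu : u ∈ Set.uIcc 1 s) : |u - 1| ≤ |s - 1| := Set.abs_sub_left_of_mem_uIcc hu
    have hle := abs_sub_taylor_le_of_deriv (φ := fun u => f u t) (C := C * |s - 1| ^ m)
      (fun u hu => hder u t ((hmem hu).trans hs) ht) fun u hu =>
        (h.abs_sub_le u t ((hmem hu).trans hs) ht).trans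
          (mul_le_mul_of_nonneg_left (pow_le_pow_left₀ (abs_nonneg _) (hmem hu) m) hC)
    rw [Finset.sum_range_succ']
    simp only [Nat.add_eq_zero_iff, one_ne_zero, and_false, if_false, Nat.add_sub_cancel, if_true,
      pow_zero, mul_one]
    calc _ ≤ C * |s - 1| ^ m * |s - 1| := hle
      _ = C * |s - 1| ^ (m + 1) := by ring
      _ ≤ (C + C') * |s - 1| ^ (m + 1) := by gcongr; linarith

lemma exists_taylorApprox (m : ℕ) : ∀ f : ℝ → ℝ → ℝ,
    ContDiffAt ℝ m (fun p : ℝ × ℝ => f p.1 p.2) (1, 1) →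
      ∃ (a : ℕ → ℝ → ℝ) (C : ℝ), 0 ≤ C ∧ ∀ᶠ δ in 𝓝[>] (0 : ℝ), TaylorApprox f a m C δ := by
  induction m with
  | zero =>
    intro f hf
    refine ⟨fun _ _ => 0, |f 1 1| + 1, by positivity, ?_⟩
    filter_upwards [eventually_box_abs_le hf.continuousAt] with δ hδ
    exact ⟨fun _ _ _ => by simp only [abs_zero]; positivity,
      fun s t hs ht => by simpa using hδ s t hs ht⟩
  | succ m ih =>
    intro f hf
    set F : ℝ × ℝ → ℝ := fun p => f p.1 p.2
    have hfderiv : ContDiffAt ℝ m (fun p => fderiv ℝ F p (1, 0)) (1, 1) :=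
      (hf.fderiv_right (m := m) (by norm_cast)).clm_apply contDiffAt_const
    obtain ⟨a, C, hC, ha⟩ := ih (fun s t => fderiv ℝ F (s, t) (1, 0)) hfderiv
    have hdiff : ∀ᶠ z in 𝓝 ((1 : ℝ), (1 : ℝ)), DifferentiableAt ℝ F z :=
      ((hf.of_le (m := 1) (by norm_cast; omega)).eventually (by simp)).mono fun z hz =>
        hz.differentiableAt (by simp)
    refine ⟨fun l t => if l = 0 then f 1 t else a (l - 1) t / l, C + (|f 1 1| + 1),
      by positivity, ?_⟩
    filter_upwards [ha, eventually_box hdiff, eventually_box_abs_le hf.continuousAt,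
      self_mem_nhdsWithin] with δ ha hdiff hbdd (hδ : 0 < δ)
    refine ha.of_deriv hδ.le (fun s t hs ht => ?_) (by positivity) fun t ht =>
      hbdd 1 t (by simpa using hδ.le) ht
    exact (hdiff s t hs ht).hasFDerivAt.comp_hasDerivAt s
      ((hasDerivAt_id s).prodMk (hasDerivAt_const s t))

lemma exists_taylorApprox_coeff {gc : ℕ → ℝ → ℝ → ℝ} {M : ℕ}
    (hsm : ∀ k ≤ M, ContDiffAt ℝ (M + 1 - k : ℕ) (fun p : ℝ × ℝ => gc k p.1 p.2) (1, 1)) :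
    ∃ (a : ℕ → ℕ → ℝ → ℝ) (C : ℝ), 0 ≤ C ∧ ∀ᶠ δ in 𝓝[>] (0 : ℝ), ∀ k ≤ M,
      TaylorApprox (gc k) (a k) (M + 1 - k) C δ := by
  have hex (k : ℕ) : ∃ (a : ℕ → ℝ → ℝ) (C : ℝ), 0 ≤ C ∧
      (k ≤ M → ∀ᶠ δ in 𝓝[>] (0 : ℝ), TaylorApprox (gc k) a (M + 1 - k) C δ) := by
    by_cases hk : k ≤ M
    · obtain ⟨a, C, hC, ha⟩ := exists_taylorApprox _ _ (hsm k hk)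
      exact ⟨a, C, hC, fun _ => ha⟩
    · exact ⟨fun _ _ => 0, 0, le_rfl, fun h => absurd h hk⟩
  choose a C hC ha using hex
  refine ⟨a, ∑ k ∈ Finset.range (M + 1), C k, Finset.sum_nonneg fun k _ => hC k, ?_⟩
  have hall := (Filter.eventually_all_finset (Finset.range (M + 1))).2 fun k hk =>
    ha k (Finset.mem_range_succ_iff.1 hk)
  filter_upwards [hall] with δ hδ k hk
  have hk' := Finset.mem_range_succ_iff.2 hk
  exact (hδ k hk').mono (Finset.single_le_sum (fun k _ => hC k) hk')

lemma abs_sum_sub_shellPoly_le {gc : ℕ → ℝ → ℝ → ℝ} {a : ℕ → ℕ → ℝ → ℝ} {M : ℕ} (hC : 0 ≤ C)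
    (h : ∀ k ≤ M, TaylorApprox (gc k) (a k) (M + 1 - k) C δ) {s t w : ℝ} (hs : |s - 1| ≤ δ)
    (ht : |t - 1| ≤ δ) (hw : |w| ≤ δ) :
    |∑ k ∈ Finset.range (M + 1), gc k s t * w ^ k -
      shellPoly (fun k l t => if k + l ≤ M then a k l t else 0) M s t w| ≤
        (M + 1) * C * δ ^ (M + 1) := by
  have hδ : 0 ≤ δ := (abs_nonneg w).trans hw
  rw [shellPoly_ite_add_le, ← Finset.sum_sub_distrib]
  refine (Finset.abs_sum_le_sum_abs _ _).trans ((Finset.sum_le_card_nsmul _ _ (C * δ ^ (M + 1))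
    fun k hk => ?_).trans_eq ?_)
  · have hk' : k ≤ M + 1 := (Finset.mem_range.1 hk).le
    rw [← sub_mul, abs_mul, abs_pow]
    calc _ ≤ C * |s - 1| ^ (M + 1 - k) * |w| ^ k := by
          gcongr
          exact (h k (Finset.mem_range_succ_iff.1 hk)).abs_sub_le s t hs ht
      _ ≤ C * δ ^ (M + 1 - k) * δ ^ k := by gcongr
      _ = C * δ ^ (M + 1) := by rw [mul_assoc, ← pow_add, Nat.sub_add_cancel hk']
  · rw [Finset.card_range, nsmul_eq_mul]
    push_cast
    ring

end Taylor

section PowerSeries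

variable {g : ℝ → ℝ → ℝ → ℝ} {gc : ℕ → ℝ → ℝ → ℝ} {M : ℕ} {T T' : Set ℝ} {C c δ : ℝ}

namespace ShellPowerSeries

lemma shellApprox {a : ℕ → ℕ → ℝ → ℝ} {C' : ℝ} (h : ShellPowerSeries g gc M T C c) (hC' : 0 ≤ C')
    (hδ : δ ≤ 1 / 2) (hT' : shell T' δ ⊆ T)
    (ha : ∀ k ≤ M, TaylorApprox (gc k) (a k) (M + 1 - k) C' δ) :
    ShellApprox g (fun k l t => if k + l ≤ M then a k l t else 0) M T'
      (C * 2 ^ (M + 1) + (M + 1) * C') δ := by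
  have hC := h.nonneg
  refine ⟨fun k hk l _ t ht => ?_, fun x x' hx hx' hw => ?_⟩
  · have hle : C' ≤ C * 2 ^ (M + 1) + (M + 1) * C' := by
      have : 0 ≤ C * 2 ^ (M + 1) + M * C' := by positivity
      linarith
    split_ifs
    · exact ((ha k hk).abs_coeff_le l t ht).trans hle
    · simpa using hC'.trans hle
  · refine (abs_sub_le _ _ _).trans ((add_le_add
      (h.abs_tail_le hδ (hT' hx) (hT' hx') hw (M + 1))
      (abs_sum_sub_shellPoly_le hC' ha hx.2 hx'.2 hw)).trans_eq ?_)
    rw [mul_pow]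
    ring

theorem barrierKernel (h : ShellPowerSeries g gc M T C c)
    (hpsd : ∀ d : ℕ, IsPSDKernelOn Set.univ (rotKernel g (d := d)))
    (hsm : ∀ k ≤ M, ContDiffAt ℝ (M + 1 - k : ℕ) (fun p : ℝ × ℝ => gc k p.1 p.2) (1, 1))
    (hT' : ∀ᶠ δ in 𝓝[>] (0 : ℝ), shell T' δ ⊆ T) : BarrierKernel g M (2 * M) T' := by
  obtain ⟨a, C', hC', ha⟩ := exists_taylorApprox_coeff hsm
  have hC := h.nonneg
  refine ⟨hpsd, ⟨fun k l t => if k + l ≤ M then a k l t else 0,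
    C * 2 ^ (M + 1) + (M + 1) * C', by positivity, fun k l t hne => ?_, ?_⟩, h.coercive hT'⟩
  · by_contra hcon
    exact hne (if_neg (by omega))
  · filter_upwards [ha, hT', Ioo_mem_nhdsGT (show (0 : ℝ) < 1 / 2 by norm_num)]
      with δ ha hT' hδ
    exact h.shellApprox hC' hδ.2.le hT' ha

end ShellPowerSeries

lemma norm_sq_sqrt_smul_single {s : ℝ} (hs : 0 ≤ s) :
    ‖(√s • EuclideanSpace.single 0 1 : E 1)‖ ^ 2 = s := by
  rw [norm_smul, PiLp.norm_single, norm_one, mul_one, Real.norm_eq_abs, sq_abs, Real.sq_sqrt hs]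

lemma hasSum_apply_diag {s : ℝ} (hs : 0 ≤ s) (hexp : ∀ x : E 1, ‖x‖ ^ 2 = s →
    HasSum (fun j : ℕ => gc j (‖x‖ ^ 2) (‖x‖ ^ 2) * (inner ℝ x x) ^ j) (rotKernel g x x)) :
    HasSum (fun j => gc j s s * s ^ j) (g s s s) := by
  have hsum := hexp _ (norm_sq_sqrt_smul_single hs)
  rw [rotKernel] at hsum
  simpa only [real_inner_self_eq_norm_sq, norm_sq_sqrt_smul_single hs] using hsum

theorem SpherePowerSeriesKernel.barrierKernel {a : ℕ → ℝ} (h : SpherePowerSeriesKernel g a M) :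
    BarrierKernel g M M {1} := by
  obtain ⟨J, hJ, hJpos⟩ := h.pos
  have hone {d : ℕ} {x : E d} (hx : ‖x‖ ^ 2 ∈ ({1} : Set ℝ)) : ‖x‖ = 1 :=
    (pow_eq_one_iff_of_nonneg (norm_nonneg x) two_ne_zero).1 hx
  have hseries : ShellPowerSeries g (fun j _ _ => a j) M {1} |g 1 1 1| (a J) :=
    { half_le := by rintro _ rfl; norm_num
      posSemidef := fun j => isPSDKernelOn_const (h.nonneg j)
      expansion := fun x x' hx hx' => h.expansion _ x x' (hone hx) (hone hx')
      nonneg := abs_nonneg _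
      diag_le := by rintro _ rfl; exact le_abs_self _
      pos := hJpos
      le_diag_tail := by
        rintro _ rfl
        have hsum := hasSum_apply_diag (gc := fun j _ _ => a j) zero_le_one
          fun x hx => h.expansion 1 x x (hone hx) (hone hx)
        simpa using apply_le_sub_sum_range hsum (fun j => by simpa using h.nonneg j) hJ }
  exact (hseries.barrierKernel h.posSemidef (fun _ _ => contDiffAt_const)
    (Eventually.of_forall fun _ _ hs => hs.1)).sphere rfl

lemma PowerSeriesKernel.continuousAt_diag (h : PowerSeriesKernel g gc M) :
    ContinuousAt (fun s => g s s s) 1 := by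
  have hcont : Continuous fun s : ℝ =>
      rotKernel g (√s • EuclideanSpace.single 0 1 : E 1) (√s • EuclideanSpace.single 0 1 : E 1) :=
    (h.continuous 1).comp (f := fun s : ℝ => ((√s • EuclideanSpace.single 0 1 : E 1),
      (√s • EuclideanSpace.single 0 1 : E 1))) (by fun_prop)
  refine hcont.continuousAt.congr ?_
  filter_upwards [Ioi_mem_nhds (show (0 : ℝ) < 1 by norm_num)] with s hs
  rw [rotKernel, real_inner_self_eq_norm_sq, norm_sq_sqrt_smul_single (le_of_lt hs)]

lemma PowerSeriesKernel.contDiffAt (h : PowerSeriesKernel g gc M) {k : ℕ} (hk : k ≤ M) :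
    ContDiffAt ℝ (M + 1 - k : ℕ) (fun p : ℝ × ℝ => gc k p.1 p.2) (1, 1) := by
  obtain ⟨U, hU, hU'⟩ := h.smooth k hk
  exact hU'.contDiffAt hU

lemma PowerSeriesKernel.continuousAt_diag_tail (h : PowerSeriesKernel g gc M) :
    ContinuousAt (fun s => g s s s - ∑ k ∈ Finset.range (M + 1), gc k s s * s ^ k) 1 := by
  refine h.continuousAt_diag.sub (tendsto_finsetSum _ fun k hk => ?_)
  have hcoeff : ContinuousAt (fun s : ℝ => gc k s s) 1 :=
    ContinuousAt.comp (f := fun s : ℝ => (s, s)) (g := fun p : ℝ × ℝ => gc k p.1 p.2)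
      (h.contDiffAt (Finset.mem_range_succ_iff.1 hk)).continuousAt (by fun_prop)
  exact hcoeff.mul (continuousAt_id.pow k)

lemma PowerSeriesKernel.exists_shellPowerSeries (h : PowerSeriesKernel g gc M) :
    ∃ ε > 0, ∃ C c, ShellPowerSeries g gc M (Metric.ball 1 ε) C c := by
  obtain ⟨δ, hδ, hgc, hexp⟩ := h.expansion
  obtain ⟨J, hJ, hJpos⟩ := h.pos
  have hone : (1 : ℝ) ∈ Set.Icc (1 - δ) (1 + δ) := by constructor <;> linarith
  have htail : gc J 1 1 ≤ g 1 1 1 - ∑ k ∈ Finset.range (M + 1), gc k 1 1 * 1 ^ k := by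
    have hsum := hasSum_apply_diag (g := g) (gc := gc) zero_le_one fun x hx =>
      hexp 1 x x (hx ▸ hone) (hx ▸ hone)
    simpa using apply_le_sub_sum_range hsum (fun j => mul_nonneg
      ((hgc j).apply_self_nonneg hone) (by positivity)) hJ
  have hev : ∀ᶠ s in 𝓝 (1 : ℝ), s ∈ Set.Icc (1 - δ) (1 + δ) ∧ 1 / 2 < s ∧
      g s s s < |g 1 1 1| + 1 ∧
      gc J 1 1 / 2 < g s s s - ∑ k ∈ Finset.range (M + 1), gc k s s * s ^ k :=
    Filter.Eventually.and (Icc_mem_nhds (by linarith) (by linarith)) <|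
      (lt_mem_nhds (by norm_num)).and <|
      (h.continuousAt_diag.eventually_lt_const (by linarith [le_abs_self (g 1 1 1)])).and
      (h.continuousAt_diag_tail.eventually_const_lt (by linarith))
  obtain ⟨ε, hε, hball⟩ := Metric.eventually_nhds_iff.1 hev
  exact ⟨ε, hε, |g 1 1 1| + 1, gc J 1 1 / 2,
    { half_le := fun s hs => (hball hs).2.1.le
      posSemidef := fun j => (hgc j).mono fun s hs => (hball hs).1
      expansion := fun x x' hx hx' => hexp _ x x' (hball hx).1 (hball hx').1
      nonneg := by positivity
      diag_le := fun s hs => (hball hs).2.2.1.le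
      pos := by positivity
      le_diag_tail := fun s hs => (hball hs).2.2.2.le }⟩

theorem PowerSeriesKernel.barrierKernel (h : PowerSeriesKernel g gc M) :
    BarrierKernel g M (2 * M) Set.univ := by
  obtain ⟨ε, hε, C, c, hseries⟩ := h.exists_shellPowerSeries
  refine hseries.barrierKernel h.posSemidef (fun k hk => h.contDiffAt hk) ?_
  filter_upwards [Ioo_mem_nhdsGT hε] with δ hδ s hs
  exact hs.2.trans_lt hδ.2

end PowerSeries

/-! ### Exponentials of positive semi-definite kernels -/

section ExpForm

variable {α : Type*} {A : Set α} {k : α → α → ℝ} {N : ℕ} {x : Fin N → α}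

lemma kernelForm_add (k l : α → α → ℝ) (x : Fin N → α) (v : Fin N → ℝ) :
    kernelForm (fun y z => k y z + l y z) x v = kernelForm k x v + kernelForm l x v := by
  simp only [kernelForm, mul_add, Finset.sum_add_distrib]

lemma kernelForm_const_mul (c : ℝ) (k : α → α → ℝ) (x : Fin N → α) (v : Fin N → ℝ) :
    kernelForm (fun y z => c * k y z) x v = c * kernelForm k x v := by
  simp only [kernelForm, Finset.mul_sum, mul_left_comm]

lemma kernelForm_mul_mul (f : α → ℝ) (k : α → α → ℝ) (x : Fin N → α) (v : Fin N → ℝ) :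
    kernelForm (fun y z => f y * f z * k y z) x v = kernelForm k x fun i => v i * f (x i) :=
  Finset.sum_congr rfl fun i _ => Finset.sum_congr rfl fun j _ => by ring

lemma hasSum_kernelForm_exp (k : α → α → ℝ) (x : Fin N → α) (v : Fin N → ℝ) :
    HasSum (fun m : ℕ => (m.factorial : ℝ)⁻¹ * kernelForm (fun y z => k y z ^ m) x v)
      (kernelForm (fun y z => Real.exp (k y z)) x v) := by
  simp only [← kernelForm_const_mul]
  refine hasSum_sum fun i _ => hasSum_sum fun j _ => HasSum.mul_left _ ?_
  simpa only [Real.exp_eq_exp_ℝ, div_eq_inv_mul] using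
    NormedSpace.expSeries_div_hasSum_exp (k (x i) (x j))

lemma IsPSDKernelOn.kernelForm_pow_le_exp_sub_one (hk : IsPSDKernelOn A k) (hx : ∀ i, x i ∈ A)
    (v : Fin N → ℝ) {n : ℕ} (hn : n ≠ 0) :
    (n.factorial : ℝ)⁻¹ * kernelForm (fun y z => k y z ^ n) x v ≤
      kernelForm (fun y z => Real.exp (k y z) - 1) x v := by
  have hle := sum_le_hasSum {0, n} (fun m _ => mul_nonneg (by positivity)
    ((hk.pow m).kernelForm_nonneg hx v)) (hasSum_kernelForm_exp k x v)
  rw [Finset.sum_pair hn.symm] at hle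
  simp only [pow_zero, Nat.factorial_zero, Nat.cast_one, inv_one, one_mul] at hle
  rw [kernelForm_sub]
  linarith

lemma IsPSDKernelOn.kernelForm_le_exp (hk : IsPSDKernelOn A k) (hx : ∀ i, x i ∈ A)
    (v : Fin N → ℝ) : kernelForm k x v ≤ kernelForm (fun y z => Real.exp (k y z)) x v := by
  have hle := hk.kernelForm_pow_le_exp_sub_one hx v one_ne_zero
  have hone := (isPSDKernelOn_const (A := A) zero_le_one).kernelForm_nonneg hx v
  simp only [pow_one, Nat.factorial_one, Nat.cast_one, inv_one, one_mul, kernelForm_sub] at hle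
  linarith

lemma integrable_kernelForm {Ω : Type*} [MeasurableSpace Ω] {μ : Measure Ω} {k : Ω → α → α → ℝ}
    (hk : ∀ i j, Integrable (fun u => k u (x i) (x j)) μ) (v : Fin N → ℝ) :
    Integrable (fun u => kernelForm (k u) x v) μ :=
  integrable_finsetSum _ fun i _ => integrable_finsetSum _ fun j _ => (hk i j).const_mul _

lemma integral_kernelForm {Ω : Type*} [MeasurableSpace Ω] {μ : Measure Ω} {k : Ω → α → α → ℝ}
    (hk : ∀ i j, Integrable (fun u => k u (x i) (x j)) μ) (v : Fin N → ℝ) :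
    ∫ u, kernelForm (k u) x v ∂μ = kernelForm (fun y z => ∫ u, k u y z ∂μ) x v := by
  simp only [kernelForm]
  rw [integral_finsetSum _ fun i _ => integrable_finsetSum _ fun j _ => (hk i j).const_mul _]
  refine Finset.sum_congr rfl fun i _ => ?_
  rw [integral_finsetSum _ fun j _ => (hk i j).const_mul _]
  exact Finset.sum_congr rfl fun j _ => integral_const_mul _ _

lemma sq_mul_sum_sq_le {b : ℝ} (hb : 0 ≤ b) {f : Fin N → ℝ} (hf : ∀ i, b ≤ f i) (v : Fin N → ℝ) :
    b ^ 2 * ∑ i, v i ^ 2 ≤ ∑ i, (v i * f i) ^ 2 := by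
  rw [Finset.mul_sum]
  refine Finset.sum_le_sum fun i _ => ?_
  rw [mul_pow, mul_comm]
  gcongr
  exact hf i

end ExpForm

/-! ### The energy kernel -/

section Stable

variable {γ : ℝ}

/-- The integrand in the representation of `y ^ γ`, for `0 < γ < 1`, as a multiple of
`∫ (1 - e^(-u y)) u^(-1-γ) du`. -/
def stableIntegrand (γ y u : ℝ) : ℝ := (1 - Real.exp (-(u * y))) * u ^ (-1 - γ)

/-- The normalizing constant `∫ (1 - e⁻ᵘ) u^(-1-γ) du` in the integral representation of
`y ^ γ`. -/
def stableConst (γ : ℝ) : ℝ := ∫ u in Set.Ioi (0 : ℝ), stableIntegrand γ 1 u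

lemma stableIntegrand_nonneg {y u : ℝ} (hy : 0 ≤ y) (hu : 0 ≤ u) : 0 ≤ stableIntegrand γ y u := by
  have : Real.exp (-(u * y)) ≤ 1 := Real.exp_le_one_iff.2 (by linarith [mul_nonneg hu hy])
  exact mul_nonneg (by linarith) (Real.rpow_nonneg hu _)

lemma stableIntegrand_le_rpow {y u : ℝ} (hu : 0 ≤ u) : stableIntegrand γ y u ≤ u ^ (-1 - γ) :=
  mul_le_of_le_one_left (Real.rpow_nonneg hu _) (by linarith [Real.exp_pos (-(u * y))])

lemma stableIntegrand_le_mul_rpow {y u : ℝ} (hu : 0 < u) :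
    stableIntegrand γ y u ≤ y * u ^ (-γ) := by
  have hsplit : u ^ (-γ) = u * u ^ (-1 - γ) := by
    rw [show -γ = 1 + (-1 - γ) by ring, Real.rpow_add hu, Real.rpow_one]
  rw [hsplit, ← mul_assoc]
  refine mul_le_mul_of_nonneg_right ?_ (Real.rpow_nonneg hu.le _)
  linarith [Real.add_one_le_exp (-(u * y))]

lemma integrableOn_stableIntegrand (h0 : 0 < γ) (h1 : γ < 1) {y : ℝ} (hy : 0 ≤ y) :
    IntegrableOn (stableIntegrand γ y) (Set.Ioi 0) := by
  have hmeas : Measurable (stableIntegrand γ y) := by unfold stableIntegrand; fun_prop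
  have hdom {s : Set ℝ} {f : ℝ → ℝ} (hs : MeasurableSet s) (hs0 : ∀ u ∈ s, 0 < u)
      (hf : IntegrableOn f s) (hle : ∀ u ∈ s, stableIntegrand γ y u ≤ f u) :
      IntegrableOn (stableIntegrand γ y) s := by
    refine Integrable.mono' hf hmeas.aestronglyMeasurable <| (ae_restrict_iff' hs).2 <|
      ae_of_all _ fun u hu => ?_
    rw [Real.norm_eq_abs, abs_of_nonneg (stableIntegrand_nonneg hy (hs0 u hu).le)]
    exact hle u hu
  rw [← Set.Ioc_union_Ioi_eq_Ioi (zero_le_one (α := ℝ))]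
  refine (hdom measurableSet_Ioc (fun u hu => hu.1) ?_ fun u hu =>
    stableIntegrand_le_mul_rpow hu.1).union
    (hdom measurableSet_Ioi (fun u hu => zero_lt_one.trans hu)
      (integrableOn_Ioi_rpow_of_lt (by linarith) zero_lt_one) fun u hu =>
        stableIntegrand_le_rpow (zero_lt_one.trans hu).le)
  exact (intervalIntegrable_iff_integrableOn_Ioc_of_le zero_le_one).1
    ((intervalIntegral.intervalIntegrable_rpow' (by linarith)).const_mul y)

lemma stableConst_pos (h0 : 0 < γ) (h1 : γ < 1) : 0 < stableConst γ := by
  have hpos : ∀ u ∈ Set.Ioi (0 : ℝ), 0 < stableIntegrand γ 1 u := fun u (hu : 0 < u) =>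
    mul_pos (by linarith [Real.exp_lt_one_iff.2 (show -(u * 1) < 0 by linarith)])
      (Real.rpow_pos_of_pos hu _)
  rw [stableConst, setIntegral_pos_iff_support_of_nonneg_ae
    ((ae_restrict_iff' measurableSet_Ioi).2 (ae_of_all _ fun u hu => (hpos u hu).le))
    (integrableOn_stableIntegrand h0 h1 zero_le_one)]
  have hsub : Set.Ioi (0 : ℝ) ⊆ Function.support (stableIntegrand γ 1) ∩ Set.Ioi 0 :=
    fun u hu => ⟨(hpos u hu).ne', hu⟩
  exact lt_of_lt_of_le (by simp) (measure_mono hsub)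

lemma integral_stableIntegrand (h0 : 0 < γ) {y : ℝ} (hy : 0 ≤ y) :
    ∫ u in Set.Ioi (0 : ℝ), stableIntegrand γ y u = stableConst γ * y ^ γ := by
  rcases hy.eq_or_lt with rfl | hy
  · simp [stableIntegrand, Real.zero_rpow h0.ne']
  · have hscale := integral_comp_mul_left_Ioi (stableIntegrand γ 1) 0 hy
    rw [mul_zero, smul_eq_mul, ← stableConst] at hscale
    have hcongr : ∀ u ∈ Set.Ioi (0 : ℝ),
        stableIntegrand γ y u = y ^ (1 + γ) * stableIntegrand γ 1 (y * u) := by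
      intro u hu
      rw [stableIntegrand, stableIntegrand, Real.mul_rpow hy.le (le_of_lt hu),
        show -1 - γ = -(1 + γ) by ring, Real.rpow_neg hy.le, mul_one, mul_comm y u]
      have : y ^ (1 + γ) ≠ 0 := (Real.rpow_pos_of_pos hy _).ne'
      field_simp
    rw [setIntegral_congr_fun measurableSet_Ioi hcongr, integral_const_mul, hscale,
      Real.rpow_add hy, Real.rpow_one]
    field_simp

end Stable

section Energy

variable {V : Type*} [NormedAddCommGroup V] {γ u : ℝ} {N : ℕ}

/-- The positive semi-definite kernel `‖x‖^{2γ} + ‖x'‖^{2γ} - ‖x - x'‖^{2γ}`, whose exponential is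
a rescaling of `exp(-‖x - x'‖^{2γ})`. -/
def energyKernel (γ : ℝ) (x x' : V) : ℝ :=
  (‖x‖ ^ 2) ^ γ + (‖x'‖ ^ 2) ^ γ - (‖x - x'‖ ^ 2) ^ γ

/-- The Gaussian analogue of `energyKernel`, with `1 - exp(-u ‖x‖²)` in place of `‖x‖^{2γ}`. -/
def gaussianEnergyKernel (u : ℝ) (x x' : V) : ℝ :=
  (1 - Real.exp (-(u * ‖x‖ ^ 2))) + (1 - Real.exp (-(u * ‖x'‖ ^ 2))) -
    (1 - Real.exp (-(u * ‖x - x'‖ ^ 2)))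

lemma gaussianEnergyKernel_mul_rpow (x x' : V) (u : ℝ) :
    u ^ (-1 - γ) * gaussianEnergyKernel u x x' =
      stableIntegrand γ (‖x‖ ^ 2) u + stableIntegrand γ (‖x'‖ ^ 2) u -
        stableIntegrand γ (‖x - x'‖ ^ 2) u := by
  simp only [gaussianEnergyKernel, stableIntegrand]
  ring

lemma integrableOn_gaussianEnergyKernel (h0 : 0 < γ) (h1 : γ < 1) (x x' : V) :
    IntegrableOn (fun u => u ^ (-1 - γ) * gaussianEnergyKernel u x x') (Set.Ioi 0) := by
  simp only [gaussianEnergyKernel_mul_rpow]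
  exact ((integrableOn_stableIntegrand h0 h1 (by positivity)).add
    (integrableOn_stableIntegrand h0 h1 (by positivity))).sub
    (integrableOn_stableIntegrand h0 h1 (by positivity))

lemma integral_gaussianEnergyKernel (h0 : 0 < γ) (h1 : γ < 1) (x x' : V) :
    ∫ u in Set.Ioi (0 : ℝ), u ^ (-1 - γ) * gaussianEnergyKernel u x x' =
      stableConst γ * energyKernel γ x x' := by
  have hint (y : V) := integrableOn_stableIntegrand h0 h1 (sq_nonneg ‖y‖)
  have hadd : IntegrableOn (fun u => stableIntegrand γ (‖x‖ ^ 2) u +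
      stableIntegrand γ (‖x'‖ ^ 2) u) (Set.Ioi 0) := (hint x).add (hint x')
  simp only [gaussianEnergyKernel_mul_rpow]
  rw [integral_sub hadd (hint (x - x')), integral_add (hint x) (hint x')]
  simp only [integral_stableIntegrand h0 (sq_nonneg _), energyKernel]
  ring

lemma integrableOn_kernelForm_gaussianEnergyKernel (h0 : 0 < γ) (h1 : γ < 1) (x : Fin N → V)
    (v : Fin N → ℝ) :
    IntegrableOn (fun u => u ^ (-1 - γ) * kernelForm (gaussianEnergyKernel u) x v)
      (Set.Ioi 0) := by
  simp only [← kernelForm_const_mul]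
  exact integrable_kernelForm (μ := volume.restrict (Set.Ioi 0))
    (k := fun u y z => u ^ (-1 - γ) * gaussianEnergyKernel u y z)
    (fun i j => integrableOn_gaussianEnergyKernel h0 h1 _ _) v

lemma kernelForm_energyKernel_eq (h0 : 0 < γ) (h1 : γ < 1) (x : Fin N → V) (v : Fin N → ℝ) :
    stableConst γ * kernelForm (energyKernel γ) x v =
      ∫ u in Set.Ioi (0 : ℝ), u ^ (-1 - γ) * kernelForm (gaussianEnergyKernel u) x v := by
  simp only [← kernelForm_const_mul, ← integral_gaussianEnergyKernel h0 h1]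
  exact (integral_kernelForm (k := fun u y z => u ^ (-1 - γ) * gaussianEnergyKernel u y z)
    (fun i j => integrableOn_gaussianEnergyKernel h0 h1 _ _) v).symm

lemma kernelForm_exp_neg_eq (x : Fin N → V) (v : Fin N → ℝ) :
    kernelForm (fun y z => Real.exp (-(‖y - z‖ ^ 2) ^ γ)) x v =
      kernelForm (fun y z => Real.exp (energyKernel γ y z)) x
        fun i => v i * Real.exp (-(‖x i‖ ^ 2) ^ γ) := by
  rw [← kernelForm_mul_mul fun y : V => Real.exp (-(‖y‖ ^ 2) ^ γ)]
  simp only [← Real.exp_add, energyKernel]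
  ring_nf

variable [InnerProductSpace ℝ V]

lemma gaussianEnergyKernel_eq (u : ℝ) (x x' : V) : gaussianEnergyKernel u x x' =
    (1 - Real.exp (-(u * ‖x‖ ^ 2))) * (1 - Real.exp (-(u * ‖x'‖ ^ 2))) * 1 +
    Real.exp (-(u * ‖x‖ ^ 2)) * Real.exp (-(u * ‖x'‖ ^ 2)) *
      (Real.exp (2 * u * inner ℝ x x') - 1) := by
  have hsub : Real.exp (-(u * ‖x - x'‖ ^ 2)) = Real.exp (-(u * ‖x‖ ^ 2)) *
      Real.exp (-(u * ‖x'‖ ^ 2)) * Real.exp (2 * u * inner ℝ x x') := by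
    rw [← Real.exp_add, ← Real.exp_add, norm_sub_sq_real]
    ring_nf
  rw [gaussianEnergyKernel, hsub]
  ring

lemma le_kernelForm_gaussianEnergyKernel (hu : 0 ≤ u) (x : Fin N → V) (v : Fin N → ℝ) {n : ℕ}
    (hn : n ≠ 0) :
    (2 * u) ^ n / n.factorial *
        kernelForm (fun y z => inner ℝ y z ^ n) x (fun i => v i * Real.exp (-(u * ‖x i‖ ^ 2))) ≤
      kernelForm (gaussianEnergyKernel u) x v := by
  have hpsd : IsPSDKernelOn (Set.univ : Set V) fun y z => 2 * u * inner ℝ y z :=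
    (isPSDKernelOn_const (by positivity)).mul (isPSDKernelOn_inner _)
  have hpow := hpsd.kernelForm_pow_le_exp_sub_one (x := x) (fun _ => Set.mem_univ _)
    (fun i => v i * Real.exp (-(u * ‖x i‖ ^ 2))) hn
  have hone := (isPSDKernelOn_const zero_le_one).kernelForm_nonneg (x := x)
    (fun _ => Set.mem_univ _) fun i => v i * (1 - Real.exp (-(u * ‖x i‖ ^ 2)))
  simp only [mul_pow (2 * u), kernelForm_const_mul, ← mul_assoc] at hpow
  simp only [funext₂ (gaussianEnergyKernel_eq (V := V) u), kernelForm_add,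
    kernelForm_mul_mul (fun y : V => 1 - Real.exp (-(u * ‖y‖ ^ 2))),
    kernelForm_mul_mul fun y : V => Real.exp (-(u * ‖y‖ ^ 2))]
  rw [div_eq_inv_mul]
  linarith

lemma kernelForm_gaussianEnergyKernel_nonneg (hu : 0 ≤ u) (x : Fin N → V) (v : Fin N → ℝ) :
    0 ≤ kernelForm (gaussianEnergyKernel u) x v :=
  (mul_nonneg (by positivity) (((isPSDKernelOn_inner Set.univ).pow 1).kernelForm_nonneg
    (fun _ => Set.mem_univ _) _)).trans (le_kernelForm_gaussianEnergyKernel hu x v one_ne_zero)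

lemma isPSDKernelOn_energyKernel (h0 : 0 < γ) (h1 : γ < 1) :
    IsPSDKernelOn (Set.univ : Set V) (energyKernel γ) := by
  refine isPSDKernelOn_of_kernelForm_nonneg (fun x _ y _ => ?_) fun N x _ v => ?_
  · rw [energyKernel, energyKernel, norm_sub_rev, add_comm]
  · refine nonneg_of_mul_nonneg_right ?_ (stableConst_pos h0 h1)
    rw [kernelForm_energyKernel_eq h0 h1]
    exact setIntegral_nonneg measurableSet_Ioi fun u (hu : 0 < u) =>
      mul_nonneg (Real.rpow_nonneg hu.le _) (kernelForm_gaussianEnergyKernel_nonneg hu.le x v)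

/-- Restricting the integral representation to `u ∈ (1, 2]`. -/
lemma le_kernelForm_energyKernel (h0 : 0 < γ) (h1 : γ < 1) (x : Fin N → V) (v : Fin N → ℝ) {b : ℝ}
    (hb : ∀ u ∈ Set.Ioc (1 : ℝ) 2, b ≤ kernelForm (gaussianEnergyKernel u) x v) :
    b / 4 ≤ stableConst γ * kernelForm (energyKernel γ) x v := by
  have hint := integrableOn_kernelForm_gaussianEnergyKernel h0 h1 x v
  have hnonneg {u : ℝ} (hu : 0 < u) := kernelForm_gaussianEnergyKernel_nonneg hu.le x v
  have hsub : Set.Ioc (1 : ℝ) 2 ⊆ Set.Ioi 0 := fun u hu => zero_lt_one.trans hu.1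
  have hlow : ∀ u ∈ Set.Ioc (1 : ℝ) 2,
      b / 4 ≤ u ^ (-1 - γ) * kernelForm (gaussianEnergyKernel u) x v := by
    intro u hu
    have hrpow : (1 / 4 : ℝ) ≤ u ^ (-1 - γ) :=
      calc (1 / 4 : ℝ) = 2 ^ (-2 : ℝ) := by norm_num [Real.rpow_neg]
        _ ≤ u ^ (-2 : ℝ) := Real.rpow_le_rpow_of_nonpos (hsub hu) hu.2 (by norm_num)
        _ ≤ u ^ (-1 - γ) := Real.rpow_le_rpow_of_exponent_le hu.1.le (by linarith)
    calc b / 4 ≤ 1 / 4 * kernelForm (gaussianEnergyKernel u) x v := by linarith [hb u hu]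
      _ ≤ _ := mul_le_mul_of_nonneg_right hrpow (hnonneg (hsub hu))
  rw [kernelForm_energyKernel_eq h0 h1]
  calc b / 4 = ∫ _ in Set.Ioc (1 : ℝ) 2, b / 4 := by rw [setIntegral_const]; norm_num
    _ ≤ ∫ u in Set.Ioc (1 : ℝ) 2, u ^ (-1 - γ) * kernelForm (gaussianEnergyKernel u) x v :=
      setIntegral_mono_on (integrableOn_const (by simp) enorm_ne_top) (hint.mono_set hsub)
        measurableSet_Ioc hlow
    _ ≤ _ := setIntegral_mono_set hint ((ae_restrict_iff' measurableSet_Ioi).2 <|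
        ae_of_all _ fun u (hu : 0 < u) => mul_nonneg (Real.rpow_nonneg hu.le _) (hnonneg hu))
        (Eventually.of_forall hsub)

lemma kernelForm_energyKernel_le (h0 : 0 < γ) (h1 : γ < 1) (x : Fin N → V) (v : Fin N → ℝ) :
    kernelForm (energyKernel γ) x (fun i => v i * Real.exp (-(‖x i‖ ^ 2) ^ γ)) ≤
      kernelForm (fun y z => Real.exp (-(‖y - z‖ ^ 2) ^ γ)) x v := by
  rw [kernelForm_exp_neg_eq]
  exact (isPSDKernelOn_energyKernel h0 h1).kernelForm_le_exp (fun _ => Set.mem_univ _) _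

end Energy

/-! ### The `α`-exponential kernel -/

section AlphaExponential

variable {g : ℝ → ℝ → ℝ → ℝ} {α γ δ u : ℝ} {d N : ℕ} {x : Fin N → E d}

lemma le_kernelForm_inner_pow (hδ0 : 0 ≤ δ) (hδ : δ ≤ 1 / 2) (hx : NearOrthonormal Set.univ δ x)
    {n : ℕ} (hN : N * δ ^ n ≤ (1 / 2) ^ (n + 1)) (v : Fin N → ℝ) :
    (1 / 2) ^ (n + 1) * ∑ i, v i ^ 2 ≤ kernelForm (fun y z => inner ℝ y z ^ n) x v := by
  refine le_trans (mul_le_mul_of_nonneg_right ?_ (by positivity)) (le_kernelForm_of_diag_offDiag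
    (D := (1 / 2) ^ n) (pow_nonneg hδ0 n) (fun i => ?_) (fun i j hij => ?_) v)
  · rw [pow_succ] at hN ⊢
    linarith
  · have := abs_le.1 (hx.norm_sq_mem i).2
    rw [real_inner_self_eq_norm_sq]
    exact pow_le_pow_left₀ (by norm_num) (by linarith) n
  · rw [abs_pow]
    exact pow_le_pow_left₀ (abs_nonneg _) (hx.abs_inner_le i j hij) n

lemma NearOrthonormal.norm_sq_le_two {T : Set ℝ} (hδ : δ ≤ 1 / 2) (hx : NearOrthonormal T δ x)
    (i : Fin N) : ‖x i‖ ^ 2 ≤ 2 := by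
  have := abs_le.1 (hx.norm_sq_mem i).2
  linarith

lemma le_kernelForm_gaussianEnergyKernel_of_nearOrthonormal (hu : u ∈ Set.Ioc (1 : ℝ) 2)
    (hδ0 : 0 ≤ δ) (hδ : δ ≤ 1 / 2) (hx : NearOrthonormal Set.univ δ x) {n : ℕ} (hn : n ≠ 0)
    (hN : N * δ ^ n ≤ (1 / 2) ^ (n + 1)) (v : Fin N → ℝ) :
    Real.exp (-4) ^ 2 * (1 / 2) ^ (n + 1) / n.factorial * ∑ i, v i ^ 2 ≤
      kernelForm (gaussianEnergyKernel u) x v := by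
  have hu0 : 0 ≤ u := by linarith [hu.1]
  set w : Fin N → ℝ := fun i => v i * Real.exp (-(u * ‖x i‖ ^ 2))
  have hweight : Real.exp (-4) ^ 2 * ∑ i, v i ^ 2 ≤ ∑ i, w i ^ 2 :=
    sq_mul_sum_sq_le (Real.exp_pos _).le (fun i => Real.exp_le_exp.2 <| neg_le_neg <| by
      nlinarith [mul_le_mul hu.2 (hx.norm_sq_le_two hδ i) (sq_nonneg _) zero_le_two]) v
  have hone : 1 ≤ (2 * u) ^ n := one_le_pow₀ (by linarith [hu.1])
  calc Real.exp (-4) ^ 2 * (1 / 2) ^ (n + 1) / n.factorial * ∑ i, v i ^ 2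
      = 1 / n.factorial * ((1 / 2) ^ (n + 1) * (Real.exp (-4) ^ 2 * ∑ i, v i ^ 2)) := by ring
    _ ≤ (2 * u) ^ n / n.factorial * ((1 / 2) ^ (n + 1) * ∑ i, w i ^ 2) := by gcongr
    _ ≤ (2 * u) ^ n / n.factorial * kernelForm (fun y z => inner ℝ y z ^ n) x w :=
      mul_le_mul_of_nonneg_left (le_kernelForm_inner_pow hδ0 hδ hx hN w) (by positivity)
    _ ≤ kernelForm (gaussianEnergyKernel u) x v := le_kernelForm_gaussianEnergyKernel hu0 x v hn

lemma le_kernelForm_exp_neg (h0 : 0 < γ) (h1 : γ < 1) (hδ0 : 0 ≤ δ) (hδ : δ ≤ 1 / 2)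
    (hx : NearOrthonormal Set.univ δ x) {n : ℕ} (hn : n ≠ 0)
    (hN : N * δ ^ n ≤ (1 / 2) ^ (n + 1)) (v : Fin N → ℝ) :
    Real.exp (-2) ^ 2 * (Real.exp (-4) ^ 2 * (1 / 2) ^ (n + 1) / n.factorial) / 4 / stableConst γ *
      ∑ i, v i ^ 2 ≤ kernelForm (fun y z => Real.exp (-(‖y - z‖ ^ 2) ^ γ)) x v := by
  set B : ℝ := Real.exp (-4) ^ 2 * (1 / 2) ^ (n + 1) / n.factorial
  set w : Fin N → ℝ := fun i => v i * Real.exp (-(‖x i‖ ^ 2) ^ γ)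
  have hstable := stableConst_pos h0 h1
  have : 0 ≤ B := by positivity
  have hweight : Real.exp (-2) ^ 2 * ∑ i, v i ^ 2 ≤ ∑ i, w i ^ 2 := by
    refine sq_mul_sum_sq_le (Real.exp_pos _).le (fun i => Real.exp_le_exp.2 <| neg_le_neg ?_) v
    calc (‖x i‖ ^ 2) ^ γ ≤ 2 ^ γ :=
          Real.rpow_le_rpow (sq_nonneg _) (hx.norm_sq_le_two hδ i) h0.le
      _ ≤ 2 ^ (1 : ℝ) := Real.rpow_le_rpow_of_exponent_le one_le_two h1.le
      _ = 2 := Real.rpow_one 2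
  have henergy := le_kernelForm_energyKernel h0 h1 x w fun u hu =>
    le_kernelForm_gaussianEnergyKernel_of_nearOrthonormal hu hδ0 hδ hx hn hN w
  refine le_trans ?_ (kernelForm_energyKernel_le h0 h1 x v)
  rw [div_mul_eq_mul_div, div_le_iff₀' hstable]
  calc Real.exp (-2) ^ 2 * B / 4 * ∑ i, v i ^ 2
      = B * (Real.exp (-2) ^ 2 * ∑ i, v i ^ 2) / 4 := by ring
    _ ≤ B * (∑ i, w i ^ 2) / 4 := by gcongr
    _ ≤ stableConst γ * kernelForm (energyKernel γ) x w := henergy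

lemma IsAlphaExponential.rotKernel_eq (h : IsAlphaExponential g α) (y z : E d) :
    rotKernel g y z = Real.exp (-(‖y - z‖ ^ 2) ^ (α / 2)) := by
  rw [h, ← Real.rpow_natCast_mul (norm_nonneg _), Nat.cast_two, mul_div_cancel₀ α two_ne_zero]

lemma shellPoly_choose (b : ℕ → ℝ → ℝ) (M : ℕ) (s t w : ℝ) :
    shellPoly (fun k l t => if k + l ≤ M then b (k + l) t * (k + l).choose k * (-2) ^ k else 0)
      M s t w = ∑ l ∈ Finset.range (M + 1), b l t * (s - 2 * w - 1) ^ l := by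
  rw [shellPoly_ite_add_le]
  simp only [Finset.sum_mul]
  rw [← Finset.sum_range_diag_flip (M + 1) fun k l =>
    b (k + l) t * (k + l).choose k * (-2) ^ k * (s - 1) ^ l * w ^ k]
  refine Finset.sum_congr rfl fun n _ => ?_
  rw [show s - 2 * w - 1 = -2 * w + (s - 1) by ring, add_pow, Finset.mul_sum]
  refine Finset.sum_congr rfl fun k hk => ?_
  rw [Nat.add_sub_cancel' (Finset.mem_range_succ_iff.1 hk), mul_pow]
  ring

lemma abs_mul_choose_mul_le {a C : ℝ} (ha : |a| ≤ C) {k l M : ℕ} (h : k + l ≤ M) :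
    |a * (k + l).choose k * (-2) ^ k| ≤ C * 4 ^ (M + 1) := by
  have hC : 0 ≤ C := (abs_nonneg a).trans ha
  have hchoose : ((k + l).choose k : ℝ) ≤ 2 ^ (k + l) := mod_cast Nat.choose_le_two_pow _ _
  rw [abs_mul, abs_mul, abs_pow, abs_neg, abs_two, Nat.abs_cast]
  calc |a| * (k + l).choose k * 2 ^ k ≤ C * 2 ^ (M + 1) * 2 ^ (M + 1) := by
        gcongr
        · exact hchoose.trans (pow_le_pow_right₀ one_le_two (by omega))
        · exact one_le_two
        · omega
    _ = C * 4 ^ (M + 1) := by rw [mul_assoc, ← mul_pow]; norm_num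

/-- Since `‖x - x'‖² = s + t - 2w`, a Taylor expansion in the variable `s - 2w` suffices. -/
lemma IsAlphaExponential.shellApprox (h : IsAlphaExponential g α) {b : ℕ → ℝ → ℝ} {M : ℕ} {C : ℝ}
    (hC : 0 ≤ C) (hδ : 0 ≤ δ)
    (hb : TaylorApprox (fun y t => Real.exp (-(y + t) ^ (α / 2))) b (M + 1) C (3 * δ)) :
    ShellApprox g
      (fun k l t => if k + l ≤ M then b (k + l) t * (k + l).choose k * (-2) ^ k else 0)
      M Set.univ (C * 4 ^ (M + 1)) δ := by
  refine ⟨fun k _ l _ t ht => ?_, fun x x' hx hx' hw => ?_⟩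
  · split_ifs with hkl
    · exact abs_mul_choose_mul_le (hb.abs_coeff_le _ _ (ht.trans (by linarith))) hkl
    · rw [abs_zero]
      positivity
  · set s := ‖x‖ ^ 2
    set t := ‖x'‖ ^ 2
    set w : ℝ := inner ℝ x x'
    have hbox : |s - 2 * w - 1| ≤ 3 * δ := by
      have hs := abs_le.1 hx.2
      have hw := abs_le.1 hw
      exact abs_le.2 ⟨by linarith, by linarith⟩
    have hker : rotKernel g x x' = Real.exp (-(s - 2 * w + t) ^ (α / 2)) := by
      rw [h.rotKernel_eq, norm_sub_sq_real]
    rw [hker, shellPoly_choose]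
    calc _ ≤ C * |s - 2 * w - 1| ^ (M + 1) := hb.abs_sub_le _ _ hbox (hx'.2.trans (by linarith))
      _ ≤ C * (4 * δ) ^ (M + 1) := by gcongr; linarith
      _ = C * 4 ^ (M + 1) * δ ^ (M + 1) := by rw [mul_pow, mul_assoc]

lemma tendsto_const_mul_nhdsGT_zero {c : ℝ} (hc : 0 < c) :
    Tendsto (fun δ => c * δ) (𝓝[>] (0 : ℝ)) (𝓝[>] 0) := by
  refine tendsto_nhdsWithin_iff.2 ⟨?_, ?_⟩
  · exact ((continuous_const_mul c).tendsto' 0 0 (mul_zero c)).mono_left nhdsWithin_le_nhds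
  · filter_upwards [self_mem_nhdsWithin] with δ hδ using mul_pos hc hδ

lemma IsAlphaExponential.exists_shellApprox (h : IsAlphaExponential g α) (M : ℕ) :
    ∃ (a : ℕ → ℕ → ℝ → ℝ) (C : ℝ), 0 ≤ C ∧ (∀ k l t, a k l t ≠ 0 → k + 2 * l ≤ 2 * M) ∧
      ∀ᶠ δ in 𝓝[>] (0 : ℝ), ShellApprox g a M Set.univ C δ := by
  have hsm : ContDiffAt ℝ (M + 1 : ℕ) (fun p : ℝ × ℝ => Real.exp (-(p.1 + p.2) ^ (α / 2)))
      (1, 1) := by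
    refine ContDiffAt.exp (ContDiffAt.neg ?_)
    exact (contDiffAt_fst.add contDiffAt_snd).rpow_const_of_ne (by norm_num)
  obtain ⟨b, C, hC, hb⟩ := exists_taylorApprox (M + 1)
    (fun y t => Real.exp (-(y + t) ^ (α / 2))) hsm
  refine ⟨fun k l t => if k + l ≤ M then b (k + l) t * (k + l).choose k * (-2) ^ k else 0,
    C * 4 ^ (M + 1), by positivity, fun k l t hne => ?_, ?_⟩
  · by_contra hcon
    exact hne (if_neg (by omega))
  · filter_upwards [(tendsto_const_mul_nhdsGT_zero three_pos).eventually hb, self_mem_nhdsWithin]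
      with δ hb (hδ : 0 < δ)
    exact h.shellApprox hC hδ.le hb

lemma isPSDKernelOn_exp_neg (h0 : 0 < γ) (h1 : γ < 1) :
    IsPSDKernelOn (Set.univ : Set (E d)) fun y z => Real.exp (-(‖y - z‖ ^ 2) ^ γ) := by
  refine isPSDKernelOn_of_kernelForm_nonneg (fun y _ z _ => ?_) fun N x _ v => ?_
  · rw [norm_sub_rev]
  · exact ((isPSDKernelOn_energyKernel h0 h1).kernelForm_nonneg (fun _ => Set.mem_univ _) _).trans
      (kernelForm_energyKernel_le h0 h1 x v)

theorem IsAlphaExponential.barrierKernel (h : IsAlphaExponential g α) (hα0 : 0 < α) (hα2 : α < 2)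
    (M : ℕ) : BarrierKernel g M (2 * M) Set.univ := by
  have h0 : 0 < α / 2 := by linarith
  have h1 : α / 2 < 1 := by linarith
  have hker {d : ℕ} : rotKernel g (d := d) = fun y z => Real.exp (-(‖y - z‖ ^ 2) ^ (α / 2)) :=
    funext₂ h.rotKernel_eq
  have hstable := stableConst_pos h0 h1
  refine ⟨fun d => hker ▸ isPSDKernelOn_exp_neg h0 h1, h.exists_shellApprox M,
    Real.exp (-2) ^ 2 * (Real.exp (-4) ^ 2 * (1 / 2) ^ (M + 1 + 1) / (M + 1).factorial) / 4 /
      stableConst (α / 2), (1 / 2) ^ (M + 1 + 1), by positivity, by positivity, ?_⟩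
  filter_upwards [Ioo_mem_nhdsGT (show (0 : ℝ) < 1 / 2 by norm_num)] with δ hδ d N x hN hx v
  rw [hker]
  exact le_kernelForm_exp_neg h0 h1 hδ.1.le hδ.2.le hx M.succ_ne_zero hN v

end AlphaExponential

theorem DataModel.AdmissibleKernel.barrierKernel {model : DataModel} {β : ℝ}
    {g : ℝ → ℝ → ℝ → ℝ} (h : model.AdmissibleKernel β g) :
    BarrierKernel g ⌊2 / β⌋₊ (model.degree β) model.shells := by
  cases model with
  | covariance =>
    rcases h with ⟨gc, h⟩ | ⟨α, h0, h2, h⟩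
    · exact h.barrierKernel
    · exact h.barrierKernel h0 h2 _
  | sphere =>
    rcases h with ⟨a, h⟩ | ⟨α, h0, h2, h⟩
    · exact h.barrierKernel
    · exact (h.barrierKernel h0 h2 _).sphere (Set.mem_univ _)

/-! ### The barrier polynomial -/

section BarrierPolynomial

variable {g : ℝ → ℝ → ℝ → ℝ} {a : ℕ → ℕ → ℝ → ℝ} {M m d n : ℕ} {T : Set ℝ} {C δ r : ℝ}

lemma norm_sq_inv_sqrt_smul (hr : 0 < r) (z : E d) : ‖(√r)⁻¹ • z‖ ^ 2 = ‖z‖ ^ 2 / r := by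
  rw [norm_smul, mul_pow, norm_inv, inv_pow, Real.norm_of_nonneg (Real.sqrt_nonneg r),
    Real.sq_sqrt hr.le, inv_mul_eq_div]

lemma inner_inv_sqrt_smul (hr : 0 < r) (z z' : E d) :
    inner ℝ ((√r)⁻¹ • z) ((√r)⁻¹ • z') = inner ℝ z z' / r := by
  rw [real_inner_smul_left, real_inner_smul_right, ← mul_assoc, ← mul_inv,
    Real.mul_self_sqrt hr.le, inv_mul_eq_div]

lemma scaledKernel_eq_rotKernel (g : ℝ → ℝ → ℝ → ℝ) (hr : 0 < r) (x x' : E d) :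
    scaledKernel g r x x' = rotKernel g ((√r)⁻¹ • x) ((√r)⁻¹ • x') := by
  rw [rotKernel, norm_sq_inv_sqrt_smul hr, norm_sq_inv_sqrt_smul hr, inner_inv_sqrt_smul hr,
    scaledKernel]

lemma kernelForm_scaledKernel (g : ℝ → ℝ → ℝ → ℝ) (hr : 0 < r) (xs : Fin n → E d)
    (v : Fin n → ℝ) : kernelForm (scaledKernel g r) xs v =
      kernelForm (rotKernel g) (fun i => (√r)⁻¹ • xs i) v := by
  simp only [kernelForm, scaledKernel_eq_rotKernel g hr]

lemma isPSDKernelOn_scaledKernel (hg : IsPSDKernelOn Set.univ (rotKernel g (d := d)))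
    (hr : 0 < r) : IsPSDKernelOn Set.univ (scaledKernel g r (d := d)) := by
  simpa only [← scaledKernel_eq_rotKernel g hr, Set.preimage_univ] using
    hg.comp fun x : E d => (√r)⁻¹ • x

lemma nearOrthonormal_inv_sqrt_smul_iff (hr : 0 < r) {xs : Fin n → E d} :
    NearOrthonormal T δ (fun i => (√r)⁻¹ • xs i) ↔ (∀ i, ‖xs i‖ ^ 2 / r ∈ shell T δ) ∧
      ∀ i j, i ≠ j → |inner ℝ (xs i) (xs j) / r| ≤ δ := by
  simp only [← norm_sq_inv_sqrt_smul hr, ← inner_inv_sqrt_smul hr]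
  exact ⟨fun h => ⟨h.norm_sq_mem, h.abs_inner_le⟩, fun h => ⟨h.1, h.2⟩⟩

/-- `shellPoly` at `‖x‖² / r` and `xᵀy / r`, as a polynomial in the coordinates of `x`. -/
def shellMvPolynomial (a : ℕ → ℕ → ℝ → ℝ) (M : ℕ) (r : ℝ) (y : E d) : MvPolynomial (Fin d) ℝ :=
  ∑ k ∈ Finset.range (M + 1), ∑ l ∈ Finset.range (M + 1),
    MvPolynomial.C (a k l (‖y‖ ^ 2 / r)) *
      (MvPolynomial.C r⁻¹ * ∑ i, MvPolynomial.X i ^ 2 - MvPolynomial.C 1) ^ l *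
      (∑ i, MvPolynomial.C (y i / r) * MvPolynomial.X i) ^ k

lemma eval_shellMvPolynomial (x y : E d) :
    MvPolynomial.eval (fun i => x i) (shellMvPolynomial a M r y) =
      shellPoly a M (‖x‖ ^ 2 / r) (‖y‖ ^ 2 / r) (inner ℝ x y / r) := by
  have hinner : ∑ i, y i / r * x i = inner ℝ x y / r := by
    rw [PiLp.inner_apply, Finset.sum_div]
    refine Finset.sum_congr rfl fun i _ => ?_
    rw [Real.inner_apply]
    ring
  simp only [shellMvPolynomial, map_mul, map_pow, map_sub, map_sum, MvPolynomial.eval_C,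
    MvPolynomial.eval_X, hinner, ← EuclideanSpace.real_norm_sq_eq, inv_mul_eq_div, shellPoly]

lemma totalDegree_shellMvPolynomial_le (hdeg : ∀ k l t, a k l t ≠ 0 → k + 2 * l ≤ m) (y : E d) :
    (shellMvPolynomial a M r y).totalDegree ≤ m := by
  have hquad : (MvPolynomial.C r⁻¹ * ∑ i : Fin d, MvPolynomial.X i ^ 2 -
      MvPolynomial.C 1 : MvPolynomial (Fin d) ℝ).totalDegree ≤ 2 := by
    refine (MvPolynomial.totalDegree_sub _ _).trans (max_le ?_ (by simp))
    refine (MvPolynomial.totalDegree_mul _ _).trans ?_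
    rw [MvPolynomial.totalDegree_C, zero_add]
    exact MvPolynomial.totalDegree_finsetSum_le fun i _ => by simp
  have hlin : (∑ i, MvPolynomial.C (y i / r) * MvPolynomial.X i :
      MvPolynomial (Fin d) ℝ).totalDegree ≤ 1 :=
    MvPolynomial.totalDegree_finsetSum_le fun i _ =>
      (MvPolynomial.totalDegree_mul _ _).trans (by simp)
  refine MvPolynomial.totalDegree_finsetSum_le fun k _ =>
    MvPolynomial.totalDegree_finsetSum_le fun l _ => ?_
  rcases eq_or_ne (a k l (‖y‖ ^ 2 / r)) 0 with h | h
  · simp [h]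
  · have hsq := (MvPolynomial.totalDegree_pow _ l).trans (Nat.mul_le_mul_left l hquad)
    have hpow := (MvPolynomial.totalDegree_pow _ k).trans (Nat.mul_le_mul_left k hlin)
    have hmul := MvPolynomial.totalDegree_mul (MvPolynomial.C (a k l (‖y‖ ^ 2 / r)))
      ((MvPolynomial.C r⁻¹ * ∑ i : Fin d, MvPolynomial.X i ^ 2 - MvPolynomial.C 1) ^ l)
    rw [MvPolynomial.totalDegree_C] at hmul
    have := hdeg k l _ h
    exact (MvPolynomial.totalDegree_mul _ _).trans (by omega)

lemma abs_shellPoly_le {s t w Y : ℝ} (ha : ∀ k ≤ M, ∀ l ≤ M, |a k l t| ≤ C) (hs : |s - 1| ≤ Y)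
    (hw : |w| ≤ Y) (hY : 1 ≤ Y) : |shellPoly a M s t w| ≤ (M + 1) ^ 2 * C * Y ^ (2 * M) := by
  have : 0 ≤ Y := zero_le_one.trans hY
  have hterm : ∀ k ∈ Finset.range (M + 1), ∀ l ∈ Finset.range (M + 1),
      |a k l t * (s - 1) ^ l * w ^ k| ≤ C * Y ^ (2 * M) := by
    intro k hk l hl
    rw [Finset.mem_range_succ_iff] at hk hl
    have hC : 0 ≤ C := (abs_nonneg _).trans (ha k hk l hl)
    rw [abs_mul, abs_mul, abs_pow, abs_pow, mul_assoc]
    calc |a k l t| * (|s - 1| ^ l * |w| ^ k) ≤ C * (Y ^ l * Y ^ k) := by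
          gcongr
          exact ha k hk l hl
      _ ≤ C * Y ^ (2 * M) := by
          rw [← pow_add]
          gcongr
          omega
  calc |shellPoly a M s t w|
      ≤ ∑ _k ∈ Finset.range (M + 1), ∑ _l ∈ Finset.range (M + 1), C * Y ^ (2 * M) :=
        (Finset.abs_sum_le_sum_abs _ _).trans <| Finset.sum_le_sum fun k hk =>
          (Finset.abs_sum_le_sum_abs _ _).trans <| Finset.sum_le_sum fun l hl => hterm k hk l hl
    _ = (M + 1) ^ 2 * C * Y ^ (2 * M) := by
        simp only [Finset.sum_const, Finset.card_range, nsmul_eq_mul]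
        push_cast
        ring

lemma abs_inner_div_le (hr : 0 < r) {x y : E d} (hy : ‖y‖ ^ 2 / r ≤ 2) :
    |inner ℝ x y / r| ≤ 1 + ‖x‖ ^ 2 / r := by
  rw [div_le_iff₀ hr] at hy
  rw [abs_div, abs_of_pos hr, div_le_iff₀ hr, add_mul, one_mul, div_mul_cancel₀ _ hr.ne']
  nlinarith [abs_real_inner_le_norm x y, sq_nonneg (‖x‖ - ‖y‖)]

lemma abs_sum_mul_le {α u : Fin n → ℝ} {b : ℝ} (hu : ∀ i, |u i| ≤ b) :
    |∑ i, α i * u i| ≤ (∑ i, |α i|) * b := by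
  rw [Finset.sum_mul]
  refine (Finset.abs_sum_le_sum_abs _ _).trans (Finset.sum_le_sum fun i _ => ?_)
  rw [abs_mul]
  exact mul_le_mul_of_nonneg_left (hu i) (abs_nonneg _)

lemma sum_abs_le_of_sq_mul_sum_sq_le {c A : ℝ} (hc : 0 < c) (hA : 0 ≤ A) {α f : Fin n → ℝ}
    (hα : c ^ 2 * ∑ i, α i ^ 2 ≤ ∑ i, f i ^ 2) (hf : ∀ i, |f i| ≤ A) :
    ∑ i, |α i| ≤ c⁻¹ * (A * n) := by
  have hcauchy : (∑ i, |α i|) ^ 2 ≤ n * ∑ i, α i ^ 2 := by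
    simpa using sq_sum_le_card_mul_sum_sq (s := Finset.univ) (f := fun i => |α i|)
  have hsum : ∑ i, f i ^ 2 ≤ n * A ^ 2 :=
    (Finset.sum_le_card_nsmul _ _ _ fun i _ => sq_le_sq' (abs_le.1 (hf i)).1
      (abs_le.1 (hf i)).2).trans_eq (by simp)
  rw [inv_mul_eq_div, le_div_iff₀ hc]
  refine le_of_sq_le_sq ?_ (by positivity)
  calc ((∑ i, |α i|) * c) ^ 2 = c ^ 2 * (∑ i, |α i|) ^ 2 := by ring
    _ ≤ c ^ 2 * (n * ∑ i, α i ^ 2) := by gcongr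
    _ = n * (c ^ 2 * ∑ i, α i ^ 2) := by ring
    _ ≤ n * (n * A ^ 2) := mul_le_mul_of_nonneg_left (hα.trans hsum) n.cast_nonneg
    _ = (A * n) ^ 2 := by ring

lemma ShellApprox.abs_scaledKernel_sub_le (h : ShellApprox g a M T C δ) (hr : 0 < r) {x y : E d}
    (hx : ‖x‖ ^ 2 / r ∈ shell T δ) (hy : ‖y‖ ^ 2 / r ∈ shell T δ) (hxy : |inner ℝ x y / r| ≤ δ) :
    |scaledKernel g r x y - shellPoly a M (‖x‖ ^ 2 / r) (‖y‖ ^ 2 / r) (inner ℝ x y / r)| ≤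
      C * δ ^ (M + 1) := by
  rw [scaledKernel_eq_rotKernel g hr]
  simp only [← norm_sq_inv_sqrt_smul hr, ← inner_inv_sqrt_smul hr] at hx hy hxy ⊢
  exact h.abs_sub_le _ _ hx hy hxy

/-- The polynomial `p` of degree at most `m` stands in for a kernel combination `f` at the centers
`xs` whose coefficients have `ℓ¹`-norm of order `L`. -/
structure IsBarrierPolynomial (g : ℝ → ℝ → ℝ → ℝ) (M m : ℕ) (T : Set ℝ) (r δ L : ℝ)
    (xs : Fin n → E d) (f : E d → ℝ) (p : MvPolynomial (Fin d) ℝ) : Prop where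
  totalDegree_le : p.totalDegree ≤ m
  abs_eval_le : ∀ x : E d, |MvPolynomial.eval (fun i => x i) p| ≤ L * (1 + ‖x‖ ^ 2 / r) ^ (2 * M)
  abs_sub_le : ∀ x : E d, ‖x‖ ^ 2 / r ∈ shell T δ → (∀ i, |inner ℝ x (xs i) / r| ≤ δ) →
    |f x - MvPolynomial.eval (fun i => x i) p| ≤ L * δ ^ (M + 1)
  abs_le : ∀ (x : E d) (H : ℝ), 0 ≤ H → (∀ i, |scaledKernel g r x (xs i)| ≤ H) → |f x| ≤ L * H

lemma ShellApprox.isBarrierPolynomial (h : ShellApprox g a M T C δ)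
    (hdeg : ∀ k l t, a k l t ≠ 0 → k + 2 * l ≤ m) (hr : 0 < r) (hδ : δ ≤ 1) {xs : Fin n → E d}
    (hxs : ∀ i, ‖xs i‖ ^ 2 / r ∈ shell T δ) (hC : 0 ≤ C) {α : Fin n → ℝ} {L : ℝ}
    (hα : (∑ i, |α i|) * ((M + 1) ^ 2 * C + 1) ≤ L) :
    IsBarrierPolynomial g M m T r δ L xs (fun x => ∑ i, α i * scaledKernel g r x (xs i))
      (∑ i, MvPolynomial.C (α i) * shellMvPolynomial a M r (xs i)) := by
  have heval (x : E d) : MvPolynomial.eval (fun i => x i)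
      (∑ i, MvPolynomial.C (α i) * shellMvPolynomial a M r (xs i)) =
        ∑ i, α i * shellPoly a M (‖x‖ ^ 2 / r) (‖xs i‖ ^ 2 / r) (inner ℝ x (xs i) / r) := by
    simp only [map_sum, map_mul, MvPolynomial.eval_C, eval_shellMvPolynomial]
  have hα0 : 0 ≤ ∑ i, |α i| := Finset.sum_nonneg fun i _ => abs_nonneg _
  have hL {b H : ℝ} (hb : b ≤ (M + 1) ^ 2 * C + 1) (hH : 0 ≤ H) :
      (∑ i, |α i|) * (b * H) ≤ L * H := by
    rw [← mul_assoc]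
    exact mul_le_mul_of_nonneg_right ((mul_le_mul_of_nonneg_left hb hα0).trans hα) hH
  refine ⟨MvPolynomial.totalDegree_finsetSum_le fun i _ => ?_, fun x => ?_, fun x hx hxi => ?_,
    fun x H hH hk => (abs_sum_mul_le hk).trans ?_⟩
  · refine (MvPolynomial.totalDegree_mul _ _).trans ?_
    rw [MvPolynomial.totalDegree_C, zero_add]
    exact totalDegree_shellMvPolynomial_le hdeg _
  · have hs : 0 ≤ ‖x‖ ^ 2 / r := by positivity
    rw [heval]
    refine (abs_sum_mul_le fun i => abs_shellPoly_le (fun k hk l hl => h.abs_coeff_le k hk l hl _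
      (hxs i).2) (abs_le.2 ⟨?_, ?_⟩) (abs_inner_div_le hr ?_) ?_).trans
      (hL (by linarith) (by positivity))
    · linarith
    · linarith
    · linarith [(abs_le.1 (hxs i).2).2]
    · linarith
  · have hδ0 : 0 ≤ δ := (abs_nonneg _).trans hx.2
    rw [heval, ← Finset.sum_sub_distrib]
    simp only [← mul_sub]
    refine (abs_sum_mul_le fun i => h.abs_scaledKernel_sub_le hr hx (hxs i) (hxi i)).trans
      (hL ?_ (by positivity))
    nlinarith [mul_nonneg M.cast_nonneg hC, mul_nonneg (mul_nonneg M.cast_nonneg M.cast_nonneg) hC]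
  · have hone : 1 ≤ (M + 1) ^ 2 * C + 1 := by
      have : 0 ≤ (M + 1) ^ 2 * C := by positivity
      linarith
    simpa only [one_mul] using hL hone hH

theorem BarrierKernel.exists_isBarrierPolynomial (hg : BarrierKernel g M m T) :
    ∃ K η : ℝ, 0 ≤ K ∧ 0 < η ∧ ∀ᶠ δ in 𝓝[>] 0, ∀ {d n : ℕ} {r : ℝ} {xs : Fin n → E d}, 0 < r →
      NearOrthonormal T δ (fun i => (√r)⁻¹ • xs i) → n * δ ^ (M + 1) ≤ η →
      ∀ {lam A : ℝ} (κ : Kernel (E d) ℝ) [IsMarkovKernel κ], 0 ≤ lam →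
      (∀ i, Integrable (fun y : ℝ => y) (κ (xs i))) → 0 ≤ A → (∀ i, |groundTruth κ (xs i)| ≤ A) →
      ∃ p, IsBarrierPolynomial g M m T r δ (K * A * n) xs
        (averagedEstimate (scaledKernel g r) lam κ xs) p := by
  obtain ⟨a, C, hC, hdeg, happ⟩ := hg.approx
  obtain ⟨c, η, hc, hη, hcoer⟩ := hg.coercive
  refine ⟨c⁻¹ * ((M + 1) ^ 2 * C + 1), η, by positivity, hη, ?_⟩
  filter_upwards [happ, hcoer, Ioo_mem_nhdsGT one_pos] with δ happ hcoer hδ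
  intro d n r xs hr hxs hn lam A κ _ hlam hint hA hf
  obtain ⟨α, hα, hα2⟩ := exists_averagedEstimate_eq
    (isPSDKernelOn_scaledKernel (hg.posSemidef d) hr)
    hlam κ hint hc fun v => (hcoer _ hn hxs v).trans_eq (kernelForm_scaledKernel g hr xs v).symm
  have hsum := sum_abs_le_of_sq_mul_sum_sq_le hc hA hα2 hf
  have hbar := happ.isBarrierPolynomial hdeg hr hδ.2.le
    ((nearOrthonormal_inv_sqrt_smul_iff hr).1 hxs).1 hC (α := α)
    (L := c⁻¹ * ((M + 1) ^ 2 * C + 1) * A * n) <| by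
      calc _ ≤ c⁻¹ * (A * n) * ((M + 1) ^ 2 * C + 1) := by gcongr
        _ = _ := by ring
  rw [← funext hα] at hbar
  exact ⟨_, hbar⟩

end BarrierPolynomial

/-! ### Random inputs -/

section Rates

lemma tendsto_natCast_rpow_neg_nhdsGT {θ : ℝ} (hθ : 0 < θ) :
    Tendsto (fun n : ℕ => (n : ℝ) ^ (-θ)) atTop (𝓝[>] 0) := by
  refine tendsto_nhdsWithin_iff.2
    ⟨(tendsto_rpow_neg_atTop hθ).comp tendsto_natCast_atTop_atTop, ?_⟩
  filter_upwards [eventually_gt_atTop 0] with n hn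
  exact Real.rpow_pos_of_pos (Nat.cast_pos.2 hn) _

lemma tendsto_natCast_mul_rpow_neg_pow {θ : ℝ} {k : ℕ} (h : 1 < θ * k) :
    Tendsto (fun n : ℕ => n * ((n : ℝ) ^ (-θ)) ^ k) atTop (𝓝 0) := by
  refine ((tendsto_rpow_neg_atTop (sub_pos.2 h)).comp tendsto_natCast_atTop_atTop).congr' ?_
  filter_upwards [eventually_gt_atTop 0] with n hn
  have hn' : (0 : ℝ) < n := Nat.cast_pos.2 hn
  rw [Function.comp_apply, neg_sub, sub_eq_add_neg, Real.rpow_add hn', Real.rpow_one, ← neg_mul,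
    Real.rpow_mul_natCast hn'.le]

lemma eventually_div_pow_le_one_div_pow {s : ℕ → ℝ} {c γ : ℝ} (hc : 0 < c)
    (hs : ∀ᶠ n : ℕ in atTop, c * (n : ℝ) ^ γ ≤ s n) {q k : ℕ} (hq : k < γ * q) (C : ℝ) :
    ∀ᶠ n : ℕ in atTop, C / s n ^ q ≤ 1 / (n : ℝ) ^ k := by
  have hgrow : Tendsto (fun n : ℕ => c ^ q * (n : ℝ) ^ (γ * q - k)) atTop atTop :=
    ((tendsto_rpow_atTop (sub_pos.2 hq)).comp tendsto_natCast_atTop_atTop).const_mul_atTop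
      (pow_pos hc q)
  filter_upwards [hs, hgrow.eventually_ge_atTop C, eventually_gt_atTop 0] with n hsn hC hn
  have hn' : (0 : ℝ) < n := Nat.cast_pos.2 hn
  have hγ := Real.rpow_pos_of_pos hn' γ
  have hsn0 : 0 < s n := (mul_pos hc hγ).trans_le hsn
  rw [div_le_div_iff₀ (pow_pos hsn0 q) (pow_pos hn' k), one_mul]
  calc C * (n : ℝ) ^ k ≤ c ^ q * (n : ℝ) ^ (γ * q - k) * (n : ℝ) ^ k := by gcongr
    _ = (c * (n : ℝ) ^ γ) ^ q := by
        rw [mul_assoc, ← Real.rpow_natCast (n : ℝ) k, ← Real.rpow_add hn', sub_add_cancel,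
          Real.rpow_mul_natCast hn'.le, mul_pow]
    _ ≤ s n ^ q := by gcongr

lemma eventually_le_of_const_mul_rpow_le {r : ℕ → ℝ} {β c : ℝ} (hβ : 0 < β) (hc : 0 < c)
    (hr : ∀ᶠ n : ℕ in atTop, c * (n : ℝ) ^ β ≤ r n) (b : ℝ) : ∀ᶠ n in atTop, b ≤ r n :=
  (tendsto_atTop_mono' atTop hr (((tendsto_rpow_atTop hβ).comp
    tendsto_natCast_atTop_atTop).const_mul_atTop hc)).eventually_ge_atTop b

-- `δ n = n ^ (-θ)` with `1 / (M + 1) < θ < β / 2`: the left inequality makes `n δ ^ (M + 1)`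
-- tend to zero, and the right one makes `δ ^ 2 r` grow like a power of `n`.
lemma exists_threshold {β c : ℝ} (hβ : 0 < β) (hc : 0 < c) {r : ℕ → ℝ}
    (hr : ∀ᶠ n : ℕ in atTop, c * (n : ℝ) ^ β ≤ r n) {M : ℕ} (hM : 2 / β < M + 1) :
    ∃ δ : ℕ → ℝ, Tendsto δ atTop (𝓝[>] 0) ∧
      Tendsto (fun n : ℕ => n * δ n ^ (M + 1)) atTop (𝓝 0) ∧
      ∀ k : ℕ, ∀ᶠ q : ℕ in atTop, ∀ C : ℝ, ∀ᶠ n : ℕ in atTop,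
        C / (δ n ^ 2 * r n) ^ q ≤ 1 / (n : ℝ) ^ k := by
  have hM0 : (0 : ℝ) < M + 1 := by positivity
  have hlt : 1 / (M + 1 : ℝ) < β / 2 := by
    rw [div_lt_iff₀ hβ] at hM
    rw [div_lt_div_iff₀ hM0 two_pos]
    linarith
  obtain ⟨θ, hMθ, hθβ⟩ := exists_between hlt
  have hγ : 0 < β - 2 * θ := by linarith
  refine ⟨fun n => (n : ℝ) ^ (-θ), tendsto_natCast_rpow_neg_nhdsGT (lt_trans (by positivity) hMθ),
    tendsto_natCast_mul_rpow_neg_pow ?_, fun k => ?_⟩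
  · push_cast
    exact (div_lt_iff₀ hM0).1 hMθ
  filter_upwards [(tendsto_natCast_atTop_atTop.const_mul_atTop hγ).eventually_gt_atTop (k : ℝ)]
    with q hq C
  refine eventually_div_pow_le_one_div_pow hc (γ := β - 2 * θ) ?_ hq C
  filter_upwards [hr, eventually_gt_atTop 0] with n hrn hn
  have hn' : (0 : ℝ) < n := Nat.cast_pos.2 hn
  calc c * (n : ℝ) ^ (β - 2 * θ) = ((n : ℝ) ^ (-θ)) ^ 2 * (c * (n : ℝ) ^ β) := by
        rw [← Real.rpow_mul_natCast hn'.le, mul_left_comm, ← Real.rpow_add hn']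
        congr 2
        push_cast
        ring
    _ ≤ _ := by gcongr

end Rates

section Sampling

variable {d n : ℕ} {Ω : Type*} [MeasurableSpace Ω] {μ : Measure Ω} {Q : Measure (E d)}
  {T : Set ℝ} {r δ : ℝ} {ρ : ℝ≥0∞}

/-- The points whose norm is atypical or which are not nearly orthogonal to all the inputs `xs`. -/
def atypicalPoints (T : Set ℝ) (r δ : ℝ) (xs : Fin n → E d) : Set (E d) :=
  {x | ‖x‖ ^ 2 / r ∉ shell T δ} ∪ ⋃ i, {x | δ < |inner ℝ x (xs i) / r|}

lemma notMem_atypicalPoints {xs : Fin n → E d} {x : E d} : x ∉ atypicalPoints T r δ xs ↔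
    ‖x‖ ^ 2 / r ∈ shell T δ ∧ ∀ i, |inner ℝ x (xs i) / r| ≤ δ := by
  simp [atypicalPoints]

lemma measurableSet_atypicalPoints (hT : MeasurableSet T) (r δ : ℝ) (xs : Fin n → E d) :
    MeasurableSet (atypicalPoints T r δ xs) := by
  refine .union ((measurableSet_shell hT δ).compl.preimage
    (by fun_prop : Measurable fun x : E d => ‖x‖ ^ 2 / r)) (.iUnion fun i => ?_)
  exact measurableSet_lt measurable_const (by fun_prop)

/-- The tail estimates of `Concentrates` at one level `δ`, with probability bound `ρ`. -/
structure HasTailBound (Q : Measure (E d)) (T : Set ℝ) (r δ : ℝ) (ρ : ℝ≥0∞) : Prop where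
  norm_tail : Q {x | ‖x‖ ^ 2 / r ∉ shell T δ} ≤ ρ
  inner_tail : ∀ x' : E d, ‖x'‖ ^ 2 / r ≤ 2 → Q {x | δ < |inner ℝ x x' / r|} ≤ ρ

lemma Concentrates.hasTailBound {q : ℕ} {C : ℝ≥0} (h : Concentrates Q T r q C) (hδ : 0 < δ)
    (hδ' : δ ≤ 1 / 2) {b : ℝ} (hb : C / (δ ^ 2 * r) ^ q ≤ b) :
    HasTailBound Q T r δ (ENNReal.ofReal b) :=
  ⟨(h.norm_tail δ hδ hδ').trans (ENNReal.ofReal_le_ofReal hb), fun x' hx' =>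
    (h.inner_tail δ hδ hδ' x' hx').trans (ENNReal.ofReal_le_ofReal hb)⟩

lemma HasTailBound.measure_atypicalPoints_le (h : HasTailBound Q T r δ ρ)
    {xs : Fin n → E d} (hxs : ∀ i, ‖xs i‖ ^ 2 / r ≤ 2) :
    Q (atypicalPoints T r δ xs) ≤ ρ + n * ρ := by
  refine (measure_union_le _ _).trans (add_le_add h.norm_tail ?_)
  refine (measure_iUnion_fintype_le _ _).trans
    ((Finset.sum_le_sum fun i _ => h.inner_tail (xs i) (hxs i)).trans ?_)
  simp

-- Conditionally on the second input, this is a bound at a fixed point.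
lemma HasTailBound.measure_lt_abs_inner_le [IsProbabilityMeasure μ] [IsProbabilityMeasure Q]
    (h : HasTailBound Q T r δ ρ)
    {X Y : Ω → E d} (hX : HasLaw X Q μ) (hY : HasLaw Y Q μ) (hXY : IndepFun X Y μ) :
    μ {ω | ‖Y ω‖ ^ 2 / r ≤ 2 ∧ δ < |inner ℝ (X ω) (Y ω) / r|} ≤ ρ := by
  set D : Set (E d × E d) := {z | ‖z.2‖ ^ 2 / r ≤ 2 ∧ δ < |inner ℝ z.1 z.2 / r|} with hD
  have hDm : MeasurableSet D :=
    (measurableSet_le (by fun_prop : Measurable fun z : E d × E d => ‖z.2‖ ^ 2 / r)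
      measurable_const).inter (measurableSet_lt measurable_const
        (by fun_prop : Measurable fun z : E d × E d => |inner ℝ z.1 z.2 / r|))
  have hprod : μ.map (fun ω => (X ω, Y ω)) = Q.prod Q := by
    rw [(indepFun_iff_map_prod_eq_prod_map_map hX.aemeasurable hY.aemeasurable).1 hXY,
      hX.map_eq, hY.map_eq]
  calc μ ((fun ω => (X ω, Y ω)) ⁻¹' D)
      ≤ (Q.prod Q) D := by
        rw [← hprod]
        exact Measure.le_map_apply (hX.aemeasurable.prodMk hY.aemeasurable) _
    _ = ∫⁻ y, Q ((fun x => (x, y)) ⁻¹' D) ∂Q := Measure.prod_apply_symm hDm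
    _ ≤ ∫⁻ _, ρ ∂Q := by
        refine lintegral_mono fun y => ?_
        by_cases hy : ‖y‖ ^ 2 / r ≤ 2
        · exact (measure_mono fun x hx => hx.2).trans (h.inner_tail y hy)
        · simp [hD, hy]
    _ = ρ := by simp

lemma HasTailBound.measure_not_nearOrthonormal_le [IsProbabilityMeasure μ]
    [IsProbabilityMeasure Q] (h : HasTailBound Q T r δ ρ) (hr : 0 < r) (hδ : δ ≤ 1)
    {xs : Fin n → Ω → E d} (hlaw : ∀ i, HasLaw (xs i) Q μ)
    (hind : Pairwise fun i j => IndepFun (xs i) (xs j) μ) :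
    μ {ω | ¬NearOrthonormal T δ fun i => (√r)⁻¹ • xs i ω} ≤ n * (ρ + n * ρ) := by
  have hsub : {ω | ¬NearOrthonormal T δ fun i => (√r)⁻¹ • xs i ω} ⊆
      (⋃ i, xs i ⁻¹' {x | ‖x‖ ^ 2 / r ∉ shell T δ}) ∪
      ⋃ i, ⋃ j, {ω | i ≠ j ∧ ‖xs j ω‖ ^ 2 / r ≤ 2 ∧ δ < |inner ℝ (xs i ω) (xs j ω) / r|} := by
    intro ω hω
    contrapose! hω
    simp only [Set.mem_union, Set.mem_iUnion, not_or, not_exists, Set.mem_preimage,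
      Set.mem_ofPred_eq, not_not, not_and, not_lt] at hω ⊢
    refine (nearOrthonormal_inv_sqrt_smul_iff hr).2
      ⟨hω.1, fun i j hij => hω.2 i j hij ?_⟩
    linarith [(abs_le.1 (hω.1 j).2).2]
  have hsingle (i : Fin n) : μ (xs i ⁻¹' {x | ‖x‖ ^ 2 / r ∉ shell T δ}) ≤ ρ := by
    refine (Measure.le_map_apply (hlaw i).aemeasurable _).trans ?_
    rw [(hlaw i).map_eq]
    exact h.norm_tail
  have hpair (i j : Fin n) : μ {ω | i ≠ j ∧ ‖xs j ω‖ ^ 2 / r ≤ 2 ∧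
      δ < |inner ℝ (xs i ω) (xs j ω) / r|} ≤ ρ := by
    rcases eq_or_ne i j with hij | hij
    · simp [hij]
    · exact (measure_mono fun ω hω => hω.2).trans
        (h.measure_lt_abs_inner_le (hlaw i) (hlaw j) (hind hij))
  rw [mul_add]
  refine (measure_mono hsub).trans ((measure_union_le _ _).trans (add_le_add ?_ ?_))
  · refine (measure_iUnion_fintype_le _ _).trans ((Finset.sum_le_sum fun i _ => hsingle i).trans ?_)
    simp
  · refine (measure_iUnion_fintype_le _ _).trans ((Finset.sum_le_sum fun i _ =>
      (measure_iUnion_fintype_le _ _).trans (Finset.sum_le_sum fun j _ => hpair i j)).trans ?_)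
    simp

end Sampling

/-! ### Approximation in `L²` -/

section Norms

variable {X : Type*} [MeasurableSpace X] {μ : Measure X} {p : ℝ≥0∞}

-- The triangle inequality for a function `G` that need not be measurable.
lemma eLpNorm_le_add_of_abs_le {F G e : X → ℝ} (hF : Measurable F) (he : Measurable e)
    (hp : 1 ≤ p) (h : ∀ᵐ x ∂μ, |F x| ≤ |G x| + e x) :
    eLpNorm F p μ ≤ eLpNorm G p μ + eLpNorm e p μ := by
  set D : X → ℝ := fun x => max (|F x| - e x) 0
  have hD : Measurable D := by fun_prop
  calc eLpNorm F p μ ≤ eLpNorm (D + e) p μ :=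
        eLpNorm_mono_real fun x => sub_le_iff_le_add.1 (le_max_left (|F x| - e x) 0)
    _ ≤ eLpNorm D p μ + eLpNorm e p μ :=
        eLpNorm_add_le hD.aestronglyMeasurable he.aestronglyMeasurable hp
    _ ≤ eLpNorm G p μ + eLpNorm e p μ := by
        gcongr
        refine eLpNorm_mono_ae (h.mono fun x hx => ?_)
        rw [Real.norm_of_nonneg (le_max_right _ _), Real.norm_eq_abs]
        exact max_le (sub_le_iff_le_add.2 hx) (abs_nonneg _)

lemma eLpNorm_two_indicator_le {f : X → ℝ} (hf : Measurable f) {N : Set X} (hN : MeasurableSet N)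
    {t : ℝ≥0∞} (ht : μ N ≤ t ^ 4) : eLpNorm (N.indicator f) 2 μ ≤ eLpNorm f 4 μ * t := by
  rw [eLpNorm_indicator_eq_eLpNorm_restrict hN]
  refine (eLpNorm_le_eLpNorm_mul_rpow_measure_univ (q := 4) (by norm_num)
    hf.aestronglyMeasurable).trans ?_
  gcongr
  · exact Measure.restrict_le_self
  · rw [Measure.restrict_apply_univ]
    calc _ ≤ (t ^ 4) ^ (1 / (2 : ℝ≥0∞).toReal - 1 / (4 : ℝ≥0∞).toReal) := by
          gcongr
          norm_num
      _ = t := by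
          rw [← ENNReal.rpow_natCast, ← ENNReal.rpow_mul]
          norm_num

lemma eLpNorm_pow_le [IsProbabilityMeasure μ] {f : X → ℝ} (hf : Measurable f) {k q : ℕ}
    (hkq : p * k ≤ q) : eLpNorm (fun x => f x ^ k) p μ ≤ eLpNorm f q μ ^ k := by
  rcases eq_or_ne k 0 with rfl | hk
  · simpa using eLpNorm_le_of_ae_bound (C := 1) (p := p) (f := fun _ : X => (1 : ℝ))
      (ae_of_all μ (by simp))
  have hk' : (0 : ℝ) < k := by positivity
  have hnorm := eLpNorm_norm_rpow (p := p) (μ := μ) f hk'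
  rw [ENNReal.ofReal_natCast, ENNReal.rpow_natCast] at hnorm
  calc _ = eLpNorm (fun x => ‖f x‖ ^ (k : ℝ)) p μ :=
        eLpNorm_congr_norm_ae (ae_of_all _ fun x => by simp)
    _ ≤ _ := by
        rw [hnorm]
        gcongr
        exact eLpNorm_le_eLpNorm_of_exponent_le hkq hf.aestronglyMeasurable

end Norms

section Distance

variable {d m : ℕ} {P : Measure (E d)} {f h : E d → ℝ} {A : ℝ}

lemma polyDistSq_le {p : MvPolynomial (Fin d) ℝ} (hp : p.totalDegree ≤ m) :
    polyDistSq P f m ≤ eLpNorm (fun x => f x - MvPolynomial.eval (fun i => x i) p) 2 P ^ 2 :=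
  iInf₂_le p hp

lemma polyDistSq_le_sq [IsProbabilityMeasure P] (hf : ∀ᵐ x ∂P, |f x| ≤ A) :
    polyDistSq P f m ≤ ENNReal.ofReal A ^ 2 := by
  refine (polyDistSq_le (p := 0) (by simp)).trans ?_
  gcongr
  simpa using eLpNorm_le_of_ae_bound (f := f) (C := A) (p := 2) hf

lemma measurable_eval_mvPolynomial (p : MvPolynomial (Fin d) ℝ) :
    Measurable fun x : E d => MvPolynomial.eval (fun i => x i) p :=
  (p.continuous_eval.comp (by fun_prop)).measurable

lemma polyDistSq_le_add [IsProbabilityMeasure P] (hf : Measurable f) (hfA : ∀ᵐ x ∂P, |f x| ≤ A)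
    {p : MvPolynomial (Fin d) ℝ} (hp : p.totalDegree ≤ m) {e : E d → ℝ} (he : Measurable e)
    (hfp : ∀ᵐ x ∂P, |f x - MvPolynomial.eval (fun i => x i) p| ≤ |h x - f x| + e x)
    {u : ℝ≥0∞} (hu : eLpNorm e 2 P ≤ u) :
    polyDistSq P f m ≤ eLpNorm (fun x => h x - f x) 2 P ^ 2 +
      (2 * ENNReal.ofReal A * u + u ^ 2) := by
  set s := eLpNorm (fun x => h x - f x) 2 P
  rcases le_total (ENNReal.ofReal A) s with hs | hs
  · calc polyDistSq P f m ≤ ENNReal.ofReal A ^ 2 := polyDistSq_le_sq hfA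
      _ ≤ s ^ 2 := by gcongr
      _ ≤ _ := le_self_add
  · calc polyDistSq P f m ≤ (s + u) ^ 2 := by
          refine (polyDistSq_le hp).trans ?_
          gcongr
          exact (eLpNorm_le_add_of_abs_le (hf.sub (measurable_eval_mvPolynomial p)) he one_le_two
            hfp).trans (by gcongr)
      _ = s ^ 2 + (2 * s * u + u ^ 2) := by ring
      _ ≤ _ := by gcongr

end Distance

section Envelope

variable {g : ℝ → ℝ → ℝ → ℝ} {M m d n : ℕ} {T : Set ℝ} {δ r L : ℝ} {xs : Fin n → E d}
  {f : E d → ℝ} {p : MvPolynomial (Fin d) ℝ} {Q : Measure (E d)} [IsProbabilityMeasure Q]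

/-- An `L²`-small error `e` for replacing `f` by the polynomial `p`: a value of size at most `b` is,
up to `e`, at least as far from `f` as it is from `p`. -/
structure IsEnvelope (Q : Measure (E d)) (b : ℝ) (u : ℝ≥0∞) (f : E d → ℝ)
    (p : MvPolynomial (Fin d) ℝ) (e : E d → ℝ) : Prop where
  measurable : Measurable e
  eLpNorm_le : eLpNorm e 2 Q ≤ u
  abs_sub_eval_le : ∀ (z : E d) (v : ℝ), |v| ≤ b →
    |v - MvPolynomial.eval (fun i => z i) p| ≤ |f z - v| + e z

-- The envelope is `L δ ^ (M + 1)` off the atypical points, where `f` is close to `p`, and a bound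
-- for `|v| + |p|` on them.
lemma IsBarrierPolynomial.exists_isEnvelope (hp : IsBarrierPolynomial g M m T r δ L xs f p)
    (hT : MeasurableSet T) (hr : 0 < r) (hδ : 0 ≤ δ) (hL : 0 ≤ L) {D : ℝ≥0}
    (hD : eLpNorm (fun x : E d => (1 + ‖x‖ ^ 2 / r) ^ (2 * M)) 4 Q ≤ D) {t : ℝ} (ht : 0 ≤ t)
    (hbad : Q (atypicalPoints T r δ xs) ≤ ENNReal.ofReal t ^ 4) {b : ℝ} (hb : 0 ≤ b) :
    ∃ e, IsEnvelope Q b (ENNReal.ofReal (L * δ ^ (M + 1) + (b + L) * (D * t))) f p e := by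
  set N := atypicalPoints T r δ xs
  set Y : E d → ℝ := fun x => (1 + ‖x‖ ^ 2 / r) ^ (2 * M)
  have hN : MeasurableSet N := measurableSet_atypicalPoints hT r δ xs
  have hY : Measurable Y := by fun_prop
  have hY1 (x : E d) : 1 ≤ Y x := one_le_pow₀ (le_add_of_nonneg_right (by positivity))
  have hIY : Measurable (N.indicator Y) := hY.indicator hN
  refine ⟨(fun _ => L * δ ^ (M + 1)) + (b + L) • N.indicator Y,
    measurable_const.add (hIY.const_smul _), ?_, fun z v hv => ?_⟩
  · refine (eLpNorm_add_le aestronglyMeasurable_const (hIY.const_smul _).aestronglyMeasurable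
      one_le_two).trans ?_
    rw [ENNReal.ofReal_add (by positivity) (by positivity)]
    refine add_le_add (eLpNorm_le_of_ae_bound (C := L * δ ^ (M + 1)) (ae_of_all _ fun _ =>
      (Real.norm_of_nonneg (by positivity)).le) |>.trans_eq (by simp)) ?_
    rw [eLpNorm_const_smul, Real.enorm_of_nonneg (by positivity),
      ENNReal.ofReal_mul (by positivity), ENNReal.ofReal_mul (p := (D : ℝ)) D.coe_nonneg,
      ENNReal.ofReal_coe_nnreal]
    gcongr
    exact (eLpNorm_two_indicator_le hY hN hbad).trans (by gcongr)
  · simp only [Pi.add_apply, Pi.smul_apply, smul_eq_mul]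
    by_cases hz : z ∈ N
    · have heval := hp.abs_eval_le z
      rw [Set.indicator_of_mem hz]
      have hbY : b ≤ b * Y z := le_mul_of_one_le_right hb (hY1 z)
      have hLδ : 0 ≤ L * δ ^ (M + 1) := by positivity
      linarith [abs_sub v (MvPolynomial.eval (fun i => z i) p), abs_nonneg (f z - v)]
    · obtain ⟨hnorm, hinner⟩ := notMem_atypicalPoints.1 hz
      rw [Set.indicator_of_notMem hz, mul_zero, add_zero]
      have htri := _root_.abs_sub_le v (f z) (MvPolynomial.eval (fun i => z i) p)
      rw [abs_sub_comm v (f z)] at htri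
      linarith [hp.abs_sub_le z hnorm hinner]

end Envelope

/-! ### Regression on random inputs -/

section BorelCantelli

lemma ae_eventually_of_eventually_measure_le {Ω : Type*} [MeasurableSpace Ω] {μ : Measure Ω}
    {p : ℕ → Ω → Prop} {b : ℕ → ℝ} (hb : Summable b)
    (h : ∀ᶠ n in atTop, μ {ω | ¬p n ω} ≤ ENNReal.ofReal (b n)) :
    ∀ᵐ ω ∂μ, ∀ᶠ n in atTop, p n ω := by
  obtain ⟨n₀, hn₀⟩ := eventually_atTop.1 h
  have hsum : ∑' n, μ {ω | ¬p (n + n₀) ω} ≠ ∞ :=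
    ne_top_of_le_ne_top ((summable_nat_add_iff n₀).2 hb).tsum_ofReal_ne_top
      (ENNReal.tsum_le_tsum fun n => hn₀ _ (Nat.le_add_left _ _))
  filter_upwards [ae_eventually_notMem hsum] with ω hω
  rw [← map_add_atTop_eq_nat n₀, eventually_map]
  exact hω.mono fun n hn => not_not.1 hn

lemma natCast_mul_ofReal_div_pow_succ {n : ℕ} (hn : 0 < n) (a : ℝ) (k : ℕ) :
    (n : ℝ≥0∞) * ENNReal.ofReal (a / (n : ℝ) ^ (k + 1)) = ENNReal.ofReal (a / (n : ℝ) ^ k) := by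
  rw [← ENNReal.ofReal_natCast, ← ENNReal.ofReal_mul n.cast_nonneg]
  congr 1
  field_simp
  ring

lemma ofReal_add_natCast_mul_le {n : ℕ} (hn : 0 < n) (k : ℕ) :
    ENNReal.ofReal (1 / (n : ℝ) ^ (k + 1)) + n * ENNReal.ofReal (1 / (n : ℝ) ^ (k + 1)) ≤
      ENNReal.ofReal (2 / (n : ℝ) ^ k) := by
  have hn' : (1 : ℝ) ≤ n := Nat.one_le_cast.2 hn
  rw [natCast_mul_ofReal_div_pow_succ hn, ← ENNReal.ofReal_add (by positivity) (by positivity),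
    ← one_add_one_eq_two, add_div]
  gcongr
  exact k.le_succ

end BorelCantelli

section Threshold

variable {d : ℕ → ℕ} {T : Set ℝ} {β c A : ℝ} {r δ : ℕ → ℝ} {P : ∀ n, Measure (E (d n))} {M m : ℕ}
  {g : ℝ → ℝ → ℝ → ℝ} {D : ℝ≥0}

/-- `δ` is a sequence of levels for which atypical inputs are polynomially rare under `P`, whose
power `δ ^ (M + 1)` is small compared to `1 / n`, and `D` bounds the moments which are needed to
control polynomials at atypical inputs. -/
structure IsThreshold (T : Set ℝ) (M : ℕ) (r : ℕ → ℝ) (P : ∀ n, Measure (E (d n))) (δ : ℕ → ℝ)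
    (D : ℝ≥0) : Prop where
  tendsto : Tendsto δ atTop (𝓝[>] 0)
  tendsto_mul_pow : Tendsto (fun n : ℕ => n * δ n ^ (M + 1)) atTop (𝓝 0)
  hasTailBound : ∀ᶠ n : ℕ in atTop,
    HasTailBound (P n) T (r n) (δ n) (ENNReal.ofReal (1 / (n : ℝ) ^ 9))
  moment : ∀ᶠ n in atTop,
    eLpNorm (fun x : E (d n) => (1 + ‖x‖ ^ 2 / r n) ^ (2 * M)) 4 (P n) ≤ D

lemma IsThreshold.eventually_mem_Ioc (h : IsThreshold T M r P δ D) {b : ℝ} (hb : 0 < b) :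
    ∀ᶠ n in atTop, δ n ∈ Set.Ioc 0 b :=
  h.tendsto.eventually (Ioc_mem_nhdsGT hb)

lemma exists_isThreshold [∀ n, IsProbabilityMeasure (P n)] (hβ : 0 < β) (hc : 0 < c)
    (hr : ∀ᶠ n : ℕ in atTop, c * (n : ℝ) ^ β ≤ r n) (hM : 2 / β < M + 1)
    (hP : ∀ q : ℕ, q ≠ 0 → ∃ C : ℝ≥0, ∀ᶠ n in atTop, Concentrates (P n) T (r n) q C) :
    ∃ (δ : ℕ → ℝ) (D : ℝ≥0), IsThreshold T M r P δ D := by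
  obtain ⟨δ, hδ, hδM, hδr⟩ := exists_threshold hβ hc hr hM
  obtain ⟨q, hq, hqM⟩ := ((hδr 9).and (eventually_ge_atTop (4 * M + 1))).exists
  obtain ⟨C, hC⟩ := hP q (by omega)
  refine ⟨δ, C ^ (2 * M), hδ, hδM, ?_, ?_⟩
  · filter_upwards [hC, hq C, hδ.eventually (Ioc_mem_nhdsGT one_half_pos)] with n hCn hqn hδn
    exact hCn.hasTailBound hδn.1 hδn.2 hqn
  · filter_upwards [hC] with n hCn
    refine (eLpNorm_pow_le (q := 2 * q) (by fun_prop) ?_).trans ?_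
    · exact_mod_cast (by omega : 4 * (2 * M) ≤ 2 * q)
    · rw [ENNReal.coe_pow]
      gcongr
      exact hCn.moment

lemma IsThreshold.ae_eventually_nearOrthonormal {Ω : Type*} [MeasurableSpace Ω] {μ : Measure Ω}
    [IsProbabilityMeasure μ] [∀ n, IsProbabilityMeasure (P n)] (h : IsThreshold T M r P δ D)
    (hr : ∀ᶠ n in atTop, 0 < r n) {x : ∀ n, Fin n → Ω → E (d n)}
    (hlaw : ∀ n i, HasLaw (x n i) (P n) μ)
    (hind : ∀ n, Pairwise fun i j => IndepFun (x n i) (x n j) μ) :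
    ∀ᵐ ω ∂μ, ∀ᶠ n in atTop, NearOrthonormal T (δ n) fun i => (√(r n))⁻¹ • x n i ω := by
  refine ae_eventually_of_eventually_measure_le
    ((Real.summable_one_div_nat_pow (p := 7)).2 (by norm_num) |>.mul_left 2) ?_
  filter_upwards [h.hasTailBound, h.eventually_mem_Ioc one_pos, hr, eventually_gt_atTop 0]
    with n htail hδ hrn hn
  rw [mul_one_div, ← natCast_mul_ofReal_div_pow_succ hn]
  refine (htail.measure_not_nearOrthonormal_le hrn hδ.2 (hlaw n) (hind n)).trans ?_
  gcongr
  exact ofReal_add_natCast_mul_le hn 8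

lemma HasTailBound.exists_isEnvelope {n d : ℕ} {Q : Measure (E d)} [IsProbabilityMeasure Q]
    {r δ K b : ℝ} {xs : Fin n → E d} {f : E d → ℝ} {p : MvPolynomial (Fin d) ℝ}
    (h : HasTailBound Q T r δ (ENNReal.ofReal (1 / (n : ℝ) ^ 9))) (hT : MeasurableSet T)
    (hr : 0 < r) (hδ : δ ∈ Set.Ioc 0 1)
    (hD : eLpNorm (fun x : E d => (1 + ‖x‖ ^ 2 / r) ^ (2 * M)) 4 Q ≤ D)
    (hxs : NearOrthonormal T δ fun i => (√r)⁻¹ • xs i) (hn : 0 < n) (hK : 0 ≤ K) (hb : 0 ≤ b)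
    (hp : IsBarrierPolynomial g M m T r δ (K * n) xs f p) :
    ∃ e, IsEnvelope Q (b * n)
      (ENNReal.ofReal (K * (n * δ ^ (M + 1)) + (b + K) * D * (2 / n))) f p e := by
  have : (0 : ℝ) < n := Nat.cast_pos.2 hn
  have hbad : Q (atypicalPoints T r δ xs) ≤ ENNReal.ofReal (2 / (n : ℝ) ^ 2) ^ 4 := by
    refine (h.measure_atypicalPoints_le fun i => ?_).trans
      ((ofReal_add_natCast_mul_le hn 8).trans ?_)
    · linarith [(abs_le.1 (((nearOrthonormal_inv_sqrt_smul_iff hr).1 hxs).1 i).2).2, hδ.2]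
    · rw [← ENNReal.ofReal_pow (by positivity), div_pow, ← pow_mul]
      gcongr
      norm_num
  convert hp.exists_isEnvelope hT hr hδ.1.le (by positivity) hD (by positivity) hbad
    (b := b * n) (by positivity) using 4
  field_simp

end Threshold

lemma exists_seq_of_eventually_exists {α : ℕ → Type*} {p q : ∀ n, α n → Prop}
    (hp : ∀ n, ∃ a, p n a) (h : ∀ᶠ n in atTop, ∃ a, p n a ∧ q n a) :
    ∃ a : ∀ n, α n, (∀ n, p n (a n)) ∧ ∀ᶠ n in atTop, q n (a n) := by
  have hsel (n : ℕ) : ∃ a, p n a ∧ ((∃ a', p n a' ∧ q n a') → q n a) := by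
    by_cases hn : ∃ a', p n a' ∧ q n a'
    · exact hn.imp fun a ha => ⟨ha.1, fun _ => ha.2⟩
    · exact (hp n).imp fun a ha => ⟨ha, fun hc => absurd hc hn⟩
  choose a ha hq using hsel
  exact ⟨a, ha, h.mono hq⟩

section Regression

variable {d : ℕ → ℕ} {T : Set ℝ} {β A : ℝ} {r : ℕ → ℝ} {P : ∀ n, Measure (E (d n))}
  {κ : ∀ n, Kernel (E (d n)) ℝ} {lam : ℕ → ℝ} {Ω : Type*} [MeasurableSpace Ω] {μ : Measure Ω}
  {x : ∀ n, Fin n → Ω → E (d n)} {M m : ℕ} {g : ℝ → ℝ → ℝ → ℝ}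

/-- For every `n`, kernel regression with ridge parameter `lam n` on `n` pairwise independent inputs
whose law `P n` concentrates at a scale `r n` that grows at least like `n ^ β`, for observations of
conditional law `κ n` with bounded conditional mean. -/
structure RegressionSetting (T : Set ℝ) (β A : ℝ) (r : ℕ → ℝ) (P : ∀ n, Measure (E (d n)))
    (κ : ∀ n, Kernel (E (d n)) ℝ) (lam : ℕ → ℝ) (μ : Measure Ω) (x : ∀ n, Fin n → Ω → E (d n)) :
    Prop where
  growth : ∃ c > 0, ∀ᶠ n : ℕ in atTop, c * (n : ℝ) ^ β ≤ r n
  concentrates : ∀ q : ℕ, q ≠ 0 → ∃ C : ℝ≥0, ∀ᶠ n in atTop, Concentrates (P n) T (r n) q C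
  integrable : ∀ n, ∀ᵐ z ∂P n, Integrable (fun y : ℝ => y) (κ n z)
  abs_groundTruth_le : ∀ n, ∀ᵐ z ∂P n, |groundTruth (κ n) z| ≤ A
  hasLaw : ∀ n i, HasLaw (x n i) (P n) μ
  indepFun : ∀ n, Pairwise fun i j => IndepFun (x n i) (x n j) μ
  ridge_nonneg : ∀ n, 0 ≤ lam n

/-- The averaged estimate for the `n`-th sample. -/
def sampleEstimate (g : ℝ → ℝ → ℝ → ℝ) (r : ℕ → ℝ) (κ : ∀ n, Kernel (E (d n)) ℝ) (lam : ℕ → ℝ)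
    (x : ∀ n, Fin n → Ω → E (d n)) (n : ℕ) (ω : Ω) : E (d n) → ℝ :=
  averagedEstimate (scaledKernel g (r n)) (lam n) (κ n) fun i => x n i ω

namespace RegressionSetting

lemma ae_forall_sample (h : RegressionSetting T β A r P κ lam μ x) {p : ∀ n, E (d n) → Prop}
    (hp : ∀ n, ∀ᵐ z ∂P n, p n z) : ∀ᵐ ω ∂μ, ∀ n i, p n (x n i ω) := by
  refine ae_all_iff.2 fun n => ae_all_iff.2 fun i =>
    ae_of_ae_map (p := p n) (h.hasLaw n i).aemeasurable ?_
  rw [(h.hasLaw n i).map_eq]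
  exact hp n

lemma eventually_pos (h : RegressionSetting T β A r P κ lam μ x) (hβ : 0 < β) :
    ∀ᶠ n in atTop, 0 < r n := by
  obtain ⟨c, hc, hr⟩ := h.growth
  exact (eventually_le_of_const_mul_rpow_le hβ hc hr 1).mono fun n hn => one_pos.trans_le hn

variable [∀ n, IsProbabilityMeasure (P n)]

lemma bound_nonneg (h : RegressionSetting T β A r P κ lam μ x) : 0 ≤ A :=
  let ⟨_, hz⟩ := (h.abs_groundTruth_le 0).exists
  (abs_nonneg _).trans hz

variable [∀ n, IsMarkovKernel (κ n)] [IsProbabilityMeasure μ]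

lemma ae_eventually_isBarrierPolynomial (h : RegressionSetting T β A r P κ lam μ x)
    (hβ : 0 < β) (hM : 2 / β < M + 1)
    (hg : BarrierKernel g M m T) :
    ∃ (K : ℝ) (δ : ℕ → ℝ) (D : ℝ≥0), 0 ≤ K ∧ IsThreshold T M r P δ D ∧
      ∀ᵐ ω ∂μ, ∀ᶠ n in atTop,
        (NearOrthonormal T (δ n) fun i => (√(r n))⁻¹ • x n i ω) ∧
        ∃ p, IsBarrierPolynomial g M m T (r n) (δ n) (K * n) (fun i => x n i ω)
          (sampleEstimate g r κ lam x n ω) p := by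
  obtain ⟨c, hc, hr⟩ := h.growth
  obtain ⟨δ, D, hδ⟩ := exists_isThreshold hβ hc hr hM h.concentrates
  obtain ⟨K, η, hK, hη, hbarrier⟩ := hg.exists_isBarrierPolynomial
  refine ⟨K * A, δ, D, mul_nonneg hK h.bound_nonneg, hδ, ?_⟩
  filter_upwards [hδ.ae_eventually_nearOrthonormal (h.eventually_pos hβ) h.hasLaw h.indepFun,
    h.ae_forall_sample h.integrable, h.ae_forall_sample h.abs_groundTruth_le]
    with ω hortho hint hbound
  filter_upwards [hortho, h.eventually_pos hβ, hδ.tendsto.eventually hbarrier,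
    hδ.tendsto_mul_pow.eventually_le_const hη] with n hxs hrn hbar hn
  exact ⟨hxs, hbar hrn hxs hn (κ n) (h.ridge_nonneg n) (hint n) h.bound_nonneg (hbound n)⟩

lemma ae_eventually_exists_isEnvelope (h : RegressionSetting T β A r P κ lam μ x)
    (hβ : 0 < β) (hM : 2 / β < M + 1)
    (hT : MeasurableSet T) (hg : BarrierKernel g M m T) :
    ∃ (K : ℝ) (δ : ℕ → ℝ), 0 ≤ K ∧ ∀ b : ℝ, 0 ≤ b → ∃ u : ℕ → ℝ≥0∞, Tendsto u atTop (𝓝 0) ∧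
      ∀ᵐ ω ∂μ, ∀ᶠ n in atTop, ∃ p e,
        IsBarrierPolynomial g M m T (r n) (δ n) (K * n) (fun i => x n i ω)
          (sampleEstimate g r κ lam x n ω) p ∧
        IsEnvelope (P n) (b * n) (u n) (sampleEstimate g r κ lam x n ω) p e := by
  obtain ⟨K, δ, D, hK, hδ, hbarrier⟩ := h.ae_eventually_isBarrierPolynomial hβ hM hg
  refine ⟨K, δ, hK, fun b hb => ⟨fun n => ENNReal.ofReal
    (K * (n * δ n ^ (M + 1)) + (b + K) * D * (2 / n)), ?_, ?_⟩⟩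
  · rw [← ENNReal.ofReal_zero]
    refine ENNReal.tendsto_ofReal ?_
    simpa using (hδ.tendsto_mul_pow.const_mul K).add
      ((tendsto_const_div_atTop_nhds_zero_nat 2).const_mul ((b + K) * D))
  filter_upwards [hbarrier] with ω hω
  filter_upwards [hω, h.eventually_pos hβ, hδ.eventually_mem_Ioc one_pos, hδ.hasTailBound,
    hδ.moment, eventually_gt_atTop 0] with n ⟨hxs, p, hp⟩ hrn hδn htail hmoment hn
  obtain ⟨e, he⟩ := htail.exists_isEnvelope hT hrn hδn hmoment hxs hn hK hb hp
  exact ⟨p, e, hp, he⟩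

theorem ae_eventually_polyDistSq_le (h : RegressionSetting T β A r P κ lam μ x)
    (hβ : 0 < β) (hM : 2 / β < M + 1)
    (hT : MeasurableSet T) (hg : BarrierKernel g M m T) :
    ∀ᵐ ω ∂μ, ∀ ε : ℝ, 0 < ε → ∀ᶠ n : ℕ in atTop,
      polyDistSq (P n) (groundTruth (κ n)) m ≤
        bias (P n) (scaledKernel g (r n)) (lam n) (κ n) (fun i => x n i ω) +
          ENNReal.ofReal ε := by
  obtain ⟨_, _, _, henv⟩ := h.ae_eventually_exists_isEnvelope hβ hM hT hg
  obtain ⟨u, hu, henv⟩ := henv A h.bound_nonneg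
  have herr : Tendsto (fun n => 2 * ENNReal.ofReal A * u n + u n ^ 2) atTop (𝓝 0) := by
    simpa using (ENNReal.Tendsto.const_mul hu (.inr (by finiteness))).add
      (ENNReal.Tendsto.pow hu (n := 2))
  filter_upwards [henv] with ω hω ε hε
  filter_upwards [hω, herr.eventually_le_const (ENNReal.ofReal_pos.2 hε), eventually_gt_atTop 0]
    with n ⟨p, e, hp, he⟩ hsmall hn
  have hmeas : Measurable (groundTruth (κ n)) :=
    (stronglyMeasurable_id.integral_kernel (κ := κ n)).measurable
  refine (polyDistSq_le_add hmeas (h.abs_groundTruth_le n) hp.totalDegree_le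
    he.measurable ?_ he.eLpNorm_le).trans (add_le_add_right hsmall _)
  filter_upwards [h.abs_groundTruth_le n] with z hz
  exact he.abs_sub_eval_le z _ <| hz.trans <|
    le_mul_of_one_le_right h.bound_nonneg (Nat.one_le_cast.2 hn)

theorem ae_exists_tendsto_eLpNorm_sub_zero (h : RegressionSetting T β A r P κ lam μ x)
    (hβ : 0 < β) (hM : 2 / β < M + 1)
    (hT : MeasurableSet T) (hg : BarrierKernel g M m T) {C : ℝ}
    (hC : ∀ n, ∀ z ∈ (P n).support, ∀ z' ∈ (P n).support, |scaledKernel g (r n) z z'| ≤ C) :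
    ∀ᵐ ω ∂μ, ∃ p : ∀ n, MvPolynomial (Fin (d n)) ℝ, (∀ n, (p n).totalDegree ≤ m) ∧
      Tendsto (fun n => eLpNorm (fun z => sampleEstimate g r κ lam x n ω z -
        MvPolynomial.eval (fun i => z i) (p n)) 2 (P n)) atTop (𝓝 0) := by
  have hsupport (n : ℕ) : (P n).support ∈ ae (P n) := Measure.support_mem_ae
  have hC0 : 0 ≤ C :=
    let ⟨z, hz⟩ := nonempty_of_mem (hsupport 0)
    (abs_nonneg _).trans (hC 0 z hz z hz)
  obtain ⟨K, δ, hK, henv⟩ := h.ae_eventually_exists_isEnvelope hβ hM hT hg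
  obtain ⟨u, hu, henv⟩ := henv (K * C) (by positivity)
  filter_upwards [henv, h.ae_forall_sample (p := fun n z => z ∈ (P n).support) hsupport]
    with ω hω hsample
  have hexists : ∀ᶠ n in atTop, ∃ p : MvPolynomial (Fin (d n)) ℝ, p.totalDegree ≤ m ∧
      eLpNorm (fun z => sampleEstimate g r κ lam x n ω z - MvPolynomial.eval (fun i => z i) p) 2
        (P n) ≤ u n := by
    filter_upwards [hω] with n ⟨p, e, hp, he⟩
    refine ⟨p, hp.totalDegree_le, (eLpNorm_mono_ae_real ?_).trans he.eLpNorm_le⟩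
    filter_upwards [hsupport n] with z hz
    have hfz : |sampleEstimate g r κ lam x n ω z| ≤ K * C * n :=
      (hp.abs_le z C hC0 fun i => hC n z hz _ (hsample n i)).trans_eq (by ring)
    simpa using he.abs_sub_eval_le z _ hfz
  obtain ⟨p, hdeg, hp⟩ := exists_seq_of_eventually_exists (fun n => ⟨0, by simp⟩) hexists
  exact ⟨p, hdeg, tendsto_of_tendsto_of_tendsto_of_le_of_le' tendsto_const_nhds hu
    (.of_forall fun _ => zero_le) hp⟩

end RegressionSetting

end Regression

lemma eventually_const_mul_rpow_le_of_tendsto_div {r : ℕ → ℝ} {β c c' : ℝ} (hc : c' < c)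
    (h : Tendsto (fun n : ℕ => r n / (n : ℝ) ^ β) atTop (𝓝 c)) :
    ∀ᶠ n : ℕ in atTop, c' * (n : ℝ) ^ β ≤ r n := by
  filter_upwards [h.eventually_const_lt hc, eventually_gt_atTop 0] with n hn hn0
  exact ((lt_div_iff₀ (by positivity)).1 hn).le

lemma DataModel.regressionSetting (model : DataModel) {β c A : ℝ} (hβ : 0 < β) (hc : 0 < c)
    {d : ℕ → ℕ} {R : ∀ n, Matrix (Fin (d n)) (Fin (d n)) ℝ} (hR : ∀ n, (R n).IsSymm)
    (hnorm : ∀ n, opNorm (R n * R n) = 1)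
    (hgrowth : ∀ᶠ n : ℕ in atTop, c * (n : ℝ) ^ β ≤ effDim (R n * R n))
    {ν : ℕ → Measure ℝ} [∀ n, IsProbabilityMeasure (ν n)] {v : ℝ≥0}
    (hν : ∀ n, HasSubgaussianMGF id v (ν n)) (hvar : ∀ n, ∫ w, w ^ 2 ∂ν n = 1)
    {κ : ∀ n, Kernel (E (d n)) ℝ}
    (hκ : ∀ n, ∀ᵐ x ∂(model.law (ν n) (R n * R n) (R n)), Integrable (fun y : ℝ => y) (κ n x))
    (hA : ∀ n, ∀ᵐ x ∂(model.law (ν n) (R n * R n) (R n)), |groundTruth (κ n) x| ≤ A)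
    {Ω : Type*} [MeasurableSpace Ω] {μ : Measure Ω} {x : ∀ n, Fin n → Ω → E (d n)}
    (hlaw : ∀ n i, HasLaw (x n i) (model.law (ν n) (R n * R n) (R n)) μ)
    (hindep : ∀ n, Pairwise fun i j => IndepFun (x n i) (x n j) μ)
    {lam : ℕ → ℝ} (hlam : ∀ n, 0 ≤ lam n) :
    RegressionSetting model.shells β A (fun n => effDim (R n * R n))
      (fun n => model.law (ν n) (R n * R n) (R n)) κ lam μ x where
  growth := ⟨c, hc, hgrowth⟩
  concentrates q hq := by
    obtain ⟨C, hC⟩ := model.exists_concentrates v hq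
    exact ⟨C, (eventually_le_of_const_mul_rpow_le hβ hc hgrowth 1).mono fun n hn =>
      hC (hν n) (hvar n) (hR n) (hnorm n) hn⟩
  integrable := hκ
  abs_groundTruth_le := hA
  hasLaw := hlaw
  indepFun := hindep
  ridge_nonneg := hlam

end PolyBarrier

end

theorem theorem1_general
    (model : PolyBarrier.DataModel) (β c : ℝ) (hβ : 0 < β) (hc : 0 < c)
    (M m : ℕ) (hM : 2 / β < M + 1) (g : ℝ → ℝ → ℝ → ℝ)
    (hg : PolyBarrier.BarrierKernel g M m model.shells)
    (d : ℕ → ℕ) (S R : ∀ n, Matrix (Fin (d n)) (Fin (d n)) ℝ)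
    (hR : ∀ n, (R n).IsSymm) (hRS : ∀ n, R n * R n = S n)
    (hnorm : ∀ n, PolyBarrier.opNorm (S n) = 1)
    (hdim : ∀ᶠ n : ℕ in atTop, c * (n : ℝ) ^ β ≤ PolyBarrier.effDim (S n))
    (v : ℝ≥0) (ν : ℕ → Measure ℝ) [∀ n, IsProbabilityMeasure (ν n)]
    (hν : ∀ n, HasSubgaussianMGF id v (ν n)) (hvar : ∀ n, ∫ w, w ^ 2 ∂ν n = 1)
    (P : ∀ n, Measure (PolyBarrier.E (d n))) (hP : ∀ n, P n = model.law (ν n) (S n) (R n))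
    (κ : ∀ n, Kernel (PolyBarrier.E (d n)) ℝ) [∀ n, IsMarkovKernel (κ n)]
    (hκ : ∀ n, ∀ᵐ x ∂(P n), Integrable (fun y : ℝ => y) (κ n x))
    (A : ℝ) (hA : ∀ n, ∀ᵐ x ∂(P n), |PolyBarrier.groundTruth (κ n) x| ≤ A)
    {Ω : Type*} [MeasurableSpace Ω] (μ : Measure Ω) [IsProbabilityMeasure μ]
    (x : ∀ n, Fin n → Ω → PolyBarrier.E (d n)) (hlaw : ∀ n i, HasLaw (x n i) (P n) μ)
    (hindep : ∀ n, Pairwise fun i j => IndepFun (x n i) (x n j) μ)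
    (lam : ℕ → ℝ) (hlam : ∀ n, 0 ≤ lam n) :
    (∀ᵐ ω ∂μ, ∀ ε : ℝ, 0 < ε → ∀ᶠ n : ℕ in atTop,
      PolyBarrier.polyDistSq (P n) (PolyBarrier.groundTruth (κ n)) m ≤
        PolyBarrier.bias (P n) (PolyBarrier.scaledKernel g (PolyBarrier.effDim (S n))) (lam n)
          (κ n) (fun i => x n i ω) + ENNReal.ofReal ε) ∧
    ((∃ C : ℝ, ∀ n, ∀ z ∈ (P n).support, ∀ z' ∈ (P n).support,
        |PolyBarrier.scaledKernel g (PolyBarrier.effDim (S n)) z z'| ≤ C) →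
      ∀ᵐ ω ∂μ, ∃ p : ∀ n, MvPolynomial (Fin (d n)) ℝ,
        (∀ n, (p n).totalDegree ≤ m) ∧
        Tendsto (fun n => eLpNorm (fun z =>
          PolyBarrier.averagedEstimate (PolyBarrier.scaledKernel g (PolyBarrier.effDim (S n)))
            (lam n) (κ n) (fun i => x n i ω) z - MvPolynomial.eval (fun i => z i) (p n))
          2 (P n)) atTop (𝓝 0)) := by
  obtain rfl : S = fun n => R n * R n := funext fun n => (hRS n).symm
  obtain rfl : P = fun n => model.law (ν n) (R n * R n) (R n) := funext hP
  have h := model.regressionSetting hβ hc hR hnorm hdim hν hvar hκ hA hlaw hindep hlam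
  exact ⟨h.ae_eventually_polyDistSq_le hβ hM model.measurableSet_shells hg,
    fun ⟨_, hC⟩ => h.ae_exists_tendsto_eLpNorm_sub_zero hβ hM model.measurableSet_shells hg hC⟩

theorem theorem1
    -- the type of input distribution, and the kernel
    (model : PolyBarrier.DataModel) (β c : ℝ) (hβ : 0 < β) (hc : 0 < c)
    (g : ℝ → ℝ → ℝ → ℝ) (hg : model.AdmissibleKernel β g)
    -- covariance matrices, their square roots, and the growth of the effective dimension
    (d : ℕ → ℕ) (S R : ∀ n, Matrix (Fin (d n)) (Fin (d n)) ℝ)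
    (hS : ∀ n, (S n).PosSemidef) (hR : ∀ n, (R n).PosSemidef) (hRS : ∀ n, R n * R n = S n)
    (hnorm : ∀ n, PolyBarrier.opNorm (S n) = 1)
    (hdim : Tendsto (fun n : ℕ => PolyBarrier.effDim (S n) / (n : ℝ) ^ β) atTop (𝓝 c))
    -- the coordinate laws and the input distributions
    (B : ℝ) (ν : ℕ → Measure ℝ) [∀ n, IsProbabilityMeasure (ν n)]
    (hν : ∀ n, PolyBarrier.IsEntryLaw B (ν n))
    (P : ∀ n, Measure (PolyBarrier.E (d n))) (hP : ∀ n, P n = model.law (ν n) (S n) (R n))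
    -- the conditional laws of the observations, with bounded ground truth
    (κ : ∀ n, Kernel (PolyBarrier.E (d n)) ℝ) [∀ n, IsMarkovKernel (κ n)]
    (hκ : ∀ n, ∀ᵐ x ∂(P n), Integrable (fun y : ℝ => y) (κ n x))
    (A : ℝ) (hA : ∀ n, ∀ᵐ x ∂(P n), |PolyBarrier.groundTruth (κ n) x| ≤ A)
    -- for every `n` a sample of `n` i.i.d. inputs of law `P n`
    {Ω : Type*} [MeasurableSpace Ω] (μ : Measure Ω) [IsProbabilityMeasure μ]
    (x : ∀ n, Fin n → Ω → PolyBarrier.E (d n))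
    (hlaw : ∀ n i, HasLaw (x n i) (P n) μ) (hindep : ∀ n, iIndepFun (x n) μ)
    -- the ridge parameters
    (lam : ℕ → ℝ) (hlam : ∀ n, 0 ≤ lam n) :
    (∀ᵐ ω ∂μ, ∀ ε : ℝ, 0 < ε → ∀ᶠ n : ℕ in atTop,
      PolyBarrier.polyDistSq (P n) (PolyBarrier.groundTruth (κ n)) (model.degree β) ≤
        PolyBarrier.bias (P n) (PolyBarrier.scaledKernel g (PolyBarrier.effDim (S n))) (lam n)
          (κ n) (fun i => x n i ω) + ENNReal.ofReal ε) ∧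
    ((∃ C : ℝ, ∀ n, ∀ z ∈ (P n).support, ∀ z' ∈ (P n).support,
        |PolyBarrier.scaledKernel g (PolyBarrier.effDim (S n)) z z'| ≤ C) →
      ∀ᵐ ω ∂μ, ∃ p : ∀ n, MvPolynomial (Fin (d n)) ℝ,
        (∀ n, (p n).totalDegree ≤ model.degree β) ∧
        Tendsto (fun n => eLpNorm (fun z =>
          PolyBarrier.averagedEstimate (PolyBarrier.scaledKernel g (PolyBarrier.effDim (S n)))
            (lam n) (κ n) (fun i => x n i ω) z - MvPolynomial.eval (fun i => z i) (p n))
          2 (P n)) atTop (𝓝 0)) :=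
  theorem1_general model β (c / 2) hβ (half_pos hc) _ _ (Nat.lt_floor_add_one _) g
    hg.barrierKernel d S R
    (fun n => Matrix.isHermitian_iff_isSymm.1 (hR n).isHermitian) hRS hnorm
    (PolyBarrier.eventually_const_mul_rpow_le_of_tendsto_div (half_lt_self hc) hdim) _ ν
    (fun n => (hν n).hasSubgaussianMGF) (fun n => (hν n).integral_sq) P hP κ hκ A hA μ x hlaw
    (fun n _ _ hij => (hindep n).indepFun hij) lam hlam
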